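/- **Definitions.** For $n,m,k\ge 0$ and $U\subseteq\mathbb R^n\times\mathbb C^m$ open, let $\mathcal O(U)$ be the algebra of smooth functions $U\to\mathbb C$ which are holomorphic in the $\mathbb C^m$-variables, and let $\mathbb A^{n,m|k}$ be the ringed superspace with base $\mathbb R^n\times\mathbb C^m$ and structure sheaf $\mathcal O\otimes_{\mathbb C}\bigwedge(\mathbb C^k)$. A *mixed supermanifold* is a locally ringed superspace $M=(M_0,\mathcal O_M)$ over $\mathbb C$ with second countable Hausdorff base such that every point has an open neighbourhood isomorphic to an open subspace of some $\mathbb A^{n,m|k}$. Let $\mathcal J_M$ be the sheaf of nilpotent sections and $\mathcal O_{M_0}=\mathcal O_M/\mathcal J_M$, a sheaf of complex valued functions; $(M_0,\mathcal O_{M_0})$ is again denoted by $M_0$. A morphism $\Theta$ of mixed supermanifolds has an underlying morphism $\Theta_0$ between the underlying spaces. An even vector field $X$ on $M$ is an even $\mathbb C$-linear superderivation of the sheaf $\mathcal O_M$; it induces the underlying vector field $\tilde X$ on $M_0$, and $X$ is called *real* if $\tilde X$ maps real valued functions to real valued functions. Let $X$ be an even vector field on $M$ and let $\mathcal V$ be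 an open subspace of $\mathbb R^1\times M$ containing $\{0\}\times M$. A *flow* of $X$ on $\mathcal V$ is a morphism $\Theta\colon\mathcal V\to M$ with $\partial_t\circ\Theta^\sharp=\Theta^\sharp\circ X$ and $\Theta|_{\{0\}\times M}=\mathrm{id}_M$. The subspace $\mathcal V$ is a *flow domain* of $X$ if, in addition, $\mathcal V\cap(\mathbb R\times\{x\})$ is an interval for every $x\in M_0$ and a flow of $X$ on $\mathcal V$ exists. The *maximal flow domain* is the flow domain that contains all flow domains (if there is one), and a *maximal flow* is a flow on it. The same definitions apply to $\tilde X$ on $M_0$. **Theorem.** Let $X$ be an even real vector field on a mixed supermanifold $M$, with underlying vector field $\tilde X$ on $M_0$. Then $X$ has a maximal flow domain $\mathcal V\subseteq\mathbb R^1\times M$, and there is exactly one flow $\Theta^X\colon\mathcal V\to M$ of $X$ on $\mathcal V$. Moreover, $\tilde X$ has a maximal flow domain, which is the underlying open subspace $\mathcal V_0\subseteq\mathbb R^1\times M_0$ of $\mathcal V$, and the underlying morphism $(\Theta^X)_0\colon\mathcal V_0\to M_0$ is the unique flow of $\tilde X$ on $\mathcal V_0$. -/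

import Mathlib

open TopologicalSpace
open scoped ContDiff

universe u v u' v'

noncomputable section

set_option linter.checkUnivs false

namespace MixedSuper

/-! ### Ringed superspaces over `ℂ` -/

/-- A ringed superspace over `ℂ`: a topological space with a sheaf of supercommutative
`ℂ`-superalgebras. The sheaf is given by its sections, its restriction maps and the unique gluing
property; `parity U 0` and `parity U 1` are the even and the odd sections over `U`. -/
structure RingedSuperspace where
  carrier : Type u
  [top : TopologicalSpace carrier]
  sections : Opens carrier → Type v
  [ring : ∀ U, Ring (sections U)]
  [algebra : ∀ U, Algebra ℂ (sections U)]
  res : ∀ {U V : Opens carrier}, U ≤ V → (sections V →ₐ[ℂ] sections U)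
  res_self : ∀ {U : Opens carrier} (f : sections U), res le_rfl f = f
  res_res : ∀ {U V W : Opens carrier} (h : U ≤ V) (k : V ≤ W) (f : sections W),
    res h (res k f) = res (h.trans k) f
  glue : ∀ {ι : Type u} (W : ι → Opens carrier) (s : ∀ i, sections (W i)),
    (∀ i j, res inf_le_left (s i) = res (inf_le_right : W i ⊓ W j ≤ W j) (s j)) →
      ∃! f : sections (iSup W), ∀ i, res (le_iSup W i) f = s i
  parity : ∀ U, ZMod 2 → Submodule ℂ (sections U)
  graded : ∀ U, SetLike.GradedMonoid (parity U)
  isCompl : ∀ U, IsCompl (parity U 0) (parity U 1)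
  res_parity : ∀ {U V : Opens carrier} (h : U ≤ V) (i : ZMod 2) (f : sections V),
    f ∈ parity V i → res h f ∈ parity U i
  even_comm : ∀ {U : Opens carrier} (f g : sections U), f ∈ parity U 0 → f * g = g * f
  odd_anticomm : ∀ {U : Opens carrier} (f g : sections U),
    f ∈ parity U 1 → g ∈ parity U 1 → f * g = -(g * f)

attribute [instance] RingedSuperspace.top RingedSuperspace.ring RingedSuperspace.algebra

instance : CoeSort RingedSuperspace.{u, v} (Type u) := ⟨RingedSuperspace.carrier⟩

namespace RingedSuperspace

theorem glue_cover (M : RingedSuperspace.{u, v}) {ι : Type u} {U : Opens M} (W : ι → Opens M)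
    (hU : U = iSup W) (hW : ∀ i, W i ≤ U) (s : ∀ i, M.sections (W i))
    (hs : ∀ i j (N : Opens M) (hi : N ≤ W i) (hj : N ≤ W j), M.res hi (s i) = M.res hj (s j)) :
    ∃! f : M.sections U, ∀ i, M.res (hW i) f = s i := by
  subst hU
  exact M.glue W s fun i j => hs i j _ _ _

/-- An open subset of the open subspace `V`, regarded as an open subset of `M`. -/
def imageOpens (M : RingedSuperspace.{u, v}) (V : Opens M) (W : Opens V) : Opens M :=
  ⟨Subtype.val '' (W : Set V), V.isOpen.isOpenMap_subtype_val _ W.isOpen⟩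

theorem imageOpens_mono (M : RingedSuperspace.{u, v}) (V : Opens M) {W W' : Opens V} (h : W ≤ W') :
    M.imageOpens V W ≤ M.imageOpens V W' :=
  Set.image_mono h

/-- The open subspace of `M` with base `V`. -/
def restrict (M : RingedSuperspace.{u, v}) (V : Opens M) : RingedSuperspace.{u, v} where
  carrier := V
  sections W := M.sections (M.imageOpens V W)
  res h := M.res (M.imageOpens_mono V h)
  res_self f := M.res_self f
  res_res h k f := M.res_res _ _ f
  glue W s hs := by
    refine M.glue_cover (fun i => M.imageOpens V (W i)) ?_ _ s ?_
    · ext x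
      simp only [imageOpens, Opens.coe_iSup, Set.image_iUnion, Set.mem_iUnion, Opens.coe_mk]
    · intro i j N hi hj
      have hN : N ≤ M.imageOpens V (W i ⊓ W j) := by
        intro x hx
        obtain ⟨y, hy, rfl⟩ := hi hx
        obtain ⟨z, hz, hzy⟩ := hj hx
        obtain rfl : z = y := Subtype.ext hzy
        exact ⟨z, ⟨hy, hz⟩, rfl⟩
      have := congrArg (M.res hN) (hs i j)
      rwa [M.res_res, M.res_res] at this
  parity W := M.parity (M.imageOpens V W)
  graded W := M.graded _
  isCompl W := M.isCompl _
  res_parity h := M.res_parity _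
  even_comm := M.even_comm
  odd_anticomm := M.odd_anticomm

/-- The germ of the section `f` at `x` is invertible in the stalk at `x`. -/
def IsUnitAt (M : RingedSuperspace.{u, v}) {U : Opens M} (f : M.sections U) (x : M) : Prop :=
  ∃ (W : Opens M) (h : W ≤ U), x ∈ W ∧ IsUnit (M.res h f)

/-- All stalks of the structure sheaf are local rings: they are nonzero, and for every germ `f`
one of `f`, `1 - f` is invertible. -/
def IsLocallyRinged (M : RingedSuperspace.{u, v}) : Prop :=
  ∀ (x : M) (U : Opens M), x ∈ U →
    Nontrivial (M.sections U) ∧ ∀ f : M.sections U, M.IsUnitAt f x ∨ M.IsUnitAt (1 - f) x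

end RingedSuperspace

/-- A morphism of (locally) ringed superspaces over `ℂ`: a continuous map together with a parity
preserving morphism of sheaves of `ℂ`-algebras which is local on stalks. -/
structure Hom (A : RingedSuperspace.{u, v}) (B : RingedSuperspace.{u', v'}) where
  base : C(A, B)
  pullback : ∀ U : Opens B, B.sections U →ₐ[ℂ] A.sections (Opens.comap base U)
  pullback_res : ∀ {U V : Opens B} (h : U ≤ V) (f : B.sections V),
    pullback U (B.res h f) = A.res (Opens.comap_mono base h) (pullback V f)
  pullback_parity : ∀ {U : Opens B} (i : ZMod 2) (f : B.sections U),
    f ∈ B.parity U i → pullback U f ∈ A.parity _ i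
  isLocal : ∀ {U : Opens B} (f : B.sections U) (x : A), base x ∈ U →
    A.IsUnitAt (pullback U f) x → B.IsUnitAt f (base x)

/-- An isomorphism onto an open subspace of the target. -/
def Hom.IsOpenImmersion {A : RingedSuperspace.{u, v}} {B : RingedSuperspace.{u', v'}} (f : Hom A B) : Prop :=
  Topology.IsOpenEmbedding f.base ∧
    ∀ U : Opens B, (U : Set B) ⊆ Set.range f.base → Function.Bijective (f.pullback U)

/-! ### Partially holomorphic functions -/

open Classical in
/-- Extension of a function on an open set by zero. -/
def extendZero {E : Type u} {F : Type v} [TopologicalSpace E] [Zero F] (U : Opens E) (g : U → F) :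
    E → F :=
  fun x => if h : x ∈ U then g ⟨x, h⟩ else 0

theorem extendZero_of_mem {E : Type u} {F : Type v} [TopologicalSpace E] [Zero F] {U : Opens E}
    (g : U → F) {x : E} (h : x ∈ U) : extendZero U g x = g ⟨x, h⟩ := dif_pos h

/-- The space `ℝⁿ × ℂᵐ`, i.e. the real part of the mixed vector space
`(ℂⁿ × ℂᵐ, ℝⁿ × ℂᵐ, 0 × ℂᵐ)`. Every finite dimensional purely even mixed vector space is isomorphic
to one of these. -/
abbrev ModelSpace (n m : ℕ) : Type := (Fin n → ℝ) × (Fin m → ℂ)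

/-- Partially holomorphic functions on `U ⊆ ℝⁿ × ℂᵐ`: complex valued smooth functions whose
differential is complex linear on the subspace `0 × ℂᵐ`. -/
def IsPartiallyHolomorphic {n m : ℕ} (U : Opens (ModelSpace n m)) (g : U → ℂ) : Prop :=
  ∀ p ∈ U, ContDiffAt ℝ ∞ (extendZero U g) p ∧
    ∀ w : Fin m → ℂ,
      fderiv ℝ (extendZero U g) p (0, Complex.I • w) =
        Complex.I * fderiv ℝ (extendZero U g) p (0, w)

section PartHol
variable {n m : ℕ} {U : Opens (ModelSpace n m)}

theorem IsPartiallyHolomorphic.of_local {g : U → ℂ}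
    (H : ∀ p ∈ U, ∃ (V : Opens (ModelSpace n m)) (g' : V → ℂ), p ∈ V ∧
      IsPartiallyHolomorphic V g' ∧ ∀ q (h : q ∈ V) (h' : q ∈ U), g' ⟨q, h⟩ = g ⟨q, h'⟩) :
    IsPartiallyHolomorphic U g := by
  intro p hp
  obtain ⟨V, g', hV, hg, e⟩ := H p hp
  have : extendZero U g =ᶠ[nhds p] extendZero V g' := by
    filter_upwards [U.isOpen.mem_nhds hp, V.isOpen.mem_nhds hV] with q h1 h2
    rw [extendZero_of_mem _ h1, extendZero_of_mem _ h2, e q h2 h1]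
  rw [this.fderiv_eq]
  exact ⟨(hg p hV).1.congr_of_eventuallyEq this, (hg p hV).2⟩

theorem IsPartiallyHolomorphic.const (c : ℂ) : IsPartiallyHolomorphic U fun _ => c := by
  intro p hp
  have : extendZero U (fun _ => c) =ᶠ[nhds p] fun _ => c := by
    filter_upwards [U.isOpen.mem_nhds hp] with q h1
    rw [extendZero_of_mem _ h1]
  rw [this.fderiv_eq]
  exact ⟨contDiffAt_const.congr_of_eventuallyEq this, fun w => by simp⟩

theorem IsPartiallyHolomorphic.add {f g : U → ℂ} (hf : IsPartiallyHolomorphic U f)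
    (hg : IsPartiallyHolomorphic U g) : IsPartiallyHolomorphic U fun p => f p + g p := by
  intro p hp
  have : extendZero U (fun p => f p + g p) =
      extendZero U f + extendZero U g := by
    funext q
    by_cases h : q ∈ U <;> simp [extendZero, h]
  have df := (hf p hp).1.differentiableAt (by simp)
  have dg := (hg p hp).1.differentiableAt (by simp)
  rw [this, fderiv_add df dg]
  refine ⟨(hf p hp).1.add (hg p hp).1, fun w => ?_⟩
  simp only [add_apply, (hf p hp).2 w, (hg p hp).2 w]
  ring

theorem IsPartiallyHolomorphic.mul {f g : U → ℂ} (hf : IsPartiallyHolomorphic U f)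
    (hg : IsPartiallyHolomorphic U g) : IsPartiallyHolomorphic U fun p => f p * g p := by
  intro p hp
  have : extendZero U (fun p => f p * g p) =
      extendZero U f * extendZero U g := by
    funext q
    by_cases h : q ∈ U <;> simp [extendZero, h]
  have df := (hf p hp).1.differentiableAt (by simp)
  have dg := (hg p hp).1.differentiableAt (by simp)
  rw [this, fderiv_mul df dg]
  refine ⟨(hf p hp).1.mul (hg p hp).1, fun w => ?_⟩
  simp only [add_apply, smul_apply, smul_eq_mul, (hf p hp).2 w, (hg p hp).2 w]
  ring

theorem IsPartiallyHolomorphic.inv {f : U → ℂ} (hf : IsPartiallyHolomorphic U f)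
    (h0 : ∀ p, f p ≠ 0) : IsPartiallyHolomorphic U fun p => (f p)⁻¹ := by
  intro p hp
  have : extendZero U (fun p => (f p)⁻¹) =
      fun q => (extendZero U f q)⁻¹ := by
    funext q
    by_cases h : q ∈ U <;> simp [extendZero, h]
  have df := (hf p hp).1.differentiableAt (by simp)
  have hne : extendZero U f p ≠ 0 := by
    rw [extendZero_of_mem _ hp]; exact h0 _
  rw [this]
  refine ⟨(hf p hp).1.inv hne, fun w => ?_⟩
  have key := (((hasDerivAt_inv hne).hasFDerivAt.restrictScalars ℝ).comp p df.hasFDerivAt).fderiv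
  change fderiv ℝ (Inv.inv ∘ extendZero U f) p _ = Complex.I * fderiv ℝ (Inv.inv ∘ extendZero U f) p _
  rw [key]
  simp [(hf p hp).2 w]
  ring

theorem IsPartiallyHolomorphic.sum {ι : Type} (s : Finset ι) {f : ι → U → ℂ}
    (hf : ∀ i ∈ s, IsPartiallyHolomorphic U (f i)) :
    IsPartiallyHolomorphic U fun p => ∑ i ∈ s, f i p := by
  classical
  induction s using Finset.induction_on with
  | empty => simpa using IsPartiallyHolomorphic.const 0
  | insert a s ha ih =>
    simp only [Finset.sum_insert ha]
    exact (hf a (by simp)).add (ih fun i hi => hf i (by simp [hi]))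

end PartHol

/-- The Grassmann algebra `⋀ (ℂᵏ)` on `k` odd generators. -/
abbrev Grassmann (k : ℕ) : Type := ExteriorAlgebra ℂ (Fin k → ℂ)

/-- The even and the odd part of the Grassmann algebra. -/
def Grassmann.parity (k : ℕ) : ZMod 2 → Submodule ℂ (Grassmann k) :=
  CliffordAlgebra.evenOdd (0 : QuadraticForm ℂ (Fin k → ℂ))


namespace Grassmann
variable {k : ℕ}

theorem even_comm (a b : Grassmann k) (ha : a ∈ parity k 0) : a * b = b * a := by
  have H : ∀ i, ∀ c ∈ parity k i, a * c = c * a := fun i c hc => by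
    have := CliffordAlgebra.commute_map_mul_map_of_isOrtho_of_mem_evenOdd_zero_left
      (Qₙ := (0 : QuadraticForm ℂ (Fin k → ℂ))) (QuadraticMap.Isometry.id 0)
      (QuadraticMap.Isometry.id 0) (fun x y => by simp [QuadraticMap.IsOrtho]) a c ha hc
    simpa [CliffordAlgebra.map_id] using this.eq
  have hb : b ∈ parity k 0 ⊔ parity k 1 := by
    rw [parity, (CliffordAlgebra.evenOdd_isCompl _).sup_eq_top]; trivial
  obtain ⟨b0, h0, b1, h1, rfl⟩ := Submodule.mem_sup.1 hb
  rw [mul_add, add_mul, H 0 b0 h0, H 1 b1 h1]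

theorem odd_anticomm (a b : Grassmann k) (ha : a ∈ parity k 1) (hb : b ∈ parity k 1) :
    a * b = -(b * a) := by
  have := CliffordAlgebra.map_mul_map_eq_neg_of_isOrtho_of_mem_evenOdd_one
    (Qₙ := (0 : QuadraticForm ℂ (Fin k → ℂ))) (QuadraticMap.Isometry.id 0)
    (QuadraticMap.Isometry.id 0) (fun x y => by simp [QuadraticMap.IsOrtho]) a b ha hb
  simpa [CliffordAlgebra.map_id] using this

theorem isCompl_parity : IsCompl (parity k 0) (parity k 1) := CliffordAlgebra.evenOdd_isCompl _

instance : Module.Finite ℂ (Grassmann k) :=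
  Module.Finite.of_basis (Pi.basisFun ℂ (Fin k)).ExteriorAlgebra

/-- The projection to the even part along the odd part. -/
def evenProj (k : ℕ) : Grassmann k →ₗ[ℂ] Grassmann k :=
  Submodule.projection (parity k 0) (parity k 1) isCompl_parity

theorem evenProj_mem (a : Grassmann k) : evenProj k a ∈ parity k 0 :=
  Submodule.projection_apply_mem _ _

theorem sub_evenProj_mem (a : Grassmann k) : a - evenProj k a ∈ parity k 1 :=
  Submodule.sub_projection_mem _ _

theorem evenProj_of_even {a : Grassmann k} (h : a ∈ parity k 0) : evenProj k a = a :=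
  Submodule.projection_apply_of_mem_left _ h

theorem evenProj_of_odd {a : Grassmann k} (h : a ∈ parity k 1) : evenProj k a = 0 :=
  (Submodule.projection_apply_eq_zero_iff _).2 h

/-- The augmentation, which sends all odd generators to zero. -/
def aug (k : ℕ) : Grassmann k →ₐ[ℂ] ℂ := ExteriorAlgebra.algebraMapInv

theorem odd_sq {a : Grassmann k} (h : a ∈ parity k 1) : a * a = 0 := by
  have := odd_anticomm a a h h
  have h2 : (2 : ℂ) • (a * a) = 0 := by
    rw [two_smul]; nth_rewrite 1 [this]; abel
  exact (smul_eq_zero.1 h2).resolve_left two_ne_zero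

theorem aug_odd {a : Grassmann k} (h : a ∈ parity k 1) : aug k a = 0 := by
  have := congrArg (aug k) (odd_sq h)
  simpa using this

theorem isNilpotent_even {a : Grassmann k} (h : a ∈ parity k 0) :
    IsNilpotent (a - algebraMap ℂ _ (aug k a)) := by
  refine CliffordAlgebra.even_induction (Q := (0 : QuadraticForm ℂ (Fin k → ℂ)))
    (motive := fun a _ => IsNilpotent ((a : Grassmann k) - algebraMap ℂ _ (aug k a)))
    ?_ ?_ ?_ a h
  · intro r
    have : aug k (algebraMap ℂ (Grassmann k) r) = r := by simp
    rw [this, sub_self]; exact IsNilpotent.zero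
  · intro x y hx hy ihx ihy
    have : x + y - algebraMap ℂ (Grassmann k) (aug k (x + y)) =
      (x - algebraMap ℂ (Grassmann k) (aug k x)) + (y - algebraMap ℂ (Grassmann k) (aug k y)) := by
      rw [map_add, map_add]; abel
    rw [this]
    refine Commute.isNilpotent_add ?_ ihx ihy
    refine even_comm _ _ ((parity k 0).sub_mem hx ?_)
    exact (CliffordAlgebra.one_le_evenOdd_zero _) (Submodule.mem_one.2 ⟨_, rfl⟩)
  · intro m₁ m₂ x hx ih
    have h12 : CliffordAlgebra.ι (0 : QuadraticForm ℂ (Fin k → ℂ)) m₁ * CliffordAlgebra.ι _ m₂ ∈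
        parity k 0 := CliffordAlgebra.ι_mul_ι_mem_evenOdd_zero _ _ _
    have o1 : CliffordAlgebra.ι (0 : QuadraticForm ℂ (Fin k → ℂ)) m₁ ∈ parity k 1 :=
      CliffordAlgebra.ι_mem_evenOdd_one _ _
    have hz : aug k (CliffordAlgebra.ι _ m₁ * CliffordAlgebra.ι _ m₂ * x) = 0 := by
      rw [map_mul, map_mul, aug_odd o1, zero_mul, zero_mul]
    rw [hz, map_zero, sub_zero]
    refine Commute.isNilpotent_mul_right (even_comm _ _ h12) ⟨2, ?_⟩
    set a₁ : Grassmann k := CliffordAlgebra.ι _ m₁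
    set a₂ : Grassmann k := CliffordAlgebra.ι _ m₂
    rw [pow_two, mul_assoc, ← mul_assoc a₂, odd_anticomm a₂ a₁ (CliffordAlgebra.ι_mem_evenOdd_one _ _) o1,
      neg_mul, mul_neg, ← mul_assoc, ← mul_assoc, odd_sq o1, zero_mul, zero_mul, neg_zero]

theorem isNilpotent_of_aug {a : Grassmann k} (h : aug k a = 0) : IsNilpotent a := by
  have h1 := sub_evenProj_mem a
  have h0 := evenProj_mem a
  have e : a = evenProj k a + (a - evenProj k a) := by abel
  have ha0 : aug k (evenProj k a) = 0 := by
    have := aug_odd h1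
    rw [map_sub, h, zero_sub, neg_eq_zero] at this
    exact this
  rw [e]
  refine Commute.isNilpotent_add (even_comm _ _ h0) ?_ ⟨2, by rw [pow_two, odd_sq h1]⟩
  simpa [ha0] using isNilpotent_even h0

theorem pow_eq_zero_of_aug {a : Grassmann k} (h : aug k a = 0) :
    a ^ Module.finrank ℂ (Grassmann k) = 0 := by
  have h1 : IsNilpotent (Algebra.lmul ℂ (Grassmann k) a) := (isNilpotent_of_aug h).map _
  have h2 : (Algebra.lmul ℂ (Grassmann k) a) ^ Module.finrank ℂ (Grassmann k) = 0 := by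
    have := LinearMap.aeval_self_charpoly (Algebra.lmul ℂ (Grassmann k) a)
    rw [(LinearMap.isNilpotent_iff_charpoly _).1 h1] at this
    simpa using this
  rw [← map_pow] at h2
  simpa using LinearMap.congr_fun h2 1

end Grassmann

/-! ### The affine model superspaces -/

theorem Grassmann.dual_mul {k : ℕ} (l : Module.Dual ℂ (Grassmann k)) (x y : Grassmann k) :
    l (x * y) = ∑ i, ∑ j,
      l ((Pi.basisFun ℂ (Fin k)).ExteriorAlgebra i * (Pi.basisFun ℂ (Fin k)).ExteriorAlgebra j) *
        ((Pi.basisFun ℂ (Fin k)).ExteriorAlgebra.coord i x *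
          (Pi.basisFun ℂ (Fin k)).ExteriorAlgebra.coord j y) := by
  set b := (Pi.basisFun ℂ (Fin k)).ExteriorAlgebra
  conv_lhs => rw [← b.sum_repr x, ← b.sum_repr y]
  simp only [Finset.sum_mul, Finset.mul_sum, map_sum, smul_mul_smul_comm, map_smul, smul_eq_mul,
    Module.Basis.coord_apply]
  rw [Finset.sum_comm]
  exact Finset.sum_congr rfl fun i _ => Finset.sum_congr rfl fun j _ => by ring

section Model
variable {n m k : ℕ}

theorem isPartiallyHolomorphic_dual_mul {U : Opens (ModelSpace n m)} {f g : U → Grassmann k}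
    (hf : ∀ l : Module.Dual ℂ (Grassmann k), IsPartiallyHolomorphic U fun p => l (f p))
    (hg : ∀ l : Module.Dual ℂ (Grassmann k), IsPartiallyHolomorphic U fun p => l (g p))
    (l : Module.Dual ℂ (Grassmann k)) : IsPartiallyHolomorphic U fun p => l (f p * g p) := by
  have e : (fun p => l (f p * g p)) = _ := funext fun p => Grassmann.dual_mul l (f p) (g p)
  rw [e]
  exact .sum _ fun i _ => .sum _ fun j _ => (IsPartiallyHolomorphic.const _).mul ((hf _).mul (hg _))

/-- The sections `𝒪(U) ⊗ ⋀ (ℂᵏ)` over `U ⊆ ℝⁿ × ℂᵐ`, as functions with values in the finite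
dimensional algebra `⋀ (ℂᵏ)` all of whose coefficients are partially holomorphic. -/
def modelSections (n m k : ℕ) (U : Opens (ModelSpace n m)) : Subalgebra ℂ (U → Grassmann k) where
  carrier := {f | ∀ l : Module.Dual ℂ (Grassmann k), IsPartiallyHolomorphic U fun p => l (f p)}
  mul_mem' hf hg l := isPartiallyHolomorphic_dual_mul hf hg l
  add_mem' hf hg l := by
    simp only [Pi.add_apply, map_add]
    exact (hf l).add (hg l)
  algebraMap_mem' c l := IsPartiallyHolomorphic.const (l (algebraMap ℂ (Grassmann k) c))

theorem mem_modelSections {U : Opens (ModelSpace n m)} {f : U → Grassmann k} :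
    f ∈ modelSections n m k U ↔
      ∀ l : Module.Dual ℂ (Grassmann k), IsPartiallyHolomorphic U fun p => l (f p) := Iff.rfl

theorem mem_modelSections_of_local {U : Opens (ModelSpace n m)} {f : U → Grassmann k}
    (H : ∀ p ∈ U, ∃ (V : Opens (ModelSpace n m)) (g : modelSections n m k V), p ∈ V ∧
      ∀ q (h : q ∈ V) (h' : q ∈ U), g.1 ⟨q, h⟩ = f ⟨q, h'⟩) : f ∈ modelSections n m k U := by
  rw [mem_modelSections]; intro l
  refine IsPartiallyHolomorphic.of_local fun p hp => ?_
  obtain ⟨V, g, hV, e⟩ := H p hp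
  exact ⟨V, fun q => l (g.1 q), hV, mem_modelSections.1 g.2 l, fun q h h' => by simp [e q h h']⟩

theorem comp_linear_mem_modelSections {U : Opens (ModelSpace n m)} {f : U → Grassmann k}
    (hf : f ∈ modelSections n m k U) (L : Grassmann k →ₗ[ℂ] Grassmann k) :
    (fun p => L (f p)) ∈ modelSections n m k U :=
  mem_modelSections.2 fun l => mem_modelSections.1 hf (l.comp L)

/-- Restriction of sections of the model. -/
def modelRes (n m k : ℕ) {U V : Opens (ModelSpace n m)} (h : U ≤ V) :
    modelSections n m k V →ₐ[ℂ] modelSections n m k U where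
  toFun f := ⟨fun q => f.1 ⟨q.1, h q.2⟩, mem_modelSections_of_local fun _ hp =>
    ⟨V, f, h hp, fun _ _ _ => rfl⟩⟩
  map_one' := rfl
  map_mul' _ _ := rfl
  map_zero' := rfl
  map_add' _ _ := rfl
  commutes' _ := rfl

/-- Sections of the model with even (odd) values. -/
def modelParity (n m k : ℕ) (U : Opens (ModelSpace n m)) (i : ZMod 2) :
    Submodule ℂ (modelSections n m k U) where
  carrier := {f | ∀ p, f.1 p ∈ Grassmann.parity k i}
  add_mem' hf hg p := Submodule.add_mem _ (hf p) (hg p)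
  zero_mem' _ := Submodule.zero_mem _
  smul_mem' c _ hf p := Submodule.smul_mem _ c (hf p)

/-- The affine superspace of the mixed super vector space with even part
`(ℂⁿ × ℂᵐ, ℝⁿ × ℂᵐ, 0 × ℂᵐ)` and odd part `ℂᵏ`: the space `ℝⁿ × ℂᵐ` with the structure sheaf
`𝒪 ⊗ ⋀ (ℂᵏ)`. -/
def model (n m k : ℕ) : RingedSuperspace.{0, 0} where
  carrier := ModelSpace n m
  sections U := modelSections n m k U
  res h := modelRes n m k h
  res_self _ := rfl
  res_res _ _ _ := rfl
  glue {ι} W s hs := by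
    have hs' : ∀ i j p (hi : p ∈ W i) (hj : p ∈ W j), (s i).1 ⟨p, hi⟩ = (s j).1 ⟨p, hj⟩ :=
      fun i j p hi hj => congrFun (congrArg Subtype.val (hs i j)) ⟨p, hi, hj⟩
    have hc : ∀ p : (iSup W : Opens (ModelSpace n m)), ∃ i, p.1 ∈ W i := fun p => Opens.mem_iSup.1 p.2
    choose c hc using hc
    refine ⟨⟨fun p => (s (c p)).1 ⟨p.1, hc p⟩, mem_modelSections_of_local fun p hp =>
      ⟨W (c ⟨p, hp⟩), s _, hc ⟨p, hp⟩, fun q h h' => hs' _ _ q _ _⟩⟩, ?_, ?_⟩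
    · intro i
      exact Subtype.ext (funext fun p => hs' _ _ _ _ _)
    · intro f hf
      refine Subtype.ext (funext fun p => ?_)
      exact congrFun (congrArg Subtype.val (hf (c p))) ⟨p.1, hc p⟩
  parity := modelParity n m k
  graded U :=
    { one_mem := fun p => (CliffordAlgebra.evenOdd.gradedMonoid _).one_mem
      mul_mem := fun i j _ _ hf hg p => (CliffordAlgebra.evenOdd.gradedMonoid _).mul_mem (hf p) (hg p) }
  isCompl U := by
    rw [isCompl_iff, Submodule.disjoint_def, Submodule.codisjoint_iff_exists_add_eq]
    refine ⟨fun f h0 h1 => Subtype.ext (funext fun p => ?_), fun f => ?_⟩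
    · exact Submodule.disjoint_def.1 Grassmann.isCompl_parity.disjoint _ (h0 p) (h1 p)
    · refine ⟨⟨_, comp_linear_mem_modelSections f.2 (Grassmann.evenProj k)⟩,
        ⟨_, comp_linear_mem_modelSections f.2 (LinearMap.id - Grassmann.evenProj k)⟩,
        fun p => Grassmann.evenProj_mem _, fun p => Grassmann.sub_evenProj_mem _,
        Subtype.ext (funext fun p => ?_)⟩
      simp
  res_parity h i f hf p := hf ⟨p.1, h p.2⟩
  even_comm f g hf := Subtype.ext (funext fun p => Grassmann.even_comm _ _ (hf p))
  odd_anticomm f g hf hg := Subtype.ext (funext fun p => Grassmann.odd_anticomm _ _ (hf p) (hg p))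

theorem model_isUnitAt {U : Opens (ModelSpace n m)} (f : modelSections n m k U) (p : U)
    (hp : Grassmann.aug k (f.1 p) ≠ 0) : (model n m k).IsUnitAt (U := U) f p.1 := by
  have hf : IsPartiallyHolomorphic U fun p => Grassmann.aug k (f.1 p) :=
    mem_modelSections.1 f.2 (Grassmann.aug k).toLinearMap
  have hc := ((hf p.1 p.2).1.continuousAt.eventually_ne (y := 0)
    (by rwa [extendZero_of_mem _ p.2])).and (U.isOpen.mem_nhds p.2)
  obtain ⟨W', hW', hWo, hpW⟩ := eventually_nhds_iff.1 hc
  set W : Opens (ModelSpace n m) := ⟨W', hWo⟩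
  have hWU : W ≤ U := fun q hq => (hW' q hq).2
  have hne : ∀ q : W, Grassmann.aug k (f.1 ⟨q.1, hWU q.2⟩) ≠ 0 := fun q => by
    have := (hW' q.1 q.2).1
    rwa [extendZero_of_mem _ (hWU q.2)] at this
  have hfW : IsPartiallyHolomorphic W fun q => Grassmann.aug k (f.1 ⟨q.1, hWU q.2⟩) :=
    mem_modelSections.1 (modelRes n m k hWU f).2 (Grassmann.aug k).toLinearMap
  have scal : ∀ g : W → ℂ, IsPartiallyHolomorphic W g →
      (fun q => algebraMap ℂ (Grassmann k) (g q)) ∈ modelSections n m k W := fun g hg => by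
    rw [mem_modelSections]; intro l
    simp only [Algebra.algebraMap_eq_smul_one, map_smul, smul_eq_mul]
    exact hg.mul (.const _)
  let a : modelSections n m k W := ⟨_, scal _ hfW⟩
  let a' : modelSections n m k W := ⟨_, scal _ (hfW.inv hne)⟩
  have haa : a * a' = 1 := Subtype.ext (funext fun q => by
    change algebraMap ℂ (Grassmann k) _ * algebraMap ℂ (Grassmann k) _ = 1
    rw [← map_mul, mul_inv_cancel₀ (hne q), map_one])
  have haa' : a' * a = 1 := Subtype.ext (funext fun q => by
    change algebraMap ℂ (Grassmann k) _ * algebraMap ℂ (Grassmann k) _ = 1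
    rw [← map_mul, inv_mul_cancel₀ (hne q), map_one])
  have ha : IsUnit a := ⟨⟨a, a', haa, haa'⟩, rfl⟩
  have hN : IsNilpotent (modelRes n m k hWU f - a) := by
    refine ⟨Module.finrank ℂ (Grassmann k), Subtype.ext (funext fun q => ?_)⟩
    have : Grassmann.aug k ((modelRes n m k hWU f - a).1 q) = 0 := by
      change Grassmann.aug k (f.1 ⟨q.1, hWU q.2⟩ - algebraMap ℂ _ _) = 0
      rw [map_sub, AlgHom.commutes]; exact sub_self _
    exact Grassmann.pow_eq_zero_of_aug this
  refine ⟨W, hWU, hpW, ?_⟩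
  change IsUnit (modelRes n m k hWU f)
  have := hN.isUnit_add_left_of_commute ha (Subtype.ext (funext fun q =>
    (Algebra.commutes _ _).symm))
  simpa using this

end Model

namespace RingedSuperspace

/-! ### The product with the real line -/

/-- The open subset `{x | (t, x) ∈ W}` of `M`. -/
def slice (M : RingedSuperspace.{u, v}) (W : Opens (ℝ × M)) (t : ℝ) : Opens M :=
  ⟨{x | (t, x) ∈ W}, W.isOpen.preimage (by fun_prop)⟩

theorem slice_mono (M : RingedSuperspace.{u, v}) {W W' : Opens (ℝ × M)} (h : W ≤ W') (t : ℝ) :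
    M.slice W t ≤ M.slice W' t := fun _ hx => h hx

/-- A local parametrization of `M`: an isomorphism from an open subspace of a model to an open
subspace of `M`. -/
structure Parametrization (M : RingedSuperspace.{u, v}) where
  (n m k : ℕ)
  domain : Opens (ModelSpace n m)
  hom : Hom ((model n m k).restrict domain) M
  isOpenImmersion : hom.IsOpenImmersion

namespace Parametrization
variable {M : RingedSuperspace.{u, v}} (ψ : M.Parametrization)

/-- The preimage of `U` under a parametrization, as an open subset of `ℝⁿ × ℂᵐ`. -/
def preimage (U : Opens M) : Opens (ModelSpace ψ.n ψ.m) :=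
  (model ψ.n ψ.m ψ.k).imageOpens ψ.domain (Opens.comap ψ.hom.base U)

theorem mem_preimage {U : Opens M} {p : ModelSpace ψ.n ψ.m} :
    p ∈ ψ.preimage U ↔ ∃ h : p ∈ ψ.domain, ψ.hom.base ⟨p, h⟩ ∈ U := by
  constructor
  · rintro ⟨q, hq, rfl⟩; exact ⟨q.2, hq⟩
  · rintro ⟨h, hU⟩; exact ⟨⟨p, h⟩, hU, rfl⟩

theorem preimage_mono {U V : Opens M} (h : U ≤ V) : ψ.preimage U ≤ ψ.preimage V :=
  imageOpens_mono _ _ (Opens.comap_mono _ h)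

/-- The expression of a section in a local parametrization. -/
def pullback (U : Opens M) : M.sections U →ₐ[ℂ] modelSections ψ.n ψ.m ψ.k (ψ.preimage U) :=
  ψ.hom.pullback U

theorem pullback_res {U V : Opens M} (h : U ≤ V) (f : M.sections V) :
    ψ.pullback U (M.res h f) = modelRes _ _ _ (ψ.preimage_mono h) (ψ.pullback V f) :=
  ψ.hom.pullback_res h f

theorem pullback_parity {U : Opens M} (i : ZMod 2) {f : M.sections U} (hf : f ∈ M.parity U i)
    (p : ψ.preimage U) : (ψ.pullback U f).1 p ∈ Grassmann.parity ψ.k i :=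
  ψ.hom.pullback_parity i f hf p

/-- The coefficient, in direction of the linear form `l`, of the local expression of a family
`F t` of sections of `M`, as a function of the time and the point of the parameter domain. -/
def coeff {W : Opens (ℝ × M)} (F : ∀ t, M.sections (M.slice W t))
    (l : Module.Dual ℂ (Grassmann ψ.k)) (q : ℝ × ModelSpace ψ.n ψ.m) : ℂ :=
  extendZero (ψ.preimage (M.slice W q.1))
    (fun p => l ((ψ.pullback (M.slice W q.1) (F q.1)).1 p)) q.2

theorem coeff_eq {W : Opens (ℝ × M)} (F : ∀ t, M.sections (M.slice W t))
    (l : Module.Dual ℂ (Grassmann ψ.k)) {q : ℝ × ModelSpace ψ.n ψ.m}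
    (hq : q.2 ∈ ψ.preimage (M.slice W q.1)) :
    ψ.coeff F l q = l ((ψ.pullback (M.slice W q.1) (F q.1)).1 ⟨q.2, hq⟩) :=
  extendZero_of_mem _ hq

theorem coeff_res {W W' : Opens (ℝ × M)} (F : ∀ t, M.sections (M.slice W t))
    (F' : ∀ t, M.sections (M.slice W' t)) (h : W ≤ W') {q : ℝ × ModelSpace ψ.n ψ.m}
    (hF : F q.1 = M.res (M.slice_mono h q.1) (F' q.1))
    (l : Module.Dual ℂ (Grassmann ψ.k)) (hq : q.2 ∈ ψ.preimage (M.slice W q.1)) :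
    ψ.coeff F l q = ψ.coeff F' l q := by
  rw [ψ.coeff_eq F l hq, ψ.coeff_eq F' l (ψ.preimage_mono (M.slice_mono h q.1) hq), hF,
    ψ.pullback_res]
  rfl

theorem eventually_mem {W : Opens (ℝ × M)} {q : ℝ × ModelSpace ψ.n ψ.m}
    (hq : q.2 ∈ ψ.preimage (M.slice W q.1)) :
    ∀ᶠ q' in nhds q, q'.2 ∈ ψ.preimage (M.slice W q'.1) := by
  obtain ⟨h, hW⟩ := ψ.mem_preimage.1 hq
  have ho : IsOpen {r : ℝ × ψ.domain | (r.1, ψ.hom.base r.2) ∈ W} :=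
    W.isOpen.preimage (continuous_fst.prodMk (ψ.hom.base.continuous.comp continuous_snd))
  have hm : IsOpenMap (Prod.map id Subtype.val : ℝ × ψ.domain → ℝ × ModelSpace ψ.n ψ.m) :=
    IsOpenMap.id.prodMap ψ.domain.isOpen.isOpenMap_subtype_val
  filter_upwards [(hm _ ho).mem_nhds ⟨(q.1, ⟨q.2, h⟩), hW, rfl⟩]
  rintro _ ⟨r, hr, rfl⟩
  exact ψ.mem_preimage.2 ⟨r.2.2, hr⟩

end Parametrization

/-- The family of sections `F t` over the slices of `W ⊆ ℝ × M` depends smoothly on `t`: in every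
local parametrization all its coefficients are jointly smooth in `t` and the coordinates. (They are
automatically partially holomorphic in the coordinates.) -/
def IsSmoothFamily (M : RingedSuperspace.{u, v}) {W : Opens (ℝ × M)}
    (F : ∀ t, M.sections (M.slice W t)) : Prop :=
  ∀ (ψ : M.Parametrization) (l : Module.Dual ℂ (Grassmann ψ.k)) (q : ℝ × ModelSpace ψ.n ψ.m),
    q.2 ∈ ψ.preimage (M.slice W q.1) → ContDiffAt ℝ ∞ (ψ.coeff F l) q

theorem IsSmoothFamily.of_local {M : RingedSuperspace.{u, v}} {W : Opens (ℝ × M)}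
    {F : ∀ t, M.sections (M.slice W t)}
    (H : ∀ t x, (t, x) ∈ W → ∃ (W' : Opens (ℝ × M)) (F' : ∀ t, M.sections (M.slice W' t)),
      (t, x) ∈ W' ∧ M.IsSmoothFamily F' ∧ ∀ s (N : Opens M) (h : N ≤ M.slice W s)
        (h' : N ≤ M.slice W' s), M.res h (F s) = M.res h' (F' s)) : M.IsSmoothFamily F := by
  intro ψ l q hq
  obtain ⟨hd, hx⟩ := ψ.mem_preimage.1 hq
  obtain ⟨W', F', hW', hF', e⟩ := H _ _ hx
  have hq' : q.2 ∈ ψ.preimage (M.slice W' q.1) := ψ.mem_preimage.2 ⟨hd, hW'⟩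
  refine (hF' ψ l q hq').congr_of_eventuallyEq ?_
  filter_upwards [ψ.eventually_mem hq, ψ.eventually_mem hq'] with r h1 h2
  have h3 : r.2 ∈ ψ.preimage (M.slice (W ⊓ W') r.1) := by
    obtain ⟨h, ha⟩ := ψ.mem_preimage.1 h1
    obtain ⟨_, hb⟩ := ψ.mem_preimage.1 h2
    exact ψ.mem_preimage.2 ⟨h, ha, hb⟩
  let G : ∀ t, M.sections (M.slice (W ⊓ W') t) := fun t => M.res (M.slice_mono inf_le_left t) (F t)
  rw [← ψ.coeff_res G F inf_le_left rfl l h3, ← ψ.coeff_res G F' inf_le_right (e _ _ _ _) l h3]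

theorem IsSmoothFamily.mul {M : RingedSuperspace.{u, v}} {W : Opens (ℝ × M)}
    {F G : ∀ t, M.sections (M.slice W t)} (hF : M.IsSmoothFamily F) (hG : M.IsSmoothFamily G) :
    M.IsSmoothFamily fun t => F t * G t := by
  intro ψ l q hq
  set b := (Pi.basisFun ℂ (Fin ψ.k)).ExteriorAlgebra with hb
  have key : ψ.coeff (fun t => F t * G t) l =ᶠ[nhds q] fun r =>
      ∑ i, ∑ j, l (b i * b j) * (ψ.coeff F (b.coord i) r * ψ.coeff G (b.coord j) r) := by
    filter_upwards [ψ.eventually_mem hq] with r hr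
    simp only [ψ.coeff_eq _ _ hr, map_mul]
    exact Grassmann.dual_mul l _ _
  refine ContDiffAt.congr_of_eventuallyEq ?_ key
  exact ContDiffAt.sum fun i _ => ContDiffAt.sum fun j _ =>
    contDiffAt_const.mul ((hF ψ _ q hq).mul (hG ψ _ q hq))

/-- The sections of the structure sheaf of `ℝ × M` over `W`. -/
def timeSections (M : RingedSuperspace.{u, v}) (W : Opens (ℝ × M)) :
    Subalgebra ℂ (∀ t : ℝ, M.sections (M.slice W t)) where
  carrier := {F | M.IsSmoothFamily F}
  mul_mem' hF hG := hF.mul hG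
  add_mem' {F G} hF hG ψ l q hq := by
    refine ((hF ψ l q hq).add (hG ψ l q hq)).congr_of_eventuallyEq ?_
    filter_upwards [ψ.eventually_mem hq] with r hr
    simp [ψ.coeff_eq _ _ hr]
  algebraMap_mem' c ψ l q hq := by
    refine (contDiffAt_const (c := l (algebraMap ℂ _ c))).congr_of_eventuallyEq ?_
    filter_upwards [ψ.eventually_mem hq] with r hr
    rw [ψ.coeff_eq _ _ hr, Pi.algebraMap_apply, AlgHom.commutes]
    rfl

/-- Restriction of smooth families of sections. -/
def timeRes (M : RingedSuperspace.{u, v}) {W W' : Opens (ℝ × M)} (h : W ≤ W') :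
    M.timeSections W' →ₐ[ℂ] M.timeSections W where
  toFun F := ⟨fun t => M.res (M.slice_mono h t) (F.1 t), IsSmoothFamily.of_local fun _ _ hx =>
    ⟨W', F.1, h hx, F.2, fun _ _ _ _ => M.res_res _ _ _⟩⟩
  map_one' := Subtype.ext (funext fun _ => map_one _)
  map_mul' _ _ := Subtype.ext (funext fun _ => map_mul _ _ _)
  map_zero' := Subtype.ext (funext fun _ => map_zero _)
  map_add' _ _ := Subtype.ext (funext fun _ => map_add _ _ _)
  commutes' c := Subtype.ext (funext fun _ => AlgHom.commutes _ c)

/-- The smooth families of even (odd) sections. -/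
def timeParity (M : RingedSuperspace.{u, v}) (W : Opens (ℝ × M)) (i : ZMod 2) :
    Submodule ℂ (M.timeSections W) where
  carrier := {F | ∀ t, F.1 t ∈ M.parity _ i}
  add_mem' hf hg p := Submodule.add_mem _ (hf p) (hg p)
  zero_mem' _ := Submodule.zero_mem _
  smul_mem' c _ hf p := Submodule.smul_mem _ c (hf p)

theorem timeSections_evenPart (M : RingedSuperspace.{u, v}) {W : Opens (ℝ × M)}
    {F F₀ F₁ : ∀ t, M.sections (M.slice W t)} (hF : M.IsSmoothFamily F)
    (h0 : ∀ t, F₀ t ∈ M.parity _ 0) (h1 : ∀ t, F₁ t ∈ M.parity _ 1)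
    (h : ∀ t, F₀ t + F₁ t = F t) : M.IsSmoothFamily F₀ := by
  intro ψ l q hq
  refine (hF ψ (l.comp (Grassmann.evenProj ψ.k)) q hq).congr_of_eventuallyEq ?_
  filter_upwards [ψ.eventually_mem hq] with r hr
  rw [ψ.coeff_eq _ _ hr, ψ.coeff_eq _ _ hr, ← h, map_add]
  change _ = l (Grassmann.evenProj ψ.k (_ + _))
  rw [map_add, Grassmann.evenProj_of_even (ψ.pullback_parity 0 (h0 _) _),
    Grassmann.evenProj_of_odd (ψ.pullback_parity 1 (h1 _) _), add_zero]

/-- The product `ℝ¹ × M`: the space `ℝ × M` where the sections over `W` are the families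
`F t` of sections of `M` over the slices of `W` which depend smoothly on `t`. In a local
parametrization of `M` by an open subspace of the model with dimensions `n`, `m`, `k` these are the
sections of the model with dimensions `n + 1`, `m`, `k`. -/
def timeProduct (M : RingedSuperspace.{u, v}) : RingedSuperspace.{u, v} where
  carrier := ℝ × M
  sections W := M.timeSections W
  res h := M.timeRes h
  res_self F := Subtype.ext (funext fun t => M.res_self _)
  res_res _ _ F := Subtype.ext (funext fun t => M.res_res _ _ _)
  glue {ι} W s hs := by
    have hs' : ∀ i j t (N : Opens M) (hi : N ≤ M.slice (W i) t) (hj : N ≤ M.slice (W j) t),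
        M.res hi ((s i).1 t) = M.res hj ((s j).1 t) := by
      intro i j t N hi hj
      have h1 := congrFun (congrArg Subtype.val (hs i j)) t
      have hN : N ≤ M.slice (W i ⊓ W j) t := fun x hx => ⟨hi hx, hj hx⟩
      have h2 := congrArg (M.res hN) h1
      change M.res _ (M.res _ _) = M.res _ (M.res _ _) at h2
      rwa [M.res_res, M.res_res] at h2
    have hsl : ∀ t, M.slice (iSup W) t = ⨆ i, M.slice (W i) t := by
      intro t; ext x; simp [slice]
    have hg := fun t => M.glue_cover (fun i => M.slice (W i) t) (hsl t)
      (fun i => M.slice_mono (le_iSup W i) t) (fun i => (s i).1 t) (fun i j => hs' i j t)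
    choose F hF hu using hg
    refine ⟨⟨F, IsSmoothFamily.of_local fun t x hx => ?_⟩, ?_, ?_⟩
    · obtain ⟨i, hi⟩ := Opens.mem_iSup.1 hx
      refine ⟨W i, (s i).1, hi, (s i).2, fun r N h h' => ?_⟩
      have := congrArg (M.res h') (hF r i)
      rwa [M.res_res] at this
    · intro i
      exact Subtype.ext (funext fun t => hF t i)
    · intro G hG
      refine Subtype.ext (funext fun t => hu t _ fun i => ?_)
      exact congrFun (congrArg Subtype.val (hG i)) t
  parity := M.timeParity
  graded W :=
    { one_mem := fun t => (M.graded _).one_mem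
      mul_mem := fun i j _ _ hf hg t => (M.graded _).mul_mem (hf t) (hg t) }
  isCompl W := by
    rw [isCompl_iff, Submodule.disjoint_def, Submodule.codisjoint_iff_exists_add_eq]
    refine ⟨fun f h0 h1 => Subtype.ext (funext fun p => ?_), fun f => ?_⟩
    · exact Submodule.disjoint_def.1 (M.isCompl _).disjoint _ (h0 p) (h1 p)
    · have := fun t => Submodule.codisjoint_iff_exists_add_eq.1
        (M.isCompl (M.slice W t)).codisjoint (f.1 t)
      choose F₀ F₁ h0 h1 h using this
      have hF₀ := M.timeSections_evenPart f.2 h0 h1 h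
      have e : f.1 - F₀ = F₁ := funext fun t => by simp [← h t]
      exact ⟨⟨F₀, hF₀⟩, ⟨F₁, e ▸ (M.timeSections W).sub_mem f.2 hF₀⟩, h0, h1,
        Subtype.ext (funext h)⟩
  res_parity h i f hf t := M.res_parity _ _ _ (hf t)
  even_comm f g hf := Subtype.ext (funext fun t => M.even_comm _ _ (hf t))
  odd_anticomm f g hf hg := Subtype.ext (funext fun t => M.odd_anticomm _ _ (hf t) (hg t))

/-- `∂ F / ∂ t = G` for sections `F` and `G` of the structure sheaf of `ℝ × M`, where `∂ / ∂ t` is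
the coordinate vector field of the first factor. -/
def HasTimeDeriv (M : RingedSuperspace.{u, v}) {W : Opens (ℝ × M)} (F G : M.timeSections W) : Prop :=
  ∀ (ψ : M.Parametrization) (l : Module.Dual ℂ (Grassmann ψ.k)) (t : ℝ) (p : ModelSpace ψ.n ψ.m),
    p ∈ ψ.preimage (M.slice W t) → HasDerivAt (fun s => ψ.coeff F.1 l (s, p)) (ψ.coeff G.1 l (t, p)) t

end RingedSuperspace

/-! ### Vector fields, mixed supermanifolds and their underlying manifolds -/

/-- An even `ℂ`-linear superderivation of the structure sheaf. -/
structure EvenVectorField (M : RingedSuperspace.{u, v}) where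
  toFun : ∀ U : Opens M, M.sections U →ₗ[ℂ] M.sections U
  leibniz : ∀ {U : Opens M} (f g : M.sections U),
    toFun U (f * g) = toFun U f * g + f * toFun U g
  map_res : ∀ {U V : Opens M} (h : U ≤ V) (f : M.sections V),
    toFun U (M.res h f) = M.res h (toFun V f)
  map_parity : ∀ {U : Opens M} (i : ZMod 2) (f : M.sections U),
    f ∈ M.parity U i → toFun U f ∈ M.parity U i

/-- A mixed supermanifold: a locally ringed superspace over `ℂ` with second countable Hausdorff base
which is locally isomorphic to open subspaces of the models. -/
structure MixedSupermanifold extends RingedSuperspace.{u, v} where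
  t2 : T2Space carrier
  secondCountable : SecondCountableTopology carrier
  locallyRinged : toRingedSuperspace.IsLocallyRinged
  locallyModel : ∀ x : carrier, ∃ ψ : toRingedSuperspace.Parametrization, x ∈ Set.range ψ.hom.base

namespace MixedSupermanifold

/-- A `ℂ`-algebra homomorphism from the stalk at `x` to `ℂ`. -/
structure PointEval (M : RingedSuperspace.{u, v}) (x : M) where
  eval : ∀ U : Opens M, x ∈ U → (M.sections U →ₐ[ℂ] ℂ)
  eval_res : ∀ {U V : Opens M} (h : U ≤ V) (hx : x ∈ U) (f : M.sections V),
    eval U hx (M.res h f) = eval V (h hx) f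

section
variable {M : RingedSuperspace.{u, v}}

theorem PointEval.ne_zero_of_isUnitAt {x : M} (ev : PointEval M x) {U : Opens M} (hx : x ∈ U)
    {f : M.sections U} (hf : M.IsUnitAt f x) : ev.eval U hx f ≠ 0 := by
  obtain ⟨W, h, hxW, hu⟩ := hf
  rw [← ev.eval_res h hxW]
  exact (hu.map (ev.eval W hxW)).ne_zero

theorem mem_preimage_of_mem (ψ : M.Parametrization) {p : ψ.domain} {U : Opens M}
    (h : ψ.hom.base p ∈ U) : p.1 ∈ ψ.preimage U := ψ.mem_preimage.2 ⟨p.2, h⟩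

/-- Evaluation at a point of a parametrization: all odd coordinates are set to zero. -/
def parametrizationEval (ψ : M.Parametrization) (p : ψ.domain) : PointEval M (ψ.hom.base p) where
  eval U h :=
    { toFun := fun f => Grassmann.aug ψ.k ((ψ.pullback U f).1 ⟨p.1, mem_preimage_of_mem ψ h⟩)
      map_one' := by rw [map_one]; exact map_one _
      map_mul' := fun f g => by rw [map_mul]; exact map_mul _ _ _
      map_zero' := by rw [map_zero]; exact map_zero _
      map_add' := fun f g => by rw [map_add]; exact map_add _ _ _
      commutes' := fun c => by rw [AlgHom.commutes]; exact AlgHom.commutes _ c }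
  eval_res h hx f := by
    change Grassmann.aug ψ.k _ = Grassmann.aug ψ.k _
    rw [ψ.pullback_res]; rfl

theorem isUnitAt_of_eval_ne_zero (ψ : M.Parametrization) (p : ψ.domain) {U : Opens M}
    (h : ψ.hom.base p ∈ U) (f : M.sections U) (hf : (parametrizationEval ψ p).eval U h f ≠ 0) :
    M.IsUnitAt f (ψ.hom.base p) := by
  obtain ⟨W, hW, hpW, hu⟩ := model_isUnitAt (ψ.pullback U f) ⟨p.1, mem_preimage_of_mem ψ h⟩ hf
  refine ψ.hom.isLocal f p h ⟨Opens.comap ⟨Subtype.val, continuous_subtype_val⟩ W, ?_, hpW, ?_⟩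
  · intro q hq
    obtain ⟨_, hq'⟩ := ψ.mem_preimage.1 (hW hq)
    exact hq'
  · have hle : (model ψ.n ψ.m ψ.k).imageOpens ψ.domain
        (Opens.comap ⟨Subtype.val, continuous_subtype_val⟩ W) ≤ W := by
      rintro _ ⟨q, hq, rfl⟩; exact hq
    have := hu.map ((model ψ.n ψ.m ψ.k).res hle)
    exact this

theorem PointEval.eq_parametrizationEval (ψ : M.Parametrization) (p : ψ.domain)
    (ev : PointEval M (ψ.hom.base p)) {U : Opens M} (h : ψ.hom.base p ∈ U) (f : M.sections U) :
    ev.eval U h f = (parametrizationEval ψ p).eval U h f := by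
  by_contra hne
  set d := ev.eval U h f
  have h1 : (parametrizationEval ψ p).eval U h (f - algebraMap ℂ _ d) ≠ 0 := by
    rw [map_sub, AlgHom.commutes]
    exact fun h0 => hne (sub_eq_zero.1 h0).symm
  refine ev.ne_zero_of_isUnitAt h (isUnitAt_of_eval_ne_zero ψ p h _ h1) ?_
  rw [map_sub, AlgHom.commutes]
  exact sub_self _

end

variable (M : MixedSupermanifold.{u, v})

theorem nonempty_pointEval (x : M.carrier) : Nonempty (PointEval M.toRingedSuperspace x) := by
  obtain ⟨ψ, p, rfl⟩ := M.locallyModel x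
  exact ⟨parametrizationEval ψ p⟩

theorem pointEval_unique {x : M.carrier} (ev ev' : PointEval M.toRingedSuperspace x)
    {U : Opens M.carrier} (h : x ∈ U) (f : M.sections U) : ev.eval U h f = ev'.eval U h f := by
  obtain ⟨ψ, p, rfl⟩ := M.locallyModel x
  rw [ev.eq_parametrizationEval, ev'.eq_parametrizationEval]

/-- The complex valued function underlying a section. Its value at `x` is the image under the
homomorphism from the stalk at `x` to `ℂ`, which exists and is unique by `nonempty_pointEval` and
`pointEval_unique`. The sections with value zero everywhere are the (locally) nilpotent ones. -/
def value {U : Opens M.carrier} : M.sections U →ₐ[ℂ] (U → ℂ) :=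
  AlgHom.pi fun x => (Classical.choice (M.nonempty_pointEval x.1)).eval U x.2

theorem value_res {U V : Opens M.carrier} (h : U ≤ V) (f : M.sections V) (x : U) :
    M.value (M.res h f) x = M.value f ⟨x.1, h x.2⟩ :=
  PointEval.eval_res _ h x.2 f

theorem value_eq {U : Opens M.carrier} (f : M.sections U) (x : U)
    (ev : PointEval M.toRingedSuperspace x.1) : M.value f x = ev.eval U x.2 f :=
  M.pointEval_unique _ _ _ _

theorem isUnitAt_of_value_ne_zero {U : Opens M.carrier} (f : M.sections U) (x : U)
    (h : M.value f x ≠ 0) : M.IsUnitAt f x.1 := by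
  obtain ⟨x, hx⟩ := x
  obtain ⟨ψ, p, rfl⟩ := M.locallyModel x
  rw [M.value_eq f _ (parametrizationEval ψ p)] at h
  exact isUnitAt_of_eval_ne_zero ψ p hx f h

theorem exists_isNilpotent_of_value_eq_zero {U : Opens M.carrier} (f : M.sections U)
    (hf : ∀ x, M.value f x = 0) (x : U) :
    ∃ (W : Opens M.carrier) (h : W ≤ U), x.1 ∈ W ∧ IsNilpotent (M.res h f) := by
  obtain ⟨x, hx⟩ := x
  obtain ⟨ψ, p, rfl⟩ := M.locallyModel x
  let R : Opens M.carrier := ⟨Set.range ψ.hom.base, ψ.isOpenImmersion.1.isOpen_range⟩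
  refine ⟨U ⊓ R, inf_le_left, ⟨hx, p, rfl⟩, Module.finrank ℂ (Grassmann ψ.k), ?_⟩
  apply (ψ.isOpenImmersion.2 (U ⊓ R) (fun y hy => hy.2)).1
  change ψ.pullback _ _ = ψ.pullback _ _
  rw [map_pow, map_zero]
  refine Subtype.ext (funext fun q => ?_)
  obtain ⟨hq, hq'⟩ := ψ.mem_preimage.1 q.2
  refine Grassmann.pow_eq_zero_of_aug ?_
  have h1 := M.value_eq (M.res (inf_le_left : U ⊓ R ≤ U) f) ⟨_, hq'⟩
    (parametrizationEval ψ ⟨q.1, hq⟩)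
  rw [value_res, hf] at h1
  exact h1.symm

theorem value_odd {U : Opens M.carrier} {f : M.sections U} (hf : f ∈ M.parity U 1) :
    M.value f = 0 := by
  have h := M.odd_anticomm f f hf hf
  have h2 : (2 : ℂ) • (f * f) = 0 := by
    rw [two_smul]; nth_rewrite 1 [h]; abel
  have h3 := congrArg M.value ((smul_eq_zero.1 h2).resolve_left two_ne_zero)
  rw [map_mul, map_zero] at h3
  exact funext fun x => mul_self_eq_zero.1 (congrFun h3 x)

end MixedSupermanifold

namespace EvenVectorField

variable {M : MixedSupermanifold.{u, v}} (X : EvenVectorField M.toRingedSuperspace)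

theorem apply_one (U : Opens M.carrier) : X.toFun U 1 = 0 := by
  have := X.leibniz (1 : M.sections U) 1
  simpa using this

theorem apply_pow {U : Opens M.carrier} (f : M.sections U) (hf : f ∈ M.parity U 0) (r : ℕ) :
    X.toFun U (f ^ (r + 1)) = ((r : ℂ) + 1) • (f ^ r * X.toFun U f) := by
  induction r with
  | zero => simp
  | succ r ih =>
    rw [pow_succ, X.leibniz, ih, smul_mul_assoc, mul_assoc, ← M.even_comm f _ hf, ← mul_assoc,
      ← pow_succ]
    push_cast
    module

theorem value_apply_nilpotent (r : ℕ) : ∀ {U : Opens M.carrier} (f : M.sections U),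
    f ∈ M.parity U 0 → f ^ r = 0 → ∀ x, M.value (X.toFun U f) x = 0 := by
  induction r with
  | zero =>
    intro U f _ h x
    have h1 := congrFun (congrArg M.value h) x
    rw [pow_zero, map_one, map_zero] at h1
    exact absurd h1 one_ne_zero
  | succ r ih =>
    intro U f hf h x
    by_contra hne
    obtain ⟨W, hW, hx, hu⟩ := M.isUnitAt_of_value_ne_zero _ x hne
    have hX := X.apply_pow f hf r
    rw [h, map_zero] at hX
    have h0 := (smul_eq_zero.1 hX.symm).resolve_left (by exact_mod_cast Nat.succ_ne_zero r)
    have h1 := congrArg (M.res hW) h0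
    rw [map_mul, map_zero, map_pow] at h1
    have h2 := hu.mul_left_eq_zero.1 h1
    have h3 := ih (M.res hW f) (M.res_parity _ _ _ hf) h2 ⟨x.1, hx⟩
    rw [X.map_res, M.value_res] at h3
    exact hne h3

theorem value_apply_of_value_eq_zero {U : Opens M.carrier} (f : M.sections U)
    (hf : ∀ x, M.value f x = 0) (x : U) : M.value (X.toFun U f) x = 0 := by
  obtain ⟨f₀, f₁, h0, h1, rfl⟩ :
      ∃ f₀ f₁, f₀ ∈ M.parity U 0 ∧ f₁ ∈ M.parity U 1 ∧ f₀ + f₁ = f := by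
    obtain ⟨a, b, ha, hb, h⟩ := Submodule.codisjoint_iff_exists_add_eq.1 (M.isCompl U).codisjoint f
    exact ⟨a, b, ha, hb, h⟩
  have hz : ∀ x, M.value f₀ x = 0 := fun x => by
    have := hf x
    rwa [map_add, M.value_odd h1, add_zero] at this
  obtain ⟨W, hW, hx, r, hr⟩ := M.exists_isNilpotent_of_value_eq_zero f₀ hz x
  have h2 := X.value_apply_nilpotent r _ (M.res_parity hW 0 _ h0) hr ⟨x.1, hx⟩
  rw [X.map_res, M.value_res] at h2
  rw [map_add, map_add, M.value_odd (X.map_parity 1 _ h1), add_zero]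
  exact h2

end EvenVectorField

namespace MixedSupermanifold
variable (M : MixedSupermanifold.{u, v})

/-- The section `f` over `W ⊆ U` has the underlying function `φ` on `W`. -/
def IsLift {U W : Opens M.carrier} (h : W ≤ U) (f : M.sections W) (φ : U → ℂ) : Prop :=
  ∀ y : W, M.value f y = φ ⟨y.1, h y.2⟩

/-- The sections over `U` of the quotient sheaf `𝒪 / 𝒥` by the sheaf of nilpotent sections, as
complex valued functions: those functions which are locally the underlying function of a section. -/
def bodySections (U : Opens M.carrier) : Subalgebra ℂ (U → ℂ) where
  carrier := {φ | ∀ x : U, ∃ (W : Opens M.carrier) (h : W ≤ U) (f : M.sections W),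
    x.1 ∈ W ∧ M.IsLift h f φ}
  mul_mem' := by
    intro φ φ' hφ hφ' x
    obtain ⟨W, h, f, hx, e⟩ := hφ x
    obtain ⟨W', h', f', hx', e'⟩ := hφ' x
    refine ⟨W ⊓ W', inf_le_left.trans h, M.res inf_le_left f * M.res inf_le_right f',
      ⟨hx, hx'⟩, fun y => ?_⟩
    rw [map_mul, Pi.mul_apply, M.value_res, M.value_res, e, e']; rfl
  add_mem' := by
    intro φ φ' hφ hφ' x
    obtain ⟨W, h, f, hx, e⟩ := hφ x
    obtain ⟨W', h', f', hx', e'⟩ := hφ' x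
    refine ⟨W ⊓ W', inf_le_left.trans h, M.res inf_le_left f + M.res inf_le_right f',
      ⟨hx, hx'⟩, fun y => ?_⟩
    rw [map_add, Pi.add_apply, M.value_res, M.value_res, e, e']; rfl
  algebraMap_mem' c x := ⟨U, le_rfl, algebraMap ℂ _ c, x.2, fun y => by
    rw [AlgHom.commutes]⟩

theorem mem_bodySections {U : Opens M.carrier} {φ : U → ℂ} :
    φ ∈ M.bodySections U ↔ ∀ x : U, ∃ (W : Opens M.carrier) (h : W ≤ U) (f : M.sections W),
      x.1 ∈ W ∧ M.IsLift h f φ := Iff.rfl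

theorem mem_bodySections_of_local {U : Opens M.carrier} {φ : U → ℂ}
    (H : ∀ x : U, ∃ (V : Opens M.carrier) (φ' : M.bodySections V), x.1 ∈ V ∧
      ∀ y (h : y ∈ V) (h' : y ∈ U), φ'.1 ⟨y, h⟩ = φ ⟨y, h'⟩) : φ ∈ M.bodySections U := by
  rw [mem_bodySections]
  intro x
  obtain ⟨V, φ', hx, e⟩ := H x
  obtain ⟨W, h, f, hxW, e'⟩ := M.mem_bodySections.1 φ'.2 ⟨x.1, hx⟩
  refine ⟨W ⊓ U, inf_le_right, M.res inf_le_left f, ⟨hxW, x.2⟩, fun y => ?_⟩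
  rw [M.value_res, e', e]

/-- Restriction of functions. -/
def bodyRes {U V : Opens M.carrier} (h : U ≤ V) : M.bodySections V →ₐ[ℂ] M.bodySections U where
  toFun φ := ⟨fun x => φ.1 ⟨x.1, h x.2⟩, M.mem_bodySections_of_local fun x =>
    ⟨V, φ, h x.2, fun _ _ _ => rfl⟩⟩
  map_one' := rfl
  map_mul' _ _ := rfl
  map_zero' := rfl
  map_add' _ _ := rfl
  commutes' _ := rfl

/-- The underlying mixed manifold `M₀` of a mixed supermanifold `M`: the same base with the
purely even sheaf `𝒪 / 𝒥`. -/
def body : RingedSuperspace.{u, u} where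
  carrier := M.carrier
  sections U := M.bodySections U
  res h := M.bodyRes h
  res_self _ := rfl
  res_res _ _ _ := rfl
  glue {ι} W s hs := by
    have hs' : ∀ i j p (hi : p ∈ W i) (hj : p ∈ W j), (s i).1 ⟨p, hi⟩ = (s j).1 ⟨p, hj⟩ :=
      fun i j p hi hj => congrFun (congrArg Subtype.val (hs i j)) ⟨p, hi, hj⟩
    have hc : ∀ p : (iSup W : Opens M.carrier), ∃ i, p.1 ∈ W i := fun p => Opens.mem_iSup.1 p.2
    choose c hc using hc
    refine ⟨⟨fun p => (s (c p)).1 ⟨p.1, hc p⟩, M.mem_bodySections_of_local fun p =>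
      ⟨W (c p), s _, hc p, fun q _ _ => hs' _ _ q _ _⟩⟩, ?_, ?_⟩
    · intro i
      exact Subtype.ext (funext fun p => hs' _ _ _ _ _)
    · intro f hf
      refine Subtype.ext (funext fun p => ?_)
      exact congrFun (congrArg Subtype.val (hf (c p))) ⟨p.1, hc p⟩
  parity _ i := if i = 0 then ⊤ else ⊥
  graded U :=
    { one_mem := by simp
      mul_mem := by
        intro i j a b ha hb
        by_cases hi : i = 0
        · by_cases hj : j = 0
          · simp [hi, hj]
          · rw [if_neg hj, Submodule.mem_bot] at hb
            simp [hb]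
        · rw [if_neg hi, Submodule.mem_bot] at ha
          simp [ha] }
  isCompl U := by simpa using isCompl_top_bot
  res_parity h i f hf := by
    by_cases hi : i = 0
    · simp [hi]
    · rw [if_neg hi, Submodule.mem_bot] at hf
      simp [hf]
  even_comm f g _ := mul_comm f g
  odd_anticomm f g hf _ := by
    rw [if_neg one_ne_zero, Submodule.mem_bot] at hf
    simp [hf]

/-- The quotient map from the structure sheaf of `M` to that of `M₀`. -/
def toBody (U : Opens M.carrier) (f : M.sections U) : M.body.sections U :=
  ⟨M.value f, fun x => ⟨U, le_rfl, f, x.2, fun _ => rfl⟩⟩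

end MixedSupermanifold

namespace EvenVectorField
variable {M : MixedSupermanifold.{u, v}} (X : EvenVectorField M.toRingedSuperspace)

/-- Auxiliary to `underlying`: the value of `X f` at `x` where `f` is a lift of `φ` near `x`. -/
def bodyFun {U : Opens M.carrier} (φ : M.bodySections U) (x : U) : ℂ :=
  let h := M.mem_bodySections.1 φ.2 x
  M.value (X.toFun _ h.choose_spec.choose_spec.choose) ⟨x.1, h.choose_spec.choose_spec.choose_spec.1⟩

theorem bodyFun_eq {U W : Opens M.carrier} (φ : M.bodySections U) (h : W ≤ U) (f : M.sections W)
    (hf : M.IsLift h f φ.1) (x : W) :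
    X.bodyFun φ ⟨x.1, h x.2⟩ = M.value (X.toFun W f) x := by
  have H := M.mem_bodySections.1 φ.2 ⟨x.1, h x.2⟩
  set W' := H.choose with hW'
  set h' := H.choose_spec.choose
  set f' := H.choose_spec.choose_spec.choose with hf'
  have hx' : x.1 ∈ W' := H.choose_spec.choose_spec.choose_spec.1
  have hl' : M.IsLift h' f' φ.1 := H.choose_spec.choose_spec.choose_spec.2
  change M.value (X.toFun W' f') ⟨x.1, hx'⟩ = _
  have key := X.value_apply_of_value_eq_zero
    (M.res (inf_le_left : W ⊓ W' ≤ W) f - M.res (inf_le_right : W ⊓ W' ≤ W') f')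
    (fun y => by rw [map_sub, Pi.sub_apply, M.value_res, M.value_res, hf, hl', sub_self])
    ⟨x.1, x.2, hx'⟩
  rw [map_sub, map_sub, Pi.sub_apply, X.map_res, X.map_res, M.value_res, M.value_res,
    sub_eq_zero] at key
  exact key.symm

theorem bodyFun_mem {U : Opens M.carrier} (φ : M.bodySections U) :
    X.bodyFun φ ∈ M.bodySections U := by
  rw [M.mem_bodySections]
  intro x
  obtain ⟨W, h, f, hx, hf⟩ := M.mem_bodySections.1 φ.2 x
  exact ⟨W, h, X.toFun W f, hx, fun y => (X.bodyFun_eq φ h f hf y).symm⟩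

/-- The vector field on `M₀` underlying the even vector field `X`: it sends the function
underlying `f` to the function underlying `X f`. -/
def underlying : EvenVectorField M.body where
  toFun U :=
    { toFun := fun φ => ⟨X.bodyFun φ, X.bodyFun_mem φ⟩
      map_add' := by
        intro φ φ'
        refine Subtype.ext (funext fun x => ?_)
        obtain ⟨W, h, f, hx, hf⟩ := M.mem_bodySections.1 φ.2 x
        obtain ⟨W', h', f', hx', hf'⟩ := M.mem_bodySections.1 φ'.2 x
        have e1 := X.bodyFun_eq φ (inf_le_left.trans h) (M.res (inf_le_left : W ⊓ W' ≤ W) f)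
          (fun y => by rw [M.value_res, hf]) ⟨x.1, hx, hx'⟩
        have e2 := X.bodyFun_eq φ' (inf_le_left.trans h) (M.res (inf_le_right : W ⊓ W' ≤ W') f')
          (fun y => by rw [M.value_res, hf']) ⟨x.1, hx, hx'⟩
        have e3 := X.bodyFun_eq (φ + φ') (inf_le_left.trans h)
          (M.res (inf_le_left : W ⊓ W' ≤ W) f + M.res (inf_le_right : W ⊓ W' ≤ W') f')
          (fun y => by
            rw [map_add, Pi.add_apply, M.value_res, M.value_res, hf, hf']; rfl) ⟨x.1, hx, hx'⟩
        change X.bodyFun (φ + φ') x = X.bodyFun φ x + X.bodyFun φ' x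
        rw [e1, e2, e3, map_add, map_add, Pi.add_apply]
      map_smul' := by
        intro c φ
        refine Subtype.ext (funext fun x => ?_)
        obtain ⟨W, h, f, hx, hf⟩ := M.mem_bodySections.1 φ.2 x
        have e1 := X.bodyFun_eq φ h f hf ⟨x.1, hx⟩
        have e3 := X.bodyFun_eq (c • φ) h (c • f)
          (fun y => by rw [map_smul, Pi.smul_apply, hf]; rfl) ⟨x.1, hx⟩
        change X.bodyFun (c • φ) x = c • X.bodyFun φ x
        rw [e1, e3, map_smul, map_smul, Pi.smul_apply] }
  leibniz {U} φ φ' := by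
    refine Subtype.ext (funext fun x => ?_)
    obtain ⟨W, h, f, hx, hf⟩ := M.mem_bodySections.1 φ.2 x
    obtain ⟨W', h', f', hx', hf'⟩ := M.mem_bodySections.1 φ'.2 x
    have e1 := X.bodyFun_eq φ (inf_le_left.trans h) (M.res (inf_le_left : W ⊓ W' ≤ W) f)
      (fun y => by rw [M.value_res, hf]) ⟨x.1, hx, hx'⟩
    have e2 := X.bodyFun_eq φ' (inf_le_left.trans h) (M.res (inf_le_right : W ⊓ W' ≤ W') f')
      (fun y => by rw [M.value_res, hf']) ⟨x.1, hx, hx'⟩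
    have e3 := X.bodyFun_eq (φ * φ') (inf_le_left.trans h)
      (M.res (inf_le_left : W ⊓ W' ≤ W) f * M.res (inf_le_right : W ⊓ W' ≤ W') f')
      (fun y => by
        rw [map_mul, Pi.mul_apply, M.value_res, M.value_res, hf, hf']; rfl) ⟨x.1, hx, hx'⟩
    change X.bodyFun (φ * φ') x = X.bodyFun φ x * φ'.1 x + φ.1 x * X.bodyFun φ' x
    rw [e1, e2, e3, X.leibniz, map_add, map_mul, map_mul, Pi.add_apply, Pi.mul_apply, Pi.mul_apply,
      M.value_res _ f, M.value_res _ f', hf, hf']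
  map_res {U V} h φ := by
    refine Subtype.ext (funext fun x => ?_)
    obtain ⟨W, hW, f, hx, hf⟩ := M.mem_bodySections.1 φ.2 ⟨x.1, h x.2⟩
    have e1 := X.bodyFun_eq φ (inf_le_left.trans hW) (M.res (inf_le_left : W ⊓ U ≤ W) f)
      (fun y => by rw [M.value_res, hf]) ⟨x.1, hx, x.2⟩
    have e2 := X.bodyFun_eq (M.bodyRes h φ) inf_le_right (M.res (inf_le_left : W ⊓ U ≤ W) f)
      (fun y => by rw [M.value_res, hf]; rfl) ⟨x.1, hx, x.2⟩
    exact e2.trans e1.symm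
  map_parity {U} i φ h := by
    change φ ∈ (if i = 0 then ⊤ else ⊥ : Submodule ℂ (M.bodySections U)) at h
    change _ ∈ (if i = 0 then ⊤ else ⊥ : Submodule ℂ (M.bodySections U))
    by_cases hi : i = 0
    · rw [if_pos hi]; trivial
    · rw [if_neg hi] at h ⊢
      rw [show φ = 0 from h, map_zero]
      exact Submodule.zero_mem _

/-- An even vector field on `M` is real if the underlying vector field on `M₀` maps real valued
functions to real valued functions. -/
def IsReal : Prop :=
  ∀ (U : Opens M.carrier) (φ : M.bodySections U), (∀ x, (φ.1 x).im = 0) →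
    ∀ x, ((X.underlying.toFun U φ : M.bodySections U).1 x).im = 0

end EvenVectorField

/-! ### Flows -/

/-- The morphism `Θ : V → M` is a flow of `X` on the open subspace `V` of `ℝ × M`: the base of `V`
contains `{0} × M`, the equation `∂ₜ ∘ Θ♯ = Θ♯ ∘ X` holds, and the restriction of `Θ` to `{0} × M` is
the identity (on points, and on sections; the inclusion `h` in the last field always holds, as a
consequence of `base_zero`). -/
structure IsFlow {M : RingedSuperspace.{u, v}} (X : EvenVectorField M) (V : Opens M.timeProduct)
    (Θ : Hom (M.timeProduct.restrict V) M) : Prop where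
  zero_mem : ∀ x : M, ((0, x) : ℝ × M) ∈ V
  hasTimeDeriv : ∀ (U : Opens M) (f : M.sections U),
    M.HasTimeDeriv (Θ.pullback U f) (Θ.pullback U (X.toFun U f))
  base_zero : ∀ x : M, Θ.base ⟨((0, x) : ℝ × M), zero_mem x⟩ = x
  pullback_zero : ∀ (U : Opens M) (f : M.sections U)
    (h : U ≤ M.slice (M.timeProduct.imageOpens V (Opens.comap Θ.base U)) 0),
    M.res h ((Θ.pullback U f : M.timeSections _).1 0) = f

/-- A flow domain of `X`: an open subspace `V` of `ℝ × M` which contains `{0} × M`, meets every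
`ℝ × {x}` in an interval, and on which a flow of `X` exists. -/
structure IsFlowDomain {M : RingedSuperspace.{u, v}} (X : EvenVectorField M) (V : Opens M.timeProduct) :
    Prop where
  zero_mem : ∀ x : M, ((0, x) : ℝ × M) ∈ V
  ordConnected : ∀ x : M, {t : ℝ | ((t, x) : ℝ × M) ∈ V}.OrdConnected
  exists_flow : ∃ Θ : Hom (M.timeProduct.restrict V) M, IsFlow X V Θ

/-- `V` is the maximal flow domain of `X`, i.e. the largest one, and `Θ` is the one and only flow
of `X` on `V`. -/
structure IsMaximalFlow {M : RingedSuperspace.{u, v}} (X : EvenVectorField M) (V : Opens M.timeProduct)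
    (Θ : Hom (M.timeProduct.restrict V) M) : Prop where
  isGreatest : IsGreatest {V' | IsFlowDomain X V'} V
  isFlow : IsFlow X V Θ
  unique : ∀ Θ', IsFlow X V Θ' → Θ' = Θ

/-- The morphism `Θ₀ : V₀ → M₀`, where `V₀` is the open subspace of `ℝ × M₀` with the same base as
`V`, is the underlying morphism of `Θ : V → M`: both have the same map on points, and the function
underlying `Θ♯ f` is the pullback under `Θ₀` of the function underlying `f`. (The quantified `h` and
`h₀` say the same, by `base_eq`.) -/
structure IsUnderlying {M : MixedSupermanifold.{u, v}} {V : Opens (ℝ × M.carrier)}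
    (Θ : Hom (M.timeProduct.restrict V) M.toRingedSuperspace)
    (Θ₀ : Hom (M.body.timeProduct.restrict V) M.body) : Prop where
  base_eq : ∀ p : V, Θ₀.base p = Θ.base p
  pullback_eq : ∀ (U : Opens M.carrier) (f : M.sections U) (t : ℝ) (x : M.carrier)
    (h : x ∈ M.slice (M.timeProduct.imageOpens V (Opens.comap Θ.base U)) t)
    (h₀ : x ∈ M.body.slice (M.body.timeProduct.imageOpens V (Opens.comap Θ₀.base U)) t),
    ((Θ₀.pullback U (M.toBody U f) : M.body.timeSections _).1 t : M.bodySections _).1 ⟨x, h₀⟩ =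
      M.value ((Θ.pullback U f : M.timeSections _).1 t) ⟨x, h⟩

end MixedSuper

end

open MixedSuper

open TopologicalSpace
open scoped ContDiff
open Filter Topology
noncomputable section
set_option linter.checkUnivs false
namespace MixedSuper
/-! ### The Grassmann algebra as a normed algebra -/

namespace Grassmann
variable {k : ℕ}

/-! A section is determined by its values at Grassmann valued points, the parity preserving
homomorphisms from a stalk to some `Grassmann k` (`LPoint`, `section_ext_of_app`). In a chart such a
point amounts to a point of a finite dimensional real vector space: a base point, an even nilpotent
correction for every even coordinate and an odd value for every odd coordinate (`lpointOf_coords`).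
The value of a section there is a finite Taylor expansion, the exponential of a nilpotent even
derivation, and therefore multiplicative (`taylor_mul`).

A flow of `X` moves Grassmann valued points along curves `A` with `d/dt A(f) = A(X f)`. In a chart
this is an ordinary differential equation on the phase space (`hasDerivAt_coords`,
`isIntegral_of_hasDerivAt`), because `A ↦ A ∘ X` and the derivative along the induced field are
twisted derivations that agree on coordinates (`fderiv_taylor_field`). Reality of `X` is what keeps
the `n` real coordinates real. The local flow comes from the inverse function theorem on a Banach
space of paths. This gives smooth dependence on the data, and linearizing the integral equation
shows that the dependence is complex linear in the holomorphic directions (`exists_flow`).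
Uniqueness for the equation, together with the Hausdorff property, gives uniqueness of integral
curves (`IsIntegral.eqOn`).

The nilpotent coordinates do not shorten the life of an integral curve. Multiplying the odd
generators of the Grassmann algebra by a small nonzero real number is an automorphism that commutes
with `X` and brings the point close to its base point, so the local time of existence depends on the
base point alone (`exists_local_family`). By continuation, the integral curve of any Grassmann
valued point lives as long as that of its base point (`exists_family`). The set `flowSet` of pairs
(time, base point) is hence open and serves all Grassmann algebras at once.

Moving the universal point of a chart, the one that reads off the local expression of a section,
yields the local expression of the pulled back section. The flow of every other Grassmann valued
point is the Taylor expansion of this one (`flowPt_app_eq_taylor`), so the local pullbacks agree on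
overlaps and glue to `maximalFlow`. Conversely, any flow moves universal points along integral
curves, so uniqueness of these curves gives both the uniqueness of the flow and the maximality of
the domain (`isMaximalFlow_maximalFlow`).

The underlying manifold is itself a mixed supermanifold, with no odd coordinates, and the same
construction applies to it. Integral curves of `X` and of its underlying field have the same base
curves (`IsIntegral.toBody`, `IsIntegral.ofBody`), so the two flow domains coincide and the flows
correspond. -/

instance : NormedRing (Grassmann k) :=
  letI := Matrix.linftyOpNormedRing (n := (Finset (Fin k))) (α := ℂ)
  -- Left multiplication embeds the algebra into matrices with an operator norm, so the induced norm
  -- is submultiplicative. In finite dimension the choice of norm does not affect smoothness.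
  NormedRing.induced (Grassmann k) _ (Algebra.leftMulMatrix (Pi.basisFun ℂ (Fin k)).ExteriorAlgebra)
    (Algebra.leftMulMatrix_injective _)

instance : NormedAlgebra ℂ (Grassmann k) :=
  letI := Matrix.linftyOpNormedRing (n := (Finset (Fin k))) (α := ℂ)
  letI := Matrix.linftyOpNormedAlgebra (n := (Finset (Fin k))) (R := ℂ) (α := ℂ)
  NormedAlgebra.induced ℂ (Grassmann k) _ (Algebra.leftMulMatrix (Pi.basisFun ℂ (Fin k)).ExteriorAlgebra)

instance : IsArtinianRing (Grassmann k) := IsArtinianRing.of_finite ℂ _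

/-! ### The filtration by powers of the augmentation ideal -/

/-- The ideal of elements without constant term, as a subspace. -/
def nilIdeal (k : ℕ) : Submodule ℂ (Grassmann k) := LinearMap.ker (aug k).toLinearMap

theorem mem_nilIdeal {a : Grassmann k} : a ∈ nilIdeal k ↔ aug k a = 0 := Iff.rfl

/-- Every left multiple `y * a` is again without constant term, hence nilpotent, so `1 - y * a` is a
unit and cannot lie in a maximal ideal. -/
theorem mem_jacobson_of_mem_nilIdeal {a : Grassmann k} (ha : a ∈ nilIdeal k) :
    a ∈ Ring.jacobson (Grassmann k) := by
  rw [Ring.jacobson_eq_sInf_isMaximal, Submodule.mem_sInf]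
  intro m hm
  by_contra hna
  obtain ⟨y, i, hi, hy⟩ := Ideal.IsMaximal.exists_inv hm hna
  have h1 : IsNilpotent (y * a) := isNilpotent_of_aug (by rw [map_mul, mem_nilIdeal.1 ha, mul_zero])
  have h2 : IsUnit i := by
    rw [eq_sub_of_add_eq' hy]
    exact h1.isUnit_one_sub
  exact hm.ne_top (Ideal.eq_top_of_isUnit_mem _ hi h2)

/-- Nilpotency of each single element does not bound products of different elements. A uniform
exponent comes from the nilpotency of the Jacobson radical of an Artinian ring. The bound `2 ≤ K`
keeps the constant and the linear term in the truncated exponential series. -/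
theorem exists_nilIdeal_pow_eq_bot (k : ℕ) : ∃ K, 2 ≤ K ∧ nilIdeal k ^ K = ⊥ := by
  obtain ⟨K, hK⟩ := IsSemiprimaryRing.isNilpotent (R := Grassmann k)
  have h : ∀ r, nilIdeal k ^ r ≤ ((Ring.jacobson (Grassmann k)) ^ r).restrictScalars ℂ := by
    intro r
    induction r with
    | zero =>
      rw [Submodule.pow_zero, Submodule.pow_zero]
      intro x _
      exact Ideal.one_eq_top (R := Grassmann k) ▸ Submodule.mem_top
    | succ r ih =>
      rw [pow_succ, Submodule.mul_le]
      intro a ha b hb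
      have := Ideal.mul_mem_mul (ih ha) (mem_jacobson_of_mem_nilIdeal hb)
      rwa [← Submodule.pow_succ] at this
  refine ⟨K + 2, by omega, ?_⟩
  have h2 := h K
  rw [hK] at h2
  rw [pow_add, le_bot_iff.1 (h2 : _ ≤ (⊥ : Submodule ℂ (Grassmann k)))]
  simp

/-- An exponent which annihilates the ideal of elements without constant term. -/
def nilDegree (k : ℕ) : ℕ := (exists_nilIdeal_pow_eq_bot k).choose

theorem two_le_nilDegree (k : ℕ) : 2 ≤ nilDegree k := (exists_nilIdeal_pow_eq_bot k).choose_spec.1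

theorem nilIdeal_pow_nilDegree (k : ℕ) : nilIdeal k ^ nilDegree k = ⊥ :=
  (exists_nilIdeal_pow_eq_bot k).choose_spec.2

theorem nilIdeal_pow_eq_bot {r : ℕ} (h : nilDegree k ≤ r) : nilIdeal k ^ r = ⊥ := by
  rw [← Nat.add_sub_cancel' h, pow_add, nilIdeal_pow_nilDegree, Submodule.bot_mul]

/-- The filtration of the Grassmann algebra by the powers of the ideal of elements without constant
term. -/
def nilFilt (k r : ℕ) : Submodule ℂ (Grassmann k) := nilIdeal k ^ r * ⊤

/-- This is the purpose of the factor `⊤` in the filtration: the zeroth power of a subspace consists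
of the scalars only. -/
theorem mem_nilFilt_zero (a : Grassmann k) : a ∈ nilFilt k 0 := by
  rw [nilFilt, pow_zero, one_mul]
  trivial

theorem nilFilt_eq_bot {r : ℕ} (h : nilDegree k ≤ r) : nilFilt k r = ⊥ := by
  rw [nilFilt, nilIdeal_pow_eq_bot h, Submodule.bot_mul]

theorem mul_mem_nilFilt_succ {r : ℕ} {a b : Grassmann k} (ha : a ∈ nilIdeal k)
    (hb : b ∈ nilFilt k r) : a * b ∈ nilFilt k (r + 1) := by
  rw [nilFilt, pow_succ', mul_assoc]
  exact Submodule.mul_mem_mul ha hb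

/-- The factor `⊤` caught between the two powers is absorbed on the right, because the augmentation
ideal is stable under left multiplication. -/
theorem mul_mem_nilFilt {i j : ℕ} {a b : Grassmann k} (ha : a ∈ nilFilt k i)
    (hb : b ∈ nilFilt k j) : a * b ∈ nilFilt k (i + j) := by
  have h0 : (⊤ : Submodule ℂ (Grassmann k)) * nilIdeal k ≤ nilIdeal k :=
    Submodule.mul_le.2 fun x _ y hy => by rw [mem_nilIdeal, map_mul, mem_nilIdeal.1 hy, mul_zero]
  have h1 : ⊤ * nilFilt k j ≤ nilFilt k j := by
    cases j with
    | zero => exact fun x _ => mem_nilFilt_zero x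
    | succ j =>
      rw [nilFilt, pow_succ', mul_assoc, ← mul_assoc]
      exact mul_le_mul' h0 le_rfl
  have h2 : nilFilt k i * nilFilt k j ≤ nilFilt k (i + j) := by
    calc nilFilt k i * nilFilt k j = nilIdeal k ^ i * (⊤ * nilFilt k j) := by rw [nilFilt, mul_assoc]
      _ ≤ nilIdeal k ^ i * nilFilt k j := mul_le_mul' le_rfl h1
      _ = nilFilt k (i + j) := by rw [nilFilt, nilFilt, pow_add, mul_assoc]
  exact h2 (Submodule.mul_mem_mul ha hb)

/-- The even elements without constant term. -/
def evenNil (k : ℕ) : Submodule ℂ (Grassmann k) := parity k 0 ⊓ nilIdeal k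

theorem algebraMap_mem_even (c : ℂ) : algebraMap ℂ (Grassmann k) c ∈ parity k 0 :=
  (CliffordAlgebra.one_le_evenOdd_zero _) (Submodule.mem_one.2 ⟨c, rfl⟩)

/-- A linear projection onto the even elements without constant term. -/
def evenNilProj (k : ℕ) : Grassmann k →L[ℂ] evenNil k :=
  LinearMap.toContinuousLinearMap
    ((evenProj k - (Algebra.linearMap ℂ (Grassmann k)).comp
      ((aug k).toLinearMap.comp (evenProj k))).codRestrict (evenNil k) fun a =>
        ⟨Submodule.sub_mem _ (evenProj_mem a) (algebraMap_mem_even _), by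
          rw [SetLike.mem_coe, mem_nilIdeal]; simp⟩)

theorem coe_evenNilProj {a : Grassmann k} (h : a ∈ parity k 0) :
    (evenNilProj k a : Grassmann k) = a - algebraMap ℂ _ (aug k a) := by
  change evenProj k a - algebraMap ℂ _ (aug k (evenProj k a)) = _
  rw [evenProj_of_even h]

/-- The linear projection onto the odd part. -/
def oddProj (k : ℕ) : Grassmann k →L[ℂ] parity k 1 :=
  LinearMap.toContinuousLinearMap
    ((LinearMap.id - evenProj k).codRestrict (parity k 1) sub_evenProj_mem)

theorem coe_oddProj {a : Grassmann k} (h : a ∈ parity k 1) : (oddProj k a : Grassmann k) = a := by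
  change a - evenProj k a = a
  rw [evenProj_of_odd h, sub_zero]

/-- The augmentation as a continuous linear map. -/
def augL (k : ℕ) : Grassmann k →L[ℂ] ℂ := LinearMap.toContinuousLinearMap (aug k).toLinearMap

@[simp] theorem augL_apply (a : Grassmann k) : augL k a = aug k a := rfl

/-! ### Homomorphisms and generators of Grassmann algebras -/

theorem mul_mem_parity {i j : ZMod 2} {a b : Grassmann k} (ha : a ∈ parity k i)
    (hb : b ∈ parity k j) : a * b ∈ parity k (i + j) :=
  CliffordAlgebra.evenOdd_mul_le _ i j (Submodule.mul_mem_mul ha hb)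

/-- Modulo sums, even elements are built from scalars and odd elements from vectors by multiplying
with pairs of vectors, and the image of such a pair is even. -/
theorem map_parity_of_odd {k₀ : ℕ} (f : Grassmann k →ₐ[ℂ] Grassmann k₀)
    (h : ∀ v, f (ExteriorAlgebra.ι ℂ v) ∈ parity k₀ 1) (i : ZMod 2) {a : Grassmann k}
    (ha : a ∈ parity k i) : f a ∈ parity k₀ i := by
  have step : ∀ (i : ZMod 2) (m₁ m₂ : Fin k → ℂ) (x : Grassmann k), f x ∈ parity k₀ i →
      f (ExteriorAlgebra.ι ℂ m₁ * ExteriorAlgebra.ι ℂ m₂ * x) ∈ parity k₀ i := by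
    intro i m₁ m₂ x hx
    rw [map_mul, map_mul]
    have h2 := mul_mem_parity (mul_mem_parity (h m₁) (h m₂)) hx
    rwa [show (1 + 1 + i : ZMod 2) = i by rw [show (1 + 1 : ZMod 2) = 0 from rfl, zero_add]] at h2
  have hi : ∀ j : ZMod 2, j = 0 ∨ j = 1 := by decide
  rcases hi i with rfl | rfl
  · refine CliffordAlgebra.even_induction (Q := (0 : QuadraticForm ℂ (Fin k → ℂ)))
      (motive := fun a _ => f a ∈ parity k₀ 0) ?_ ?_ ?_ a ha
    · intro r
      rw [AlgHom.commutes]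
      exact algebraMap_mem_even r
    · intro x y _ _ hx hy
      rw [map_add]
      exact Submodule.add_mem _ hx hy
    · intro m₁ m₂ x _ hx
      exact step 0 m₁ m₂ x hx
  · refine CliffordAlgebra.odd_induction (Q := (0 : QuadraticForm ℂ (Fin k → ℂ)))
      (P := fun a _ => f a ∈ parity k₀ 1) ?_ ?_ ?_ a ha
    · intro v
      exact h v
    · intro x y _ _ hx hy
      rw [map_add]
      exact Submodule.add_mem _ hx hy
    · intro m₁ m₂ x _ hx
      exact step 1 m₁ m₂ x hx

/-- Both sides are algebra homomorphisms to `ℂ` that kill the generators, since odd elements have no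
constant term. -/
theorem aug_algHom {k₀ : ℕ} (f : Grassmann k →ₐ[ℂ] Grassmann k₀)
    (h : ∀ v, f (ExteriorAlgebra.ι ℂ v) ∈ parity k₀ 1) (a : Grassmann k) :
    aug k₀ (f a) = aug k a := by
  have : (aug k₀).comp f = aug k := ExteriorAlgebra.hom_ext (LinearMap.ext fun v => by
    change aug k₀ (f (ExteriorAlgebra.ι ℂ v)) = aug k (ExteriorAlgebra.ι ℂ v)
    rw [aug_odd (h v), aug_odd (CliffordAlgebra.ι_mem_evenOdd_one _ v)])
  exact DFunLike.congr_fun this a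

/-- The odd generators. -/
def gen (l : Fin k) : Grassmann k := ExteriorAlgebra.ι ℂ (Pi.single l 1)

theorem gen_mem_odd (l : Fin k) : gen l ∈ parity k 1 := CliffordAlgebra.ι_mem_evenOdd_one _ _

theorem ι_eq_sum_gen (v : Fin k → ℂ) : ExteriorAlgebra.ι ℂ v = ∑ l, v l • (gen l : Grassmann k) := by
  conv_lhs => rw [pi_eq_sum_univ' v]
  rw [map_sum]
  refine Finset.sum_congr rfl fun l _ => ?_
  rw [map_smul, gen]

/-- Needed to split off, from the value of a section at one point, a part divisible by the odd
coordinates. -/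
theorem exists_eq_add_sum_gen (a : Grassmann k) :
    ∃ (c : ℂ) (α : Fin k → Grassmann k), a = algebraMap ℂ _ c + ∑ l, gen l * α l := by
  induction a using ExteriorAlgebra.induction with
  | algebraMap r => exact ⟨r, 0, by simp⟩
  | ι v => exact ⟨0, fun l => algebraMap ℂ _ (v l), by
      rw [ι_eq_sum_gen, map_zero, zero_add]
      exact Finset.sum_congr rfl fun l _ => by rw [← Algebra.commutes, Algebra.smul_def]⟩
  | mul a b ha hb =>
    obtain ⟨c, α, rfl⟩ := ha
    obtain ⟨d, β, rfl⟩ := hb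
    set b := algebraMap ℂ (Grassmann k) d + ∑ l, gen l * β l with hb
    -- In `(c + ∑ gen l * α l) * b` the factor `b` is expanded only where it is multiplied by the
    -- scalar `c`.
    refine ⟨c * d, fun l => c • β l + α l * b, ?_⟩
    rw [add_mul, ← Algebra.smul_def]
    nth_rewrite 1 [hb]
    simp only [mul_add, Finset.sum_add_distrib, Finset.sum_mul, map_mul, smul_add, Finset.smul_sum,
      mul_smul_comm, mul_assoc, ← Algebra.smul_def, add_assoc]
  | add a b ha hb =>
    obtain ⟨c, α, rfl⟩ := ha
    obtain ⟨d, β, rfl⟩ := hb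
    refine ⟨c + d, α + β, ?_⟩
    simp only [Pi.add_apply, mul_add, Finset.sum_add_distrib, map_add]
    abel

/-- Substitution of odd elements for the generators. -/
def substOdd {k₀ : ℕ} (η : Fin k → parity k₀ 1) : Grassmann k →ₐ[ℂ] Grassmann k₀ :=
  ExteriorAlgebra.lift ℂ ⟨∑ l, (LinearMap.proj l : (Fin k → ℂ) →ₗ[ℂ] ℂ).smulRight (η l : Grassmann k₀),
    fun v => odd_sq (by
      rw [LinearMap.sum_apply]
      exact Submodule.sum_mem _ fun l _ => Submodule.smul_mem _ _ (η l).2)⟩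

theorem substOdd_ι {k₀ : ℕ} (η : Fin k → parity k₀ 1) (v : Fin k → ℂ) :
    substOdd η (ExteriorAlgebra.ι ℂ v) = ∑ l, v l • (η l : Grassmann k₀) := by
  rw [substOdd, ExteriorAlgebra.lift_ι_apply, LinearMap.sum_apply]
  rfl

theorem substOdd_ι_mem {k₀ : ℕ} (η : Fin k → parity k₀ 1) (v : Fin k → ℂ) :
    substOdd η (ExteriorAlgebra.ι ℂ v) ∈ parity k₀ 1 := by
  rw [substOdd_ι]
  exact Submodule.sum_mem _ fun l _ => Submodule.smul_mem _ _ (η l).2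

theorem substOdd_gen {k₀ : ℕ} (η : Fin k → parity k₀ 1) (l : Fin k) :
    substOdd η (gen l) = η l := by
  rw [gen, substOdd_ι, Finset.sum_eq_single l] <;> simp +contextual

/-- For a fixed `a` the result is a polynomial in the odd values. -/
theorem contDiff_substOdd {k₀ : ℕ} (a : Grassmann k) :
    ContDiff ℂ ∞ fun η : Fin k → parity k₀ 1 => substOdd η a := by
  induction a using ExteriorAlgebra.induction with
  | algebraMap r =>
    simp only [AlgHom.commutes]
    exact contDiff_const
  | ι v =>
    simp only [substOdd_ι]
    refine ContDiff.sum fun l _ => ContDiff.const_smul (v l) ?_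
    exact (parity k₀ 1).subtypeL.contDiff.comp (contDiff_apply ℂ _ l)
  | mul a b ha hb => simp only [map_mul]; exact ha.mul hb
  | add a b ha hb => simp only [map_add]; exact ha.add hb

/-- The algebra endomorphism which multiplies the generators by `ρ`. -/
def scale (k : ℕ) (ρ : ℝ) : Grassmann k →ₐ[ℂ] Grassmann k :=
  ExteriorAlgebra.map ((ρ : ℂ) • LinearMap.id)

theorem scale_ι (ρ : ℝ) (v : Fin k → ℂ) :
    scale k ρ (ExteriorAlgebra.ι ℂ v) = (ρ : ℂ) • ExteriorAlgebra.ι ℂ v := by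
  rw [scale, ExteriorAlgebra.map_apply_ι, LinearMap.smul_apply, map_smul, LinearMap.id_apply]

theorem scale_ι_mem (ρ : ℝ) (v : Fin k → ℂ) : scale k ρ (ExteriorAlgebra.ι ℂ v) ∈ parity k 1 := by
  rw [scale_ι]
  exact Submodule.smul_mem _ _ (CliffordAlgebra.ι_mem_evenOdd_one _ v)

theorem scale_inv_scale {ρ : ℝ} (h : ρ ≠ 0) (a : Grassmann k) : scale k ρ⁻¹ (scale k ρ a) = a := by
  have : (scale k ρ⁻¹).comp (scale k ρ) = AlgHom.id ℂ _ :=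
    ExteriorAlgebra.hom_ext (LinearMap.ext fun v => by
      change scale k ρ⁻¹ (scale k ρ (ExteriorAlgebra.ι ℂ v)) = ExteriorAlgebra.ι ℂ v
      rw [scale_ι, map_smul, scale_ι, smul_smul, Complex.ofReal_inv,
        mul_inv_cancel₀ (Complex.ofReal_ne_zero.2 h), one_smul])
  exact DFunLike.congr_fun this a

theorem continuous_scale (a : Grassmann k) : Continuous fun ρ => scale k ρ a := by
  induction a using ExteriorAlgebra.induction with
  | algebraMap r => simp only [AlgHom.commutes]; exact continuous_const
  | ι v =>
    simp only [scale_ι]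
    fun_prop
  | mul a b ha hb => simp only [map_mul]; exact ha.mul hb
  | add a b ha hb => simp only [map_add]; exact ha.add hb

/-- As `ρ → 0` the scaled elements tend to their constant terms. Together with invertibility for `ρ
≠ 0`, this moves a Grassmann valued point as close to its base point as desired without losing
information. -/
theorem scale_zero (a : Grassmann k) : scale k 0 a = algebraMap ℂ _ (aug k a) := by
  have : scale k 0 = (Algebra.ofId ℂ (Grassmann k)).comp (aug k) :=
    ExteriorAlgebra.hom_ext (LinearMap.ext fun v => by
      change scale k 0 (ExteriorAlgebra.ι ℂ v) = algebraMap ℂ _ (aug k (ExteriorAlgebra.ι ℂ v))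
      rw [scale_ι, aug_odd (CliffordAlgebra.ι_mem_evenOdd_one _ v)]
      simp)
  exact DFunLike.congr_fun this a

end Grassmann

/-! ### Mixed holomorphy of smooth maps -/

section Mix
variable {E F G H : Type*} [NormedAddCommGroup E] [NormedSpace ℝ E] [NormedAddCommGroup F]
  [NormedSpace ℝ F] [NormedAddCommGroup G] [NormedSpace ℝ G] [NormedAddCommGroup H] [NormedSpace ℝ H]

/-- The map `f` is smooth at `x`, and its differential is complex linear on the image of the
partial complex structure `J`. -/
def Mix (J : E →L[ℝ] E) (J' : F →L[ℝ] F) (f : E → F) (x : E) : Prop :=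
  ContDiffAt ℝ ∞ f x ∧ ∀ u, fderiv ℝ f x (J (J u)) = J' (fderiv ℝ f x (J u))

/-- Multiplication by the imaginary unit. -/
def mulI (F : Type*) [NormedAddCommGroup F] [NormedSpace ℂ F]
    [NormedSpace ℝ F] [IsScalarTower ℝ ℂ F] : F →L[ℝ] F :=
  (Complex.I • ContinuousLinearMap.id ℂ F).restrictScalars ℝ

@[simp] theorem mulI_apply {F : Type*} [NormedAddCommGroup F] [NormedSpace ℂ F]
    [NormedSpace ℝ F] [IsScalarTower ℝ ℂ F] (x : F) :
    mulI F x = Complex.I • x := rfl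

/-- The identity `J ^ 3 = -J` is the one property required of a partial complex structure. It holds
for the imaginary unit and for zero, hence for their products, so real and holomorphic directions
are treated alike. -/
theorem mulI_cube {F : Type*} [NormedAddCommGroup F] [NormedSpace ℂ F]
    [NormedSpace ℝ F] [IsScalarTower ℝ ℂ F] (x : F) :
    mulI F (mulI F (mulI F x)) = -mulI F x := by
  simp [smul_smul]

variable {J : E →L[ℝ] E} {J' : F →L[ℝ] F} {J₁ : G →L[ℝ] G} {f : E → F} {x : E}

theorem Mix.differentiableAt (h : Mix J J' f x) : DifferentiableAt ℝ f x :=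
  h.1.differentiableAt (by simp)

theorem Mix.congr {g : E → F} (h : Mix J J' f x) (e : g =ᶠ[𝓝 x] f) : Mix J J' g x := by
  refine ⟨h.1.congr_of_eventuallyEq e, ?_⟩
  rw [e.fderiv_eq]
  exact h.2

/-- The differential of `f` maps the image of `J` into the image of `J'`: since `J = -J ^ 3`, the
vector `f' (J u)` equals `J' (-f' (J (J u)))`. Complex linearity of `g'` on that image then applies.
-/
theorem Mix.comp {g : F → G} (hJ : ∀ u, J (J (J u)) = -J u) (hg : Mix J' J₁ g (f x))
    (h : Mix J J' f x) : Mix J J₁ (fun y => g (f y)) x := by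
  refine ⟨hg.1.comp x h.1, fun u => ?_⟩
  have e : fderiv ℝ (fun y => g (f y)) x = (fderiv ℝ g (f x)).comp (fderiv ℝ f x) :=
    fderiv_comp x hg.differentiableAt h.differentiableAt
  have h1 : fderiv ℝ f x (J u) = J' (-fderiv ℝ f x (J (J u))) := by
    rw [map_neg, ← h.2, hJ]
    simp
  rw [e, ContinuousLinearMap.comp_apply, ContinuousLinearMap.comp_apply, h.2, h1, hg.2]

theorem Mix.of_clm (L : E →L[ℝ] F) (hL : ∀ u, L (J (J u)) = J' (L (J u))) : Mix J J' L x :=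
  ⟨L.contDiff.contDiffAt, fun u => by rw [L.fderiv]; exact hL u⟩

theorem Mix.const (c : F) : Mix J J' (fun _ => c) x := ⟨contDiffAt_const, fun u => by simp⟩

theorem Mix.add {g : E → F} (hf : Mix J J' f x) (hg : Mix J J' g x) :
    Mix J J' (fun y => f y + g y) x := by
  refine ⟨hf.1.add hg.1, fun u => ?_⟩
  rw [fderiv_fun_add hf.differentiableAt hg.differentiableAt]
  simp [hf.2, hg.2]

theorem Mix.sub {g : E → F} (hf : Mix J J' f x) (hg : Mix J J' g x) :
    Mix J J' (fun y => f y - g y) x := by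
  refine ⟨hf.1.sub hg.1, fun u => ?_⟩
  rw [fderiv_fun_sub hf.differentiableAt hg.differentiableAt]
  simp [hf.2, hg.2]

theorem Mix.sum {ι : Type*} {s : Finset ι} {f : ι → E → F} (hf : ∀ i ∈ s, Mix J J' (f i) x) :
    Mix J J' (fun y => ∑ i ∈ s, f i y) x := by
  classical
  induction s using Finset.induction_on with
  | empty => simpa using Mix.const 0
  | insert a s ha ih =>
    simp only [Finset.sum_insert ha]
    exact (hf a (by simp)).add (ih fun i hi => hf i (by simp [hi]))

theorem Mix.prodMk {g : E → G} (hf : Mix J J' f x) (hg : Mix J J₁ g x) :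
    Mix J (J'.prodMap J₁) (fun y => (f y, g y)) x := by
  refine ⟨hf.1.prodMk hg.1, fun u => ?_⟩
  rw [hf.differentiableAt.fderiv_prodMk hg.differentiableAt]
  simp [hf.2, hg.2]

/-- Mixed holomorphy on a neighbourhood of a point. -/
def MixNear (J : E →L[ℝ] E) (J' : F →L[ℝ] F) (f : E → F) (x : E) : Prop :=
  ∀ᶠ y in 𝓝 x, Mix J J' f y

theorem MixNear.mix (h : MixNear J J' f x) : Mix J J' f x := Eventually.self_of_nhds h

theorem MixNear.eventually (h : MixNear J J' f x) : ∀ᶠ y in 𝓝 x, MixNear J J' f y :=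
  Eventually.eventually_nhds h

theorem MixNear.congr {g : E → F} (h : MixNear J J' f x) (e : g =ᶠ[𝓝 x] f) : MixNear J J' g x := by
  filter_upwards [h, e.eventuallyEq_nhds] with y h1 h2 using h1.congr h2

/-- The directional derivatives of a mixed holomorphic map are mixed holomorphic. -/
theorem MixNear.fderiv_apply (h : MixNear J J' f x) (b : E) :
    Mix J J' (fun y => fderiv ℝ f y b) x := by
  have hx := h.mix
  have hc : ContDiffAt ℝ ∞ (fderiv ℝ f) x := hx.1.fderiv_right (by simp)
  refine ⟨hc.clm_apply contDiffAt_const, fun u => ?_⟩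
  have hd : DifferentiableAt ℝ (fderiv ℝ f) x := hc.differentiableAt (by simp)
  have hs : IsSymmSndFDerivAt ℝ f x := hx.1.isSymmSndFDerivAt (by rw [minSmoothness_of_isRCLikeNormedField]; exact WithTop.coe_le_coe.2 (le_top : (2 : ℕ∞) ≤ ⊤))
  have e : ∀ v w, fderiv ℝ (fun y => fderiv ℝ f y v) x w = fderiv ℝ (fderiv ℝ f) x w v :=
    fun v w => by
      rw [(hd.hasFDerivAt.clm_apply (hasFDerivAt_const v x)).fderiv]
      simp
  -- Complex linearity is known for first derivatives at all nearby points. Symmetry of the second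
  -- derivative moves the direction `J (J u)` to the inner place, where this identity can be
  -- differentiated.
  have h2 : (fun y => fderiv ℝ f y (J (J u))) =ᶠ[𝓝 x] fun y => J' (fderiv ℝ f y (J u)) := by
    filter_upwards [h] with y hy using hy.2 u
  rw [e, hs.eq, ← e, h2.fderiv_eq, e, hs.eq, ← e (J u) b]
  have hd' : DifferentiableAt ℝ (fun y => fderiv ℝ f y (J u)) x :=
    (hc.clm_apply contDiffAt_const).differentiableAt (by simp)
  have e3 : fderiv ℝ (fun y => J' (fderiv ℝ f y (J u))) x =
      J'.comp (fderiv ℝ (fun y => fderiv ℝ f y (J u)) x) :=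
    (J'.hasFDerivAt.comp x hd'.hasFDerivAt).fderiv
  rw [e3]
  rfl

theorem MixNear.fderiv_near (h : MixNear J J' f x) (b : E) :
    MixNear J J' (fun y => fderiv ℝ f y b) x := by
  filter_upwards [h.eventually] with y hy using hy.fderiv_apply b

theorem Mix.of_contDiffAt_complex {E F : Type*} [NormedAddCommGroup E] [NormedSpace ℂ E] [NormedSpace ℝ E] [IsScalarTower ℝ ℂ E]
    [NormedAddCommGroup F] [NormedSpace ℂ F]
    [NormedSpace ℝ F] [IsScalarTower ℝ ℂ F] {f : E → F} {x : E} (h : ContDiffAt ℂ ∞ f x) :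
    Mix (mulI E) (mulI F) f x := by
  refine ⟨h.restrict_scalars ℝ, fun u => ?_⟩
  rw [((h.differentiableAt (by simp)).hasFDerivAt.restrictScalars ℝ).fderiv]
  simp

theorem Mix.mul {A : Type*} [NormedRing A] [NormedAlgebra ℂ A] {f g : E → A}
    (hf : Mix J (mulI A) f x) (hg : Mix J (mulI A) g x) : Mix J (mulI A) (fun y => f y * g y) x := by
  refine ⟨hf.1.mul hg.1, fun u => ?_⟩
  rw [fderiv_fun_mul' hf.differentiableAt hg.differentiableAt]
  simp [hf.2, hg.2, smul_add]

theorem Mix.clm_comp_complex {F G : Type*} [NormedAddCommGroup F] [NormedSpace ℂ F]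
    [NormedSpace ℝ F] [IsScalarTower ℝ ℂ F]
    [NormedAddCommGroup G] [NormedSpace ℂ G] [NormedSpace ℝ G] [IsScalarTower ℝ ℂ G] (L : F →L[ℂ] G) {f : E → F} (hf : Mix J (mulI F) f x) :
    Mix J (mulI G) (fun y => L (f y)) x := by
  have e : fderiv ℝ (fun y => L (f y)) x = (L.restrictScalars ℝ).comp (fderiv ℝ f x) :=
    ((L.restrictScalars ℝ).hasFDerivAt.comp x hf.differentiableAt.hasFDerivAt).fderiv
  refine ⟨(L.restrictScalars ℝ).contDiff.contDiffAt.comp x hf.1, fun u => ?_⟩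
  rw [e, ContinuousLinearMap.comp_apply, hf.2]
  simp

theorem Mix.const_smul {F : Type*} [NormedAddCommGroup F] [NormedSpace ℂ F]
    [NormedSpace ℝ F] [IsScalarTower ℝ ℂ F] (c : ℂ) {f : E → F}
    (hf : Mix J (mulI F) f x) : Mix J (mulI F) (fun y => c • f y) x :=
  Mix.clm_comp_complex (c • ContinuousLinearMap.id ℂ F) hf

theorem Mix.pi {ι : Type*} [Fintype ι] {F : ι → Type*} [∀ i, NormedAddCommGroup (F i)]
    [∀ i, NormedSpace ℂ (F i)] [∀ i, NormedSpace ℝ (F i)] [∀ i, IsScalarTower ℝ ℂ (F i)] {f : E → ∀ i, F i} (hf : ∀ i, Mix J (mulI (F i)) (fun y => f y i) x) :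
    Mix J (mulI (∀ i, F i)) f x := by
  refine ⟨contDiffAt_pi.2 fun i => (hf i).1, fun u => ?_⟩
  rw [(hasFDerivAt_pi.2 fun i => (hf i).differentiableAt.hasFDerivAt).fderiv]
  funext i
  exact (hf i).2 u

/-- Mixed holomorphy of a map into a finite dimensional space, in terms of its coefficients. -/
theorem mix_of_dual {F : Type*} [NormedAddCommGroup F] [NormedSpace ℂ F]
    [NormedSpace ℝ F] [IsScalarTower ℝ ℂ F] [FiniteDimensional ℂ F]
    {f : E → F} (h : ∀ l : Module.Dual ℂ F, Mix J (mulI ℂ) (fun y => l (f y)) x) :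
    Mix J (mulI F) f x := by
  let b := Module.finBasis ℂ F
  have h1 : Mix J (mulI (Fin (Module.finrank ℂ F) → ℂ)) (fun y => b.equivFun (f y)) x :=
    Mix.pi fun i => h (b.coord i)
  refine (Mix.clm_comp_complex (LinearMap.toContinuousLinearMap b.equivFun.symm.toLinearMap) h1).congr
    (Eventually.of_forall fun y => ?_)
  simp

theorem Mix.dual {F : Type*} [NormedAddCommGroup F] [NormedSpace ℂ F]
    [NormedSpace ℝ F] [IsScalarTower ℝ ℂ F] [FiniteDimensional ℂ F]
    {f : E → F} (h : Mix J (mulI F) f x) (l : Module.Dual ℂ F) :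
    Mix J (mulI ℂ) (fun y => l (f y)) x :=
  Mix.clm_comp_complex (LinearMap.toContinuousLinearMap l) h

end Mix

/-! ### Exponentials of nilpotent constant vector fields -/

/-- Difference quotients stay in `N`, which is closed because the dimension is finite. Where `f` is
not differentiable, `fderiv` is zero by convention, so no smoothness is assumed. -/
theorem fderiv_mem_of_eventually_mem {E F : Type*} [NormedAddCommGroup E] [NormedSpace ℝ E]
    [NormedAddCommGroup F] [NormedSpace ℂ F] [FiniteDimensional ℂ F] {f : E → F} {x : E}
    (N : Submodule ℂ F) (h : ∀ᶠ y in 𝓝 x, f y ∈ N) (v : E) : fderiv ℝ f x v ∈ N := by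
  by_cases hd : DifferentiableAt ℝ f x
  · have h1 : HasDerivAt (fun t : ℝ => f (x + t • v)) (fderiv ℝ f x v) 0 := by
      have h2 : HasDerivAt (fun t : ℝ => x + t • v) v 0 := by
        simpa using ((hasDerivAt_id (0 : ℝ)).smul_const v).const_add x
      have h3 : HasFDerivAt f (fderiv ℝ f x) (x + (0 : ℝ) • v) := by simpa using hd.hasFDerivAt
      exact h3.comp_hasDerivAt 0 h2
    rw [hasDerivAt_iff_tendsto_slope_zero] at h1
    have hcont : Tendsto (fun t : ℝ => x + t • v) (𝓝[≠] 0) (𝓝 x) := by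
      have : Continuous fun t : ℝ => x + t • v := by fun_prop
      simpa using (this.tendsto 0).mono_left nhdsWithin_le_nhds
    refine N.closed_of_finiteDimensional.mem_of_tendsto h1 ?_
    filter_upwards [hcont.eventually h] with t ht
    rw [zero_add, zero_smul, add_zero]
    exact (N.restrictScalars ℝ).smul_mem _ (N.sub_mem ht h.self_of_nhds)
  · rw [fderiv_zero_of_not_differentiableAt hd]
    exact N.zero_mem

section NilD
variable {ι Q Q' : Type*} [Fintype ι] [NormedAddCommGroup Q] [NormedSpace ℝ Q]
  [NormedAddCommGroup Q'] [NormedSpace ℝ Q'] {k : ℕ}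

/-- The differential operator `∑ νⱼ ∂ⱼ` on Grassmann algebra valued functions, where `∂ⱼ` is the
derivative in direction `bⱼ`. -/
def nilD (ν : ι → Q →L[ℝ] Grassmann k) (b : ι → Q) (Φ : Q → Grassmann k) (q : Q) : Grassmann k :=
  ∑ j, ν j q * fderiv ℝ Φ q (b j)

variable {ν : ι → Q →L[ℝ] Grassmann k} {b : ι → Q} {Φ Ψ : Q → Grassmann k} {x : Q} {J : Q →L[ℝ] Q}

theorem nilD_congr (h : Φ =ᶠ[𝓝 x] Ψ) : nilD ν b Φ =ᶠ[𝓝 x] nilD ν b Ψ := by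
  filter_upwards [h.eventuallyEq_nhds] with y hy
  simp only [nilD, hy.fderiv_eq]

theorem nilD_iterate_congr (h : Φ =ᶠ[𝓝 x] Ψ) (r : ℕ) :
    (nilD ν b)^[r] Φ =ᶠ[𝓝 x] (nilD ν b)^[r] Ψ := by
  induction r with
  | zero => exact h
  | succ r ih =>
    rw [Function.iterate_succ_apply', Function.iterate_succ_apply']
    exact nilD_congr ih

theorem MixNear.nilD (hν : ∀ j u, ν j (J (J u)) = Complex.I • ν j (J u))
    (h : MixNear J (mulI _) Φ x) : MixNear J (mulI _) (nilD ν b Φ) x := by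
  filter_upwards [h.eventually] with y hy
  exact Mix.sum fun j _ => (Mix.of_clm (ν j) (hν j)).mul (hy.fderiv_apply (b j))

theorem MixNear.nilD_iterate (hν : ∀ j u, ν j (J (J u)) = Complex.I • ν j (J u))
    (h : MixNear J (mulI _) Φ x) (r : ℕ) :
    MixNear J (mulI _) ((MixedSuper.nilD ν b)^[r] Φ) x := by
  induction r with
  | zero => exact h
  | succ r ih =>
    rw [Function.iterate_succ_apply']
    exact ih.nilD hν

/-- Evenness of the coefficients lets `ν j` move past `Φ`, so that `nilD` is a derivation without
signs. -/
theorem nilD_mul (hev : ∀ j, ν j x ∈ Grassmann.parity k 0) (hΦ : DifferentiableAt ℝ Φ x)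
    (hΨ : DifferentiableAt ℝ Ψ x) :
    nilD ν b (fun y => Φ y * Ψ y) x = nilD ν b Φ x * Ψ x + Φ x * nilD ν b Ψ x := by
  simp only [nilD, Finset.sum_mul, Finset.mul_sum, ← Finset.sum_add_distrib]
  refine Finset.sum_congr rfl fun j _ => ?_
  have e : ν j x * (Φ x * fderiv ℝ Ψ x (b j)) = Φ x * (ν j x * fderiv ℝ Ψ x (b j)) := by
    rw [← mul_assoc, Grassmann.even_comm _ _ (hev j), mul_assoc]
  rw [fderiv_fun_mul' hΦ hΨ]
  simp [mul_add, e, mul_assoc, add_comm]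

theorem nilD_sum_fun {κ : Type*} (s : Finset κ) {Φ : κ → Q → Grassmann k}
    (h : ∀ i ∈ s, DifferentiableAt ℝ (Φ i) x) :
    nilD ν b (fun y => ∑ i ∈ s, Φ i y) x = ∑ i ∈ s, nilD ν b (Φ i) x := by
  simp only [nilD]
  rw [Finset.sum_comm]
  refine Finset.sum_congr rfl fun j _ => ?_
  rw [fderiv_fun_sum h, sum_apply, Finset.mul_sum]

theorem nilD_const_smul (c : ℂ) (h : DifferentiableAt ℝ Φ x) :
    nilD ν b (fun y => c • Φ y) x = c • nilD ν b Φ x := by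
  simp only [nilD, Finset.smul_sum]
  refine Finset.sum_congr rfl fun j _ => ?_
  rw [fderiv_fun_const_smul h, smul_apply, mul_smul_comm]

/-- The terms of the exponential series of `nilD`. -/
def nilDTerm (ν : ι → Q →L[ℝ] Grassmann k) (b : ι → Q) (r : ℕ) (Φ : Q → Grassmann k) (q : Q) :
    Grassmann k := ((r.factorial : ℂ)⁻¹) • (nilD ν b)^[r] Φ q

theorem nilDTerm_zero : nilDTerm ν b 0 Φ = Φ := by
  funext q
  simp [nilDTerm]

theorem nilDTerm_congr (h : Φ =ᶠ[𝓝 x] Ψ) (r : ℕ) : nilDTerm ν b r Φ =ᶠ[𝓝 x] nilDTerm ν b r Ψ := by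
  filter_upwards [nilD_iterate_congr (ν := ν) (b := b) h r] with y hy
  rw [nilDTerm, hy, nilDTerm]

theorem MixNear.nilDTerm (hν : ∀ j u, ν j (J (J u)) = Complex.I • ν j (J u))
    (h : MixNear J (mulI _) Φ x) (r : ℕ) : MixNear J (mulI _) (nilDTerm ν b r Φ) x := by
  filter_upwards [h.nilD_iterate (b := b) hν r] with y hy
  exact hy.const_smul _

theorem nilD_nilDTerm (hν : ∀ j u, ν j (J (J u)) = Complex.I • ν j (J u))
    (h : MixNear J (mulI _) Φ x) (r : ℕ) :
    nilD ν b (nilDTerm ν b r Φ) x = ((r : ℂ) + 1) • nilDTerm ν b (r + 1) Φ x := by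
  have h1 := (h.nilD_iterate (b := b) hν r).mix.differentiableAt
  change nilD ν b (fun y => _ • _) x = _
  rw [nilD_const_smul _ h1, nilDTerm, Function.iterate_succ_apply', smul_smul, Nat.factorial_succ]
  congr 1
  have : (r.factorial : ℂ) ≠ 0 := Nat.cast_ne_zero.2 r.factorial_ne_zero
  have : ((r : ℂ) + 1) ≠ 0 := by exact_mod_cast Nat.succ_ne_zero r
  push_cast
  field_simp

/-- The Leibniz rule for divided powers. In the induction both sides are multiplied by `r + 1`, and
on the right this factor splits as `p.1 + p.2`. The identity is kept on a neighbourhood so that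
`nilD` can be applied to it again. -/
theorem nilDTerm_mul (hν : ∀ j u, ν j (J (J u)) = Complex.I • ν j (J u))
    (hev : ∀ j y, ν j y ∈ Grassmann.parity k 0)
    (hΦ : MixNear J (mulI _) Φ x) (hΨ : MixNear J (mulI _) Ψ x) (r : ℕ) :
    nilDTerm ν b r (fun y => Φ y * Ψ y) =ᶠ[𝓝 x] fun y =>
      ∑ p ∈ Finset.HasAntidiagonal.antidiagonal r, nilDTerm ν b p.1 Φ y * nilDTerm ν b p.2 Ψ y := by
  induction r with
  | zero => simp [nilDTerm_zero]
  | succ r ih =>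
    have hm : MixNear J (mulI _) (fun y => Φ y * Ψ y) x := by
      filter_upwards [hΦ, hΨ] with y h1 h2 using h1.mul h2
    filter_upwards [ih.eventuallyEq_nhds, hΦ.eventually, hΨ.eventually, hm.eventually]
      with y e h1 h2 h3
    have hr : ((r : ℂ) + 1) ≠ 0 := by exact_mod_cast Nat.succ_ne_zero r
    refine smul_right_injective (Grassmann k) hr ?_
    change ((r : ℂ) + 1) • nilDTerm ν b (r + 1) _ y = ((r : ℂ) + 1) • ∑ p ∈ _, _
    rw [← nilD_nilDTerm hν h3, (nilD_congr e).self_of_nhds, nilD_sum_fun]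
    · have e1 : ∀ p ∈ Finset.HasAntidiagonal.antidiagonal r,
          nilD ν b (fun z => nilDTerm ν b p.1 Φ z * nilDTerm ν b p.2 Ψ z) y =
          ((p.1 : ℂ) + 1) • (nilDTerm ν b (p.1 + 1) Φ y * nilDTerm ν b p.2 Ψ y) +
          ((p.2 : ℂ) + 1) • (nilDTerm ν b p.1 Φ y * nilDTerm ν b (p.2 + 1) Ψ y) := fun p _ => by
        rw [nilD_mul (fun j => hev j y) (h1.nilDTerm hν _).mix.differentiableAt
          (h2.nilDTerm hν _).mix.differentiableAt, nilD_nilDTerm hν h1, nilD_nilDTerm hν h2,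
          smul_mul_assoc, mul_smul_comm]
      rw [Finset.sum_congr rfl e1, Finset.sum_add_distrib]
      have e2 : ∀ p ∈ Finset.HasAntidiagonal.antidiagonal (r + 1),
          ((r : ℂ) + 1) • (nilDTerm ν b p.1 Φ y * nilDTerm ν b p.2 Ψ y) =
          (p.1 : ℂ) • (nilDTerm ν b p.1 Φ y * nilDTerm ν b p.2 Ψ y) +
          (p.2 : ℂ) • (nilDTerm ν b p.1 Φ y * nilDTerm ν b p.2 Ψ y) := fun p hp => by
        rw [← add_smul]
        congr 1
        exact_mod_cast (Finset.HasAntidiagonal.mem_antidiagonal.1 hp).symm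
      rw [Finset.smul_sum, Finset.sum_congr rfl e2, Finset.sum_add_distrib,
        Finset.Nat.sum_antidiagonal_succ, add_comm (Finset.sum _ _) (Finset.sum _ _),
        Finset.Nat.sum_antidiagonal_succ' (f := fun p : ℕ × ℕ =>
          (p.2 : ℂ) • (nilDTerm ν b p.1 Φ y * nilDTerm ν b p.2 Ψ y))]
      simp [add_comm]
    · exact fun p _ => ((h1.nilDTerm hν _).mix.mul (h2.nilDTerm hν _).mix).differentiableAt

theorem nilD_iterate_mem (N : Submodule ℂ (Grassmann k)) (hN : ∀ j y, ∀ a ∈ N, ν j y * a ∈ N)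
    (h : ∀ᶠ y in 𝓝 x, Φ y ∈ N) (r : ℕ) : ∀ᶠ y in 𝓝 x, (nilD ν b)^[r] Φ y ∈ N := by
  induction r with
  | zero => exact h
  | succ r ih =>
    rw [Function.iterate_succ_apply']
    filter_upwards [ih.eventually_nhds] with y hy
    exact N.sum_mem fun j _ => hN j y _ (fderiv_mem_of_eventually_mem N hy (b j))

/-- Each application multiplies by one nilpotent coefficient, and differentiation does not leave a
linear subspace. -/
theorem nilD_iterate_mem_nilFilt (hnil : ∀ j y, ν j y ∈ Grassmann.nilIdeal k) (r : ℕ) (y : Q) :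
    (nilD ν b)^[r] Φ y ∈ Grassmann.nilFilt k r := by
  induction r generalizing y with
  | zero => exact Grassmann.mem_nilFilt_zero _
  | succ r ih =>
    rw [Function.iterate_succ_apply']
    exact Submodule.sum_mem _ fun j _ => Grassmann.mul_mem_nilFilt_succ (hnil j y)
      (fderiv_mem_of_eventually_mem _ (Eventually.of_forall ih) (b j))

theorem nilDTerm_mem_nilFilt (hnil : ∀ j y, ν j y ∈ Grassmann.nilIdeal k) (r : ℕ) (y : Q) :
    nilDTerm ν b r Φ y ∈ Grassmann.nilFilt k r :=
  Submodule.smul_mem _ _ (nilD_iterate_mem_nilFilt hnil r y)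

/-- The exponential of the nilpotent differential operator `nilD`. -/
def nilExp (ν : ι → Q →L[ℝ] Grassmann k) (b : ι → Q) (Φ : Q → Grassmann k) (q : Q) : Grassmann k :=
  ∑ r ∈ Finset.range (Grassmann.nilDegree k), nilDTerm ν b r Φ q

theorem nilExp_congr (h : Φ =ᶠ[𝓝 x] Ψ) : nilExp ν b Φ =ᶠ[𝓝 x] nilExp ν b Ψ := by
  have h1 : ∀ r ∈ Finset.range (Grassmann.nilDegree k),
      ∀ᶠ y in 𝓝 x, nilDTerm ν b r Φ y = nilDTerm ν b r Ψ y := fun r _ => nilDTerm_congr h r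
  filter_upwards [(Finset.range (Grassmann.nilDegree k)).eventually_all.2 h1] with y hy
  exact Finset.sum_congr rfl hy

theorem MixNear.nilExp (hν : ∀ j u, ν j (J (J u)) = Complex.I • ν j (J u))
    (h : MixNear J (mulI _) Φ x) : MixNear J (mulI _) (nilExp ν b Φ) x := by
  filter_upwards [h.eventually] with y hy
  exact Mix.sum fun r _ => (hy.nilDTerm hν r).mix

/-- The left side runs over the triangle `i + j < K`, the right side over the square, and the
remaining terms of the square vanish. -/
theorem sum_range_mul_sum_range_of_vanish {R : Type*} [Ring R] (K : ℕ) (X Y : ℕ → R)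
    (h : ∀ i j, K ≤ i + j → X i * Y j = 0) :
    ∑ r ∈ Finset.range K, ∑ p ∈ Finset.HasAntidiagonal.antidiagonal r, X p.1 * Y p.2 =
      (∑ i ∈ Finset.range K, X i) * ∑ j ∈ Finset.range K, Y j := by
  rw [Finset.sum_mul_sum, ← Finset.sum_product', Finset.sum_sigma']
  refine Finset.sum_bij_ne_zero (fun p _ _ => p.2) ?_ ?_ ?_ ?_
  · rintro ⟨r, i, j⟩ hp _
    simp only [Finset.mem_sigma, Finset.mem_range, Finset.HasAntidiagonal.mem_antidiagonal, Finset.mem_product] at *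
    omega
  · rintro ⟨r, i, j⟩ hp _ ⟨r', i', j'⟩ hp' _ e
    simp only [Finset.mem_sigma, Finset.mem_range, Finset.HasAntidiagonal.mem_antidiagonal, Prod.mk.injEq] at *
    obtain ⟨rfl, rfl⟩ := e
    obtain rfl : r = r' := by omega
    rfl
  · rintro ⟨i, j⟩ _ hne
    have : i + j < K := by
      by_contra hK
      exact hne (h i j (not_lt.1 hK))
    exact ⟨⟨i + j, i, j⟩, by simpa using this, hne, rfl⟩
  · rintro ⟨r, i, j⟩ _ _
    rfl

/-- The exponential of a derivation is multiplicative. Truncation is harmless, since the products of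
terms of total order at least `nilDegree` lie in a vanishing step of the filtration. -/
theorem nilExp_mul (hν : ∀ j u, ν j (J (J u)) = Complex.I • ν j (J u))
    (hev : ∀ j y, ν j y ∈ Grassmann.evenNil k)
    (hΦ : MixNear J (mulI _) Φ x) (hΨ : MixNear J (mulI _) Ψ x) :
    nilExp ν b (fun y => Φ y * Ψ y) x = nilExp ν b Φ x * nilExp ν b Ψ x := by
  simp only [nilExp]
  rw [← sum_range_mul_sum_range_of_vanish]
  · exact Finset.sum_congr rfl fun r _ =>
      (nilDTerm_mul hν (fun j y => (hev j y).1) hΦ hΨ r).self_of_nhds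
  · intro i j hij
    have := Grassmann.mul_mem_nilFilt (nilDTerm_mem_nilFilt (b := b) (Φ := Φ)
      (fun j y => (hev j y).2) i x) (nilDTerm_mem_nilFilt (b := b) (Φ := Ψ)
      (fun j y => (hev j y).2) j x)
    rwa [Grassmann.nilFilt_eq_bot hij, Submodule.mem_bot] at this

theorem nilD_add (hΦ : DifferentiableAt ℝ Φ x) (hΨ : DifferentiableAt ℝ Ψ x) :
    nilD ν b (fun y => Φ y + Ψ y) x = nilD ν b Φ x + nilD ν b Ψ x := by
  simp only [nilD, ← Finset.sum_add_distrib]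
  refine Finset.sum_congr rfl fun j _ => ?_
  rw [fderiv_fun_add hΦ hΨ, add_apply, mul_add]

theorem nilExp_add (hν : ∀ j u, ν j (J (J u)) = Complex.I • ν j (J u))
    (hΦ : MixNear J (mulI _) Φ x) (hΨ : MixNear J (mulI _) Ψ x) :
    nilExp ν b (fun y => Φ y + Ψ y) x = nilExp ν b Φ x + nilExp ν b Ψ x := by
  have key : ∀ r, (nilD ν b)^[r] (fun y => Φ y + Ψ y) =ᶠ[𝓝 x]
      fun y => (nilD ν b)^[r] Φ y + (nilD ν b)^[r] Ψ y := by
    intro r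
    induction r with
    | zero => exact EventuallyEq.rfl
    | succ r ih =>
      simp only [Function.iterate_succ_apply']
      refine (nilD_congr ih).trans ?_
      filter_upwards [hΦ.nilD_iterate (b := b) hν r, hΨ.nilD_iterate (b := b) hν r] with y h1 h2
      exact nilD_add h1.differentiableAt h2.differentiableAt
  simp only [nilExp, ← Finset.sum_add_distrib, nilDTerm]
  refine Finset.sum_congr rfl fun r _ => ?_
  rw [(key r).self_of_nhds, smul_add]

/-- The exponential of `nilD` on a function which `nilD` annihilates. -/
theorem nilExp_of_nilD_eq_zero (h : nilD ν b Φ = 0) : nilExp ν b Φ x = Φ x := by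
  obtain ⟨K, hK⟩ : ∃ K, Grassmann.nilDegree k = K + 1 :=
    ⟨Grassmann.nilDegree k - 1, by have := Grassmann.two_le_nilDegree k; omega⟩
  have h0 : nilD ν b 0 = 0 := by
    funext y
    simp [nilD]
  rw [nilExp, hK, Finset.sum_range_succ', nilDTerm_zero, Finset.sum_eq_zero, zero_add]
  intro r _
  have : (nilD ν b)^[r] 0 = 0 := Function.iterate_fixed h0 r
  rw [nilDTerm, Function.iterate_succ_apply, h, this, Pi.zero_apply, smul_zero]

/-- Meant for linear functions, whose expansion ends with the linear term. The bound
`two_le_nilDegree` ensures that this term is present. -/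
theorem nilExp_of_nilD_nilD_eq_zero (h : nilD ν b (nilD ν b Φ) = 0) :
    nilExp ν b Φ x = Φ x + nilD ν b Φ x := by
  obtain ⟨K, hK⟩ : ∃ K, Grassmann.nilDegree k = K + 2 :=
    ⟨Grassmann.nilDegree k - 2, by have := Grassmann.two_le_nilDegree k; omega⟩
  have h0 : nilD ν b 0 = 0 := by
    funext y
    simp [nilD]
  rw [nilExp, hK, Finset.sum_range_succ', Finset.sum_range_succ', nilDTerm_zero,
    Finset.sum_eq_zero, zero_add, add_comm]
  · simp [nilDTerm]
  · intro r _
    have : (nilD ν b)^[r] 0 = 0 := Function.iterate_fixed h0 r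
    rw [nilDTerm, Function.iterate_succ_apply, Function.iterate_succ_apply, h, this, Pi.zero_apply,
      smul_zero]

theorem nilExp_mem (N : Submodule ℂ (Grassmann k)) (hN : ∀ j y, ∀ a ∈ N, ν j y * a ∈ N)
    (h : ∀ᶠ y in 𝓝 x, Φ y ∈ N) : nilExp ν b Φ x ∈ N :=
  Submodule.sum_mem _ fun r _ => Submodule.smul_mem _ _ (nilD_iterate_mem N hN h r).self_of_nhds

theorem aug_nilExp (hnil : ∀ j y, ν j y ∈ Grassmann.nilIdeal k) :
    Grassmann.aug k (nilExp ν b Φ x) = Grassmann.aug k (Φ x) := by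
  obtain ⟨K, hK⟩ : ∃ K, Grassmann.nilDegree k = K + 1 :=
    ⟨Grassmann.nilDegree k - 1, by have := Grassmann.two_le_nilDegree k; omega⟩
  rw [nilExp, hK, Finset.sum_range_succ', nilDTerm_zero, map_add, map_sum, Finset.sum_eq_zero,
    zero_add]
  intro r _
  rw [nilDTerm, Function.iterate_succ_apply', map_smul, nilD, map_sum, Finset.sum_eq_zero, smul_zero]
  intro j _
  rw [map_mul, Grassmann.mem_nilIdeal.1 (hnil j x), zero_mul]

/-- Compatibility with an affine change of variables. -/
theorem nilExp_comp {ν' : ι → Q' →L[ℝ] Grassmann k} {b' : ι → Q'} {A : Q' → Q} {L : Q' →L[ℝ] Q}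
    {y : Q'} (hA : ∀ z, HasFDerivAt A L z) (hb : ∀ j, L (b' j) = b j) (hνν : ∀ j z, ν j (A z) = ν' j z)
    (hν : ∀ j u, ν j (J (J u)) = Complex.I • ν j (J u)) (h : MixNear J (mulI _) Φ (A y)) :
    nilExp ν' b' (fun z => Φ (A z)) y = nilExp ν b Φ (A y) := by
  have key : ∀ r, (nilD ν' b')^[r] (fun z => Φ (A z)) =ᶠ[𝓝 y] fun z => (nilD ν b)^[r] Φ (A z) := by
    intro r
    induction r with
    | zero => exact EventuallyEq.rfl
    | succ r ih =>
      simp only [Function.iterate_succ_apply']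
      refine (nilD_congr ih).trans ?_
      filter_upwards [(hA y).continuousAt.eventually (h.nilD_iterate (b := b) hν r)] with z hz
      simp only [nilD]
      refine Finset.sum_congr rfl fun j _ => ?_
      have e : fderiv ℝ (fun z => (nilD ν b)^[r] Φ (A z)) z =
          (fderiv ℝ ((nilD ν b)^[r] Φ) (A z)).comp L :=
        (hz.differentiableAt.hasFDerivAt.comp z (hA z)).fderiv
      rw [e, hνν, ContinuousLinearMap.comp_apply, hb]
  refine Finset.sum_congr rfl fun r _ => ?_
  rw [nilDTerm, (key r).self_of_nhds, nilDTerm]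

/-- The exponential of `nilD` commutes with derivatives in directions in which the coefficients are
constant. -/
theorem fderiv_nilExp (hν : ∀ j u, ν j (J (J u)) = Complex.I • ν j (J u)) (v : Q)
    (hv : ∀ j, ν j v = 0) (h : MixNear J (mulI _) Φ x) :
    fderiv ℝ (nilExp ν b Φ) x v = nilExp ν b (fun y => fderiv ℝ Φ y v) x := by
  have step : ∀ {Φ : Q → Grassmann k} {y : Q}, MixNear J (mulI _) Φ y →
      fderiv ℝ (nilD ν b Φ) y v = nilD ν b (fun y => fderiv ℝ Φ y v) y := by
    intro Φ y hy
    have hc : ContDiffAt ℝ ∞ (fderiv ℝ Φ) y := hy.mix.1.fderiv_right (by simp)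
    have hd : DifferentiableAt ℝ (fderiv ℝ Φ) y := hc.differentiableAt (by simp)
    have hs : IsSymmSndFDerivAt ℝ Φ y := hy.mix.1.isSymmSndFDerivAt
      (by rw [minSmoothness_of_isRCLikeNormedField]; exact WithTop.coe_le_coe.2 (le_top : (2 : ℕ∞) ≤ ⊤))
    have e : ∀ v w, fderiv ℝ (fun y => fderiv ℝ Φ y v) y w = fderiv ℝ (fderiv ℝ Φ) y w v :=
      fun v w => by
        rw [(hd.hasFDerivAt.clm_apply (hasFDerivAt_const v y)).fderiv]
        simp
    have hd2 : ∀ v, DifferentiableAt ℝ (fun y => fderiv ℝ Φ y v) y := fun v =>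
      (hy.fderiv_apply v).differentiableAt
    change fderiv ℝ (fun y => ∑ j, ν j y * fderiv ℝ Φ y (b j)) y v = _
    have hd3 : ∀ j ∈ Finset.univ, DifferentiableAt ℝ (fun y => ν j y * fderiv ℝ Φ y (b j)) y :=
      fun j _ => (ν j).differentiableAt.mul (hd2 (b j))
    rw [fderiv_fun_sum hd3, sum_apply]
    refine Finset.sum_congr rfl fun j _ => ?_
    rw [fderiv_fun_mul' (ν j).differentiableAt (hd2 (b j)), e, hs.eq]
    simp [hv j, e]
  have key : ∀ r, (fun y => fderiv ℝ ((nilD ν b)^[r] Φ) y v) =ᶠ[𝓝 x]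
      (nilD ν b)^[r] fun y => fderiv ℝ Φ y v := by
    intro r
    induction r with
    | zero => exact EventuallyEq.rfl
    | succ r ih =>
      simp only [Function.iterate_succ_apply']
      refine EventuallyEq.trans ?_ (nilD_congr ih)
      filter_upwards [(h.nilD_iterate (b := b) hν r).eventually] with y hy using step hy
  change fderiv ℝ (fun y => ∑ r ∈ Finset.range (Grassmann.nilDegree k), nilDTerm ν b r Φ y) x v = _
  rw [fderiv_fun_sum fun r _ => (h.nilDTerm hν r).mix.differentiableAt, sum_apply]
  refine Finset.sum_congr rfl fun r _ => ?_
  change fderiv ℝ (fun y => _ • (nilD ν b)^[r] Φ y) x v = _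
  rw [fderiv_fun_const_smul (h.nilD_iterate hν r).mix.differentiableAt, smul_apply, nilDTerm,
    ← (key r).self_of_nhds]

end NilD

/-! ### Evaluation of Grassmann algebra valued functions at Grassmann valued points -/

section Taylor
variable {E ι : Type} [NormedAddCommGroup E] [NormedSpace ℝ E] [Fintype ι] {k k₀ : ℕ}

/-- The nilpotent part of the coordinates of a Grassmann valued point: nilpotent even corrections to
the even coordinates, and odd values for the odd coordinates. -/
def PhaseFib (ι : Type) (k k₀ : ℕ) : Type :=
  (ι → Grassmann.evenNil k₀) × (Fin k → Grassmann.parity k₀ 1)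

instance : NormedAddCommGroup (PhaseFib ι k k₀) :=
  inferInstanceAs (NormedAddCommGroup ((ι → Grassmann.evenNil k₀) × (Fin k → Grassmann.parity k₀ 1)))

instance : NormedSpace ℂ (PhaseFib ι k k₀) :=
  inferInstanceAs (NormedSpace ℂ ((ι → Grassmann.evenNil k₀) × (Fin k → Grassmann.parity k₀ 1)))

instance : FiniteDimensional ℂ (PhaseFib ι k k₀) :=
  inferInstanceAs (FiniteDimensional ℂ ((ι → Grassmann.evenNil k₀) × (Fin k → Grassmann.parity k₀ 1)))

namespace PhaseFib

/-- The even corrections. -/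
def even (ι : Type) [Fintype ι] (k k₀ : ℕ) : PhaseFib ι k k₀ →L[ℂ] (ι → Grassmann.evenNil k₀) :=
  ContinuousLinearMap.fst ℂ (ι → Grassmann.evenNil k₀) (Fin k → Grassmann.parity k₀ 1)

/-- The odd coordinates. -/
def odd (ι : Type) [Fintype ι] (k k₀ : ℕ) : PhaseFib ι k k₀ →L[ℂ] (Fin k → Grassmann.parity k₀ 1) :=
  ContinuousLinearMap.snd ℂ (ι → Grassmann.evenNil k₀) (Fin k → Grassmann.parity k₀ 1)

@[ext] theorem ext {p q : PhaseFib ι k k₀} (h : even ι k k₀ p = even ι k k₀ q)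
    (h' : odd ι k k₀ p = odd ι k k₀ q) : p = q := Prod.ext h h'

/-- An even correction as an element of the Grassmann algebra. -/
def coeff (k k₀ : ℕ) (j : ι) : PhaseFib ι k k₀ →L[ℂ] Grassmann k₀ :=
  ((Grassmann.evenNil k₀).subtypeL.comp (ContinuousLinearMap.proj (R := ℂ)
    (φ := fun _ : ι => Grassmann.evenNil k₀) j)).comp (even ι k k₀)

theorem coeff_mem (j : ι) (p : PhaseFib ι k k₀) : coeff k k₀ j p ∈ Grassmann.evenNil k₀ :=
  (even ι k k₀ p j).2

end PhaseFib

/-- The space of Grassmann valued points of `E`. -/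
abbrev Phase (E ι : Type) (k k₀ : ℕ) : Type := E × PhaseFib ι k k₀

/-- The partial complex structure on the space of Grassmann valued points. -/
def phaseJ (ι : Type) [Fintype ι] (k k₀ : ℕ) (J : E →L[ℝ] E) :
    Phase E ι k k₀ →L[ℝ] Phase E ι k k₀ :=
  J.prodMap (mulI (PhaseFib ι k k₀))

theorem phaseJ_cube {J : E →L[ℝ] E} (hJ : ∀ u, J (J (J u)) = -J u) (u : Phase E ι k k₀) :
    phaseJ ι k k₀ J (phaseJ ι k k₀ J (phaseJ ι k k₀ J u)) = -phaseJ ι k k₀ J u :=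
  Prod.ext (hJ _) (mulI_cube _)

/-- The even corrections to the coordinates, as linear functions. -/
def phaseCoeff (j : ι) : Phase E ι k k₀ →L[ℝ] Grassmann k₀ :=
  ((PhaseFib.coeff k k₀ j).restrictScalars ℝ).comp (ContinuousLinearMap.snd ℝ _ _)

@[simp] theorem phaseCoeff_apply (j : ι) (y : Phase E ι k k₀) :
    phaseCoeff j y = PhaseFib.coeff k k₀ j y.2 := rfl

theorem phaseCoeff_phaseJ (J : E →L[ℝ] E) (j : ι) (u : Phase E ι k k₀) :
    phaseCoeff j (phaseJ ι k k₀ J (phaseJ ι k k₀ J u)) =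
      Complex.I • phaseCoeff j (phaseJ ι k k₀ J u) :=
  map_smul (PhaseFib.coeff k k₀ j) _ _

/-- The function `h` with the odd coordinates replaced by odd elements of another Grassmann
algebra. -/
def oddSubst (h : E → Grassmann k) (y : Phase E ι k k₀) : Grassmann k₀ :=
  Grassmann.substOdd (PhaseFib.odd ι k k₀ y.2) (h y.1)

/-- The value of the function `h` at a Grassmann valued point, given by its Taylor expansion. -/
def taylor (b : ι → E) (h : E → Grassmann k) : Phase E ι k k₀ → Grassmann k₀ :=
  nilExp phaseCoeff (fun j => (b j, 0)) (oddSubst h)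

variable {b : ι → E} {h h' : E → Grassmann k} {y : Phase E ι k k₀} {J : E →L[ℝ] E}

theorem oddSubst_eventuallyEq (e : h =ᶠ[𝓝 y.1] h') :
    oddSubst h =ᶠ[𝓝 y] (oddSubst h' : Phase E ι k k₀ → _) := by
  filter_upwards [continuous_fst.continuousAt.eventually e] with z hz
  rw [oddSubst, hz, oddSubst]

theorem taylor_congr (e : h =ᶠ[𝓝 y.1] h') : taylor b h =ᶠ[𝓝 y] taylor b h' :=
  nilExp_congr (oddSubst_eventuallyEq e)

/-- In a basis of the Grassmann algebra the function is a finite sum of products of a mixed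
holomorphic coefficient in the base variable and a polynomial in the odd values. -/
theorem MixNear.oddSubst (hJ : ∀ u, J (J (J u)) = -J u) (hh : MixNear J (mulI _) h y.1) :
    MixNear (phaseJ ι k k₀ J) (mulI _) (oddSubst h) y := by
  filter_upwards [continuous_fst.continuousAt.eventually hh] with z hz
  let B := (Pi.basisFun ℂ (Fin k)).ExteriorAlgebra
  have e : (MixedSuper.oddSubst h : Phase E ι k k₀ → _) = fun y => ∑ i,
      algebraMap ℂ (Grassmann k₀) (B.coord i (h y.1)) * Grassmann.substOdd (PhaseFib.odd ι k k₀ y.2) (B i) := by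
    funext y
    rw [MixedSuper.oddSubst]
    conv_lhs => rw [← B.sum_repr (h y.1)]
    rw [map_sum]
    exact Finset.sum_congr rfl fun i _ => by rw [map_smul, Algebra.smul_def]; rfl
  rw [e]
  have h1 : Mix (phaseJ ι k k₀ J) J (fun y : Phase E ι k k₀ => y.1) z :=
    Mix.of_clm (ContinuousLinearMap.fst ℝ E (PhaseFib ι k k₀)) fun u => rfl
  have h2 : Mix (phaseJ ι k k₀ J) (mulI _)
      (fun y : Phase E ι k k₀ => PhaseFib.odd ι k k₀ y.2) z :=
    Mix.clm_comp_complex (PhaseFib.odd ι k k₀)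
      (Mix.of_clm (ContinuousLinearMap.snd ℝ E (PhaseFib ι k k₀)) fun u => rfl)
  refine Mix.sum fun i _ => Mix.mul ?_ ?_
  · exact Mix.clm_comp_complex (Algebra.linearMap ℂ (Grassmann k₀)).toContinuousLinearMap
      ((Mix.comp (phaseJ_cube hJ) hz h1).dual (B.coord i))
  · exact Mix.comp (phaseJ_cube hJ)
      (Mix.of_contDiffAt_complex (Grassmann.contDiff_substOdd (B i)).contDiffAt) h2

theorem MixNear.taylor (hJ : ∀ u, J (J (J u)) = -J u) (hh : MixNear J (mulI _) h y.1) :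
    MixNear (phaseJ ι k k₀ J) (mulI _) (taylor b h) y :=
  (hh.oddSubst hJ).nilExp fun j u => phaseCoeff_phaseJ J j u

/-- Substitution of odd values is an algebra homomorphism, and so is the exponential of an even
nilpotent derivation. -/
theorem taylor_mul (hJ : ∀ u, J (J (J u)) = -J u) (hh : MixNear J (mulI _) h y.1)
    (hh' : MixNear J (mulI _) h' y.1) :
    taylor b (fun q => h q * h' q) y = taylor b h y * taylor b h' y := by
  rw [taylor, taylor, taylor, ← nilExp_mul (fun j u => phaseCoeff_phaseJ J j u) (fun j z => PhaseFib.coeff_mem j z.2)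
    (hh.oddSubst hJ) (hh'.oddSubst hJ)]
  congr 1
  funext z
  exact map_mul _ _ _

theorem taylor_add (hJ : ∀ u, J (J (J u)) = -J u) (hh : MixNear J (mulI _) h y.1)
    (hh' : MixNear J (mulI _) h' y.1) :
    taylor b (fun q => h q + h' q) y = taylor b h y + taylor b h' y := by
  rw [taylor, taylor, taylor, ← nilExp_add (fun j u => phaseCoeff_phaseJ J j u) (hh.oddSubst hJ) (hh'.oddSubst hJ)]
  congr 1
  funext z
  exact map_add _ _ _

theorem taylor_const (a : Grassmann k) : taylor b (fun _ => a) y = Grassmann.substOdd (PhaseFib.odd ι k k₀ y.2) a := by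
  refine nilExp_of_nilD_eq_zero ?_
  funext z
  refine Finset.sum_eq_zero fun j _ => ?_
  have : fderiv ℝ (oddSubst fun _ => a : Phase E ι k k₀ → _) z ((b j, 0) : Phase E ι k k₀) = 0 := by
    have h1 : DifferentiableAt ℝ (oddSubst fun _ => a : Phase E ι k k₀ → _) z :=
      -- Only differentiability is wanted here, so the zero structure serves as partial complex
      -- structure.
      (MixNear.oddSubst (J := 0) (y := z) (by simp) (Eventually.of_forall fun _ =>
        Mix.const a)).mix.differentiableAt
    have h2 : HasFDerivAt (fun t : E => ((t, z.2) : Phase E ι k k₀))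
        (ContinuousLinearMap.inl ℝ E _) z.1 := hasFDerivAt_prodMk_left z.1 z.2
    have h3 := (h1.hasFDerivAt : HasFDerivAt _ _ (z.1, z.2)).comp z.1 h2
    have h4 : HasFDerivAt (fun t : E => Grassmann.substOdd (PhaseFib.odd ι k k₀ z.2) a) (0 : E →L[ℝ] Grassmann k₀) z.1 :=
      hasFDerivAt_const _ _
    exact DFunLike.congr_fun (h3.unique h4) (b j)
  rw [this, mul_zero]

/-- One application of `nilD` to a linear function of the base variable gives a linear function of
the nilpotent corrections alone. The directions `(b j, 0)` do not see it, so the series stops. -/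
theorem taylor_clm (c : E →L[ℝ] ℂ) : taylor b (fun q => algebraMap ℂ (Grassmann k) (c q)) y =
    algebraMap ℂ _ (c y.1) + ∑ j, PhaseFib.coeff k k₀ j y.2 * algebraMap ℂ _ (c (b j)) := by
  let L : Phase E ι k k₀ →L[ℝ] Grassmann k₀ :=
    ((Algebra.linearMap ℂ (Grassmann k₀)).toContinuousLinearMap.restrictScalars ℝ).comp
      (c.comp (ContinuousLinearMap.fst ℝ _ _))
  have e : (oddSubst fun q => algebraMap ℂ (Grassmann k) (c q) : Phase E ι k k₀ → _) = L := by
    funext z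
    exact AlgHom.commutes _ _
  let L' : Phase E ι k k₀ →L[ℝ] Grassmann k₀ :=
    ∑ j, ((ContinuousLinearMap.mul ℝ (Grassmann k₀)).flip (algebraMap ℂ _ (c (b j)))).comp (phaseCoeff j)
  have e' : nilD phaseCoeff (fun j => (b j, 0)) L = L' := by
    funext z
    simp only [nilD, L.fderiv, L', sum_apply]
    rfl
  rw [taylor, e, nilExp_of_nilD_nilD_eq_zero, e']
  · simp only [L', sum_apply]
    rfl
  · rw [e']
    funext z
    refine Finset.sum_eq_zero fun j _ => ?_
    have : L' (b j, 0) = 0 := by simp [L']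
    rw [L'.fderiv, this, mul_zero]

theorem taylor_mem_parity (i : ZMod 2) (hh : ∀ᶠ q in 𝓝 y.1, h q ∈ Grassmann.parity k i) :
    taylor b h y ∈ Grassmann.parity k₀ i := by
  refine nilExp_mem _ (fun j z a ha => ?_) ?_
  · have := Grassmann.mul_mem_parity (PhaseFib.coeff_mem j z.2).1 ha
    rwa [zero_add] at this
  · filter_upwards [continuous_fst.continuousAt.eventually hh] with z hz
    exact Grassmann.map_parity_of_odd _ (Grassmann.substOdd_ι_mem _) i hz

theorem aug_taylor : Grassmann.aug k₀ (taylor b h y) = Grassmann.aug k (h y.1) := by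
  rw [taylor, aug_nilExp fun j z => (PhaseFib.coeff_mem j z.2).2]
  exact Grassmann.aug_algHom _ (Grassmann.substOdd_ι_mem _) _

/-- Evaluation at Grassmann valued points commutes with the derivative in a parameter. -/
theorem hasDerivAt_taylor (hJ : ∀ u, J (J (J u)) = -J u) {g : ℝ × E → Grassmann k} {t : ℝ}
    (hg : MixNear ((0 : ℝ →L[ℝ] ℝ).prodMap J) (mulI _) g (t, y.1)) :
    HasDerivAt (fun s => taylor b (fun q => g (s, q)) y)
      (taylor b (fun q => fderiv ℝ g (t, q) (1, 0)) y) t := by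
  set J₁ : ℝ × E →L[ℝ] ℝ × E := (0 : ℝ →L[ℝ] ℝ).prodMap J with hJ₁
  have hJ1 : ∀ u, J₁ (J₁ (J₁ u)) = -J₁ u := fun u => Prod.ext (by simp [hJ₁]) (hJ _)
  -- Time is treated as an additional base coordinate without nilpotent correction. On each time
  -- slice the expansion over `ℝ × E` then restricts to the one over `E`, by `nilExp_comp` for the
  -- inclusion of the slice.
  let b₁ : ι → ℝ × E := fun j => (0, b j)
  have hA : ∀ (s : ℝ) (z : Phase E ι k k₀), HasFDerivAt
      (fun z : Phase E ι k k₀ => (((s, z.1), z.2) : Phase (ℝ × E) ι k k₀))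
      (((ContinuousLinearMap.inr ℝ ℝ E).comp (ContinuousLinearMap.fst ℝ _ _)).prod
        (ContinuousLinearMap.snd ℝ _ _)) z := fun s z =>
    (((hasFDerivAt_prodMk_right s z.1).comp z hasFDerivAt_fst).prodMk hasFDerivAt_snd)
  have key : ∀ {g : ℝ × E → Grassmann k} {s : ℝ}, MixNear J₁ (mulI _) g (s, y.1) →
      taylor b (fun q => g (s, q)) y = taylor b₁ g ((s, y.1), y.2) := fun {g s} hs =>
    nilExp_comp (hA s) (fun j => rfl) (fun j z => rfl) (fun j u => phaseCoeff_phaseJ J₁ j u)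
      (MixNear.oddSubst (y := ((s, y.1), y.2)) hJ1 hs)
  have hT : MixNear (phaseJ ι k k₀ J₁) (mulI _) (taylor b₁ g) ((t, y.1), y.2) :=
    MixNear.taylor (y := ((t, y.1), y.2)) hJ1 hg
  have hline : HasDerivAt (fun s : ℝ => (((s, y.1), y.2) : Phase (ℝ × E) ι k k₀)) ((1, 0), 0) t :=
    ((hasDerivAt_id t).prodMk (hasDerivAt_const t y.1)).prodMk (hasDerivAt_const t y.2)
  have h1 := hT.mix.differentiableAt.hasFDerivAt.comp_hasDerivAt t hline
  have hev : ∀ᶠ s in 𝓝 t, MixNear J₁ (mulI _) g (s, y.1) :=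
    (continuous_id.prodMk continuous_const).continuousAt.eventually hg.eventually
  have h2 : HasDerivAt (fun s => taylor b (fun q => g (s, q)) y)
      (fderiv ℝ (taylor b₁ g) ((t, y.1), y.2) ((1, 0), 0)) t := by
    refine h1.congr_of_eventuallyEq ?_
    filter_upwards [hev] with s hs using key hs
  have hO : MixNear (phaseJ ι k k₀ J₁) (mulI _) (oddSubst g) ((t, y.1), y.2) :=
    MixNear.oddSubst (y := ((t, y.1), y.2)) hJ1 hg
  -- The coefficients of `nilD` do not depend on time, so the time derivative commutes with the
  -- exponential.
  have h3 : fderiv ℝ (taylor b₁ g) ((t, y.1), y.2) ((1, 0), 0) =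
      taylor b₁ (fun q => fderiv ℝ g q (1, 0)) ((t, y.1), y.2) := by
    rw [taylor, fderiv_nilExp (fun j u => phaseCoeff_phaseJ J₁ j u) _ (fun j => rfl) hO]
    refine (nilExp_congr ?_).self_of_nhds
    filter_upwards [continuous_fst.continuousAt.eventually hg,
      (hO : ∀ᶠ z in _, Mix _ _ (oddSubst g : Phase (ℝ × E) ι k k₀ → _) z)] with z hz hz'
    have h4 : HasFDerivAt (fun q : ℝ × E => ((q, z.2) : Phase (ℝ × E) ι k k₀))
        (ContinuousLinearMap.inl ℝ (ℝ × E) _) z.1 := hasFDerivAt_prodMk_left z.1 z.2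
    have h5 := (hz'.differentiableAt.hasFDerivAt : HasFDerivAt _ _ (z.1, z.2)).comp z.1 h4
    have h6 := ((Grassmann.substOdd (PhaseFib.odd ι k k₀ z.2)).toLinearMap.toContinuousLinearMap.restrictScalars
      ℝ).hasFDerivAt.comp z.1 hz.differentiableAt.hasFDerivAt
    exact DFunLike.congr_fun (h5.unique h6) (1, 0)
  rw [h3, ← key (hg.fderiv_near (1, 0))] at h2
  exact h2

end Taylor

/-! ### Smoothness of composition operators on spaces of continuous paths -/

section Nemytskii
open unitInterval
variable {Y Z : Type} [NormedAddCommGroup Y] [NormedSpace ℝ Y] [NormedAddCommGroup Z] [NormedSpace ℝ Z]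

/-- Pointwise application of a path of continuous linear maps to a path of vectors. -/
def pathApply (Y Z : Type) [NormedAddCommGroup Y] [NormedSpace ℝ Y] [NormedAddCommGroup Z]
    [NormedSpace ℝ Z] : C(I, Y →L[ℝ] Z) →L[ℝ] C(I, Y) →L[ℝ] C(I, Z) :=
  LinearMap.mkContinuous₂
    (LinearMap.mk₂ ℝ (fun (A : C(I, Y →L[ℝ] Z)) (h : C(I, Y)) =>
        (⟨fun s => A s (h s), A.continuous.clm_apply h.continuous⟩ : C(I, Z)))
      (fun _ _ _ => by ext; simp) (fun _ _ _ => by ext; simp)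
      (fun _ _ _ => by ext; simp) (fun _ _ _ => by ext; simp)) 1 fun A h => by
    rw [one_mul]
    refine (ContinuousMap.norm_le _ (mul_nonneg (norm_nonneg A) (norm_nonneg h))).2 fun s => ?_
    exact ((A s).le_opNorm _).trans (mul_le_mul (A.norm_coe_le_norm s) (h.norm_coe_le_norm s)
      (norm_nonneg _) (norm_nonneg _))

@[simp] theorem pathApply_apply (A : C(I, Y →L[ℝ] Z)) (h : C(I, Y)) (s : I) :
    pathApply Y Z A h s = A s (h s) := rfl

theorem contDiff_pathApply (r : ℕ) : ContDiff ℝ r (pathApply Y Z) := by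
  apply ContinuousLinearMap.contDiff

/-- Composition of paths with a continuous map. -/
def pathComp (w : C(Y, Z)) (γ : C(I, Y)) : C(I, Z) := w.comp γ

@[simp] theorem pathComp_apply (w : C(Y, Z)) (γ : C(I, Y)) (s : I) : pathComp w γ s = w (γ s) := rfl

/-- The differential of a smooth map, as a continuous map. -/
def fderivMap {w : Y → Z} (hw : ContDiff ℝ ∞ w) : C(Y, Y →L[ℝ] Z) :=
  ⟨fderiv ℝ w, hw.continuous_fderiv (by simp)⟩

/-- A path has compact range, near which the differential of `w` is uniformly continuous. The mean
value inequality on balls then makes the pointwise remainder small uniformly along the path. -/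
theorem hasFDerivAt_pathComp {w : C(Y, Z)} (hw : ContDiff ℝ ∞ w) (γ : C(I, Y)) :
    HasFDerivAt (pathComp w) (pathApply Y Z (pathComp (fderivMap hw) γ)) γ := by
  rw [hasFDerivAt_iff_isLittleO, Asymptotics.isLittleO_iff]
  intro ε hε
  have hK : IsCompact (Set.range γ) := isCompact_range γ.continuous
  have hu := hK.uniformContinuousAt_of_continuousAt (fderiv ℝ w)
    (fun y _ => (fderivMap hw).continuous.continuousAt) (Metric.dist_mem_uniformity hε)
  obtain ⟨δ, hδ, hd⟩ := Metric.mem_uniformity_dist.1 hu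
  filter_upwards [Metric.ball_mem_nhds γ hδ] with γ' hγ'
  refine (ContinuousMap.norm_le _ (by positivity)).2 fun s => ?_
  have h1 : ∀ z ∈ Metric.ball (γ s) δ, ‖fderiv ℝ w z - fderiv ℝ w (γ s)‖ ≤ ε := fun z hz => by
    have := hd (a := γ s) (b := z) (by rw [dist_comm]; exact hz) ⟨s, rfl⟩
    rw [← dist_eq_norm, dist_comm]; exact this.le
  have h2 : γ' s ∈ Metric.ball (γ s) δ := (ContinuousMap.dist_apply_le_dist s).trans_lt hγ'
  have h3 := (convex_ball (γ s) δ).norm_image_sub_le_of_norm_fderiv_le' (𝕜 := ℝ)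
    (fun z _ => hw.differentiable (by simp) z) h1 (Metric.mem_ball_self hδ) h2
  refine h3.trans ?_
  gcongr
  exact (γ' - γ).norm_coe_le_norm s

/-- The derivative of composition with `w` is composition with `fderiv ℝ w`, up to a bounded
bilinear map. The target changes in this step, so the induction runs over all `Z`. -/
theorem contDiff_pathComp_nat (r : ℕ) : ∀ {Z : Type} [NormedAddCommGroup Z] [NormedSpace ℝ Z]
    {w : C(Y, Z)}, ContDiff ℝ ∞ w → ContDiff ℝ r (pathComp w) := by
  induction r with
  | zero =>
    intro Z _ _ w hw
    exact contDiff_zero.2 w.continuous_postcomp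
  | succ r ih =>
    intro Z _ _ w hw
    refine (contDiff_succ_iff_hasFDerivAt (n := r)).2
      ⟨_, ?_, fun γ => hasFDerivAt_pathComp hw γ⟩
    have h := ih (w := fderivMap hw) (hw.fderiv_right (by simp))
    exact (contDiff_pathApply r).comp h

theorem contDiff_pathComp {w : C(Y, Z)} (hw : ContDiff ℝ ∞ w) : ContDiff ℝ ∞ (pathComp w) :=
  contDiff_infty.2 fun r => contDiff_pathComp_nat r hw

/-- A linear map, acting on paths. -/
def pathMap (L : Y →L[ℝ] Z) : C(I, Y) →L[ℝ] C(I, Z) := L.compLeftContinuous ℝ I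

@[simp] theorem pathMap_apply (L : Y →L[ℝ] Z) (γ : C(I, Y)) (s : I) : pathMap L γ s = L (γ s) := rfl

theorem mix_pathComp {w : C(Y, Z)} (hw : ContDiff ℝ ∞ w) {J : Y →L[ℝ] Y} {J' : Z →L[ℝ] Z}
    {γ : C(I, Y)} (h : ∀ s, Mix J J' w (γ s)) : Mix (pathMap J) (pathMap J') (pathComp w) γ := by
  refine ⟨(contDiff_pathComp hw).contDiffAt, fun u => ?_⟩
  rw [(hasFDerivAt_pathComp hw γ).fderiv]
  ext s
  exact (h s).2 (u s)

/-- Constant paths. -/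
def pathConst (Y : Type) [NormedAddCommGroup Y] [NormedSpace ℝ Y] : Y →L[ℝ] C(I, Y) :=
  LinearMap.mkContinuous
    { toFun := fun y => ContinuousMap.const I y
      map_add' := fun _ _ => rfl
      map_smul' := fun _ _ => rfl } 1 fun y => by
    rw [one_mul]
    exact (ContinuousMap.norm_le _ (norm_nonneg _)).2 fun _ => le_rfl

@[simp] theorem pathConst_apply (y : Y) (s : I) : pathConst Y y s = y := rfl

/-- Evaluation of a path. -/
def pathEval (Y : Type) [NormedAddCommGroup Y] [NormedSpace ℝ Y] (s : I) : C(I, Y) →L[ℝ] Y :=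
  ContinuousMap.evalCLM ℝ s

@[simp] theorem pathEval_apply (γ : C(I, Y)) (s : I) : pathEval Y s γ = γ s := rfl

/-- The integral of a path up to a given time. -/
def pathIntegral (Y : Type) [NormedAddCommGroup Y] [NormedSpace ℝ Y] : C(I, Y) →L[ℝ] C(I, Y) :=
  LinearMap.mkContinuous
    { toFun := fun γ => ⟨fun s => ∫ τ in (0 : ℝ)..s, Set.IccExtend zero_le_one γ τ,
        (intervalIntegral.continuous_primitive
          (fun a b => (γ.continuous.Icc_extend' (h := zero_le_one)).intervalIntegrable a b) 0).comp
          continuous_subtype_val⟩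
      map_add' := fun γ γ' => by
        ext s
        exact intervalIntegral.integral_add
          ((γ.continuous.Icc_extend' (h := zero_le_one)).intervalIntegrable _ _)
          ((γ'.continuous.Icc_extend' (h := zero_le_one)).intervalIntegrable _ _)
      map_smul' := fun c γ => by
        ext s
        exact intervalIntegral.integral_smul c _ } 1 fun γ => by
    rw [one_mul]
    refine (ContinuousMap.norm_le _ (norm_nonneg _)).2 fun s => ?_
    refine (intervalIntegral.norm_integral_le_of_norm_le_const (C := ‖γ‖)
      fun τ _ => γ.norm_coe_le_norm _).trans ?_
    rw [sub_zero, abs_of_nonneg s.2.1]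
    exact mul_le_of_le_one_right (norm_nonneg _) s.2.2

theorem pathIntegral_apply (γ : C(I, Y)) (s : I) :
    pathIntegral Y γ s = ∫ τ in (0 : ℝ)..s, Set.IccExtend zero_le_one γ τ := rfl

theorem pathIntegral_pathMap [CompleteSpace Y] [CompleteSpace Z] (L : Y →L[ℝ] Z) (γ : C(I, Y)) :
    pathIntegral Z (pathMap L γ) = pathMap L (pathIntegral Y γ) := by
  ext s
  exact L.intervalIntegral_comp_comm
    ((γ.continuous.Icc_extend' (h := zero_le_one)).intervalIntegrable _ _)

theorem hasDerivAt_pathIntegral [CompleteSpace Y] (γ : C(I, Y)) {s : ℝ} (hs : s ∈ Set.Ioo (0 : ℝ) 1) :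
    HasDerivAt (fun τ => Set.IccExtend zero_le_one (pathIntegral Y γ) τ) (γ ⟨s, hs.1.le, hs.2.le⟩) s := by
  have hc : Continuous (Set.IccExtend zero_le_one γ) := γ.continuous.Icc_extend'
  have h := intervalIntegral.integral_hasDerivAt_right (hc.intervalIntegrable 0 s)
    (hc.stronglyMeasurableAtFilter _ _) hc.continuousAt
  have e : Set.IccExtend zero_le_one γ s = γ ⟨s, hs.1.le, hs.2.le⟩ :=
    Set.IccExtend_of_mem _ _ ⟨hs.1.le, hs.2.le⟩
  rw [e] at h
  refine h.congr_of_eventuallyEq ?_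
  filter_upwards [isOpen_Ioo.mem_nhds hs] with τ hτ
  rw [Set.IccExtend_of_mem _ _ ⟨hτ.1.le, hτ.2.le⟩]
  rfl

end Nemytskii

/-- A map which is smooth near a point agrees near this point with a globally smooth one. -/
theorem exists_contDiff_eventuallyEq {Y Z : Type} [NormedAddCommGroup Y] [NormedSpace ℝ Y]
    [FiniteDimensional ℝ Y] [NormedAddCommGroup Z] [NormedSpace ℝ Z] {w : Y → Z} {y₀ : Y}
    (hw : ∀ᶠ y in 𝓝 y₀, ContDiffAt ℝ ∞ w y) :
    ∃ w' : C(Y, Z), ContDiff ℝ ∞ w' ∧ w' =ᶠ[𝓝 y₀] w := by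
  obtain ⟨r, hr, hb⟩ := Metric.eventually_nhds_iff_ball.1 hw
  let f : ContDiffBump y₀ := ⟨r / 4, r / 2, by positivity, by linarith⟩
  have hc : ContDiff ℝ ∞ fun y => f y • w y := by
    refine contDiff_iff_contDiffAt.2 fun y => ?_
    by_cases hy : y ∈ Metric.ball y₀ r
    · exact f.contDiffAt.smul (hb y hy)
    · have hs : y ∉ tsupport f := by
        rw [f.tsupport_eq]
        intro h
        exact hy (Metric.closedBall_subset_ball (by change r / 2 < r; linarith) h)
      refine (contDiffAt_const (c := (0 : Z))).congr_of_eventuallyEq ?_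
      filter_upwards [notMem_tsupport_iff_eventuallyEq.1 hs] with z hz
      rw [hz, Pi.zero_apply, zero_smul]
  refine ⟨⟨_, hc.continuous⟩, hc, ?_⟩
  filter_upwards [f.eventuallyEq_one] with y hy
  change f y • w y = w y
  rw [hy, Pi.one_apply, one_smul]

/-! ### Smooth flows of mixed holomorphic vector fields on vector spaces -/

section Flow
open unitInterval
variable {Y : Type} [NormedAddCommGroup Y] [NormedSpace ℝ Y]

theorem eq_zero_of_eq_apply {F : Type*} [NormedAddCommGroup F] [NormedSpace ℝ F] {K : F →L[ℝ] F}
    (hK : ‖K‖ < 1) {x : F} (h : x = K x) : x = 0 := by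
  by_contra hx
  have h1 : 0 < ‖x‖ := norm_pos_iff.2 hx
  have h2 := K.le_opNorm x
  rw [← h] at h2
  nlinarith

/-- A linear equation with a small mixed holomorphic perturbation has a mixed holomorphic solution. -/
theorem mix_of_small_perturbation {F : Type*} [NormedAddCommGroup F] [NormedSpace ℝ F]
    {J : Y →L[ℝ] Y} {J' K : F →L[ℝ] F} (hJ' : ∀ x, J' (J' (J' x)) = -J' x)
    (hK : ‖K‖ < 1) (hK' : ‖K + J'.comp (J'.comp K)‖ < 1)
    (hKJ : ∀ x, K (J' (J' x)) = J' (K (J' x))) {A c : Y →L[ℝ] F} (hc : ∀ u, c (J u) = J' (c u))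
    (hA : ∀ u, A u = c u + K (A u)) (u : Y) : A (J (J u)) = J' (A (J u)) := by
  set x := A (J u) with hx
  -- Shows that `x` lies where `J'` squares to `-1`. The term `J' (c u)` cancels by `J' ^ 3 = -J'`,
  -- so `x + J' (J' x)` is fixed by `K + J' J' K`, an operator of norm less than one.
  have hr : x + J' (J' x) = 0 := by
    refine eq_zero_of_eq_apply hK' ?_
    have h1 : x = J' (c u) + K x := by rw [← hc]; exact hA (J u)
    have h2 : J' (J' (K (J' (J' x)))) = -K (J' (J' x)) := by rw [hKJ, hJ']
    calc x + J' (J' x) = (J' (c u) + K x) + J' (J' (J' (c u) + K x)) := by rw [← h1]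
      _ = K x + J' (J' (K x)) := by rw [map_add, map_add, hJ']; abel
      _ = _ := by
        simp only [add_apply, ContinuousLinearMap.comp_apply, map_add, h2]
        abel
  have hxx : J' (J' x) = -x := eq_neg_of_add_eq_zero_right hr
  have hKx : K (J' x) = J' (K x) := by
    have := hKJ (J' x)
    rw [hxx, map_neg, map_neg, map_neg, map_neg] at this
    exact neg_injective this
  -- Now `K` commutes with `J'` on `x` itself, and the difference of the two sides is a fixed vector
  -- of `K`.
  rw [← sub_eq_zero]
  refine eq_zero_of_eq_apply hK ?_
  rw [map_sub, hKx]
  conv_lhs => rw [hA, hx, hA (J u), ← hx]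
  rw [hc (J u), map_add]
  abel

variable [CompleteSpace Y]

/-- The rescaled integral equation of an autonomous ordinary differential equation. -/
def pathEquation (w : C(Y, Y)) (z : (ℝ × Y) × C(I, Y)) : (ℝ × Y) × C(I, Y) :=
  (z.1, z.2 - pathConst Y z.1.2 - z.1.1 • pathIntegral Y (pathComp w z.2))

theorem contDiff_pathEquation {w : C(Y, Y)} (hw : ContDiff ℝ ∞ w) :
    ContDiff ℝ ∞ (pathEquation w) := by
  have h1 : ContDiff ℝ ∞ fun z : (ℝ × Y) × C(I, Y) => pathConst Y z.1.2 :=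
    (pathConst Y).contDiff.comp (contDiff_snd.comp contDiff_fst)
  have h2 : ContDiff ℝ ∞ fun z : (ℝ × Y) × C(I, Y) => pathIntegral Y (pathComp w z.2) :=
    (pathIntegral Y).contDiff.comp ((contDiff_pathComp hw).comp contDiff_snd)
  exact contDiff_fst.prodMk ((contDiff_snd.sub h1).sub ((contDiff_fst.comp contDiff_fst).smul h2))

/-- The solutions of the rescaled integral equation. -/
theorem exists_path_solution {w : C(Y, Y)} (hw : ContDiff ℝ ∞ w) (y₀ : Y) :
    ∃ (Γ : ℝ × Y → C(I, Y)) (r' : ℝ), 0 < r' ∧ Γ (0, y₀) = pathConst Y y₀ ∧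
      ∀ᶠ p in 𝓝 ((0, y₀) : ℝ × Y), ContDiffAt ℝ ∞ Γ p ∧
        Γ p ∈ Metric.ball (pathConst Y y₀) r' ∧
        Γ p = pathConst Y p.2 + p.1 • pathIntegral Y (pathComp w (Γ p)) ∧
        ∀ γ ∈ Metric.ball (pathConst Y y₀) r',
          γ = pathConst Y p.2 + p.1 • pathIntegral Y (pathComp w γ) → γ = Γ p := by
  set G := pathEquation w
  have hG : ContDiff ℝ ∞ G := contDiff_pathEquation hw
  set a : (ℝ × Y) × C(I, Y) := ((0, y₀), pathConst Y y₀) with ha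
  set B : ℝ × Y →L[ℝ] C(I, Y) := (pathConst Y).comp (ContinuousLinearMap.snd ℝ ℝ Y) +
    (ContinuousLinearMap.fst ℝ ℝ Y).smulRight (pathIntegral Y (pathComp w (pathConst Y y₀)))
  -- The derivative at time zero is triangular: the nonlinear integral is multiplied by the time, so
  -- its dependence on the path drops out, and changing the sign of `B` inverts the map.
  let e : ((ℝ × Y) × C(I, Y)) ≃L[ℝ] ((ℝ × Y) × C(I, Y)) :=
    ContinuousLinearEquiv.equivOfInverse
      ((ContinuousLinearMap.fst ℝ _ _).prod
        (ContinuousLinearMap.snd ℝ _ _ - B.comp (ContinuousLinearMap.fst ℝ _ _)))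
      ((ContinuousLinearMap.fst ℝ _ _).prod
        (ContinuousLinearMap.snd ℝ _ _ + B.comp (ContinuousLinearMap.fst ℝ _ _)))
      (fun z => by simp) (fun z => by simp)
  have he : HasFDerivAt G (e : ((ℝ × Y) × C(I, Y)) →L[ℝ] ((ℝ × Y) × C(I, Y))) a := by
    have h0 : HasFDerivAt (fun z : (ℝ × Y) × C(I, Y) => z.1.1)
      ((ContinuousLinearMap.fst ℝ ℝ Y).comp (ContinuousLinearMap.fst ℝ _ _)) a :=
      hasFDerivAt_fst.fst
    have h1 : HasFDerivAt (fun z : (ℝ × Y) × C(I, Y) => pathConst Y z.1.2)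
      ((pathConst Y).comp ((ContinuousLinearMap.snd ℝ ℝ Y).comp (ContinuousLinearMap.fst ℝ _ _))) a :=
      (pathConst Y).hasFDerivAt.comp a hasFDerivAt_fst.snd
    have h2 : HasFDerivAt (fun z : (ℝ × Y) × C(I, Y) => pathIntegral Y (pathComp w z.2))
      (((pathIntegral Y).comp (pathApply Y Y (pathComp (fderivMap hw) a.2))).comp
        (ContinuousLinearMap.snd ℝ _ _)) a :=
      ((pathIntegral Y).hasFDerivAt.comp _ (hasFDerivAt_pathComp hw a.2)).comp a hasFDerivAt_snd
    have h3 := hasFDerivAt_fst.prodMk ((hasFDerivAt_snd.sub h1).sub (h0.smul h2))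
    refine h3.congr_fderiv ?_
    refine ContinuousLinearMap.ext fun z => Prod.ext rfl ?_
    simp [e, B, a]
    abel
  let g := hG.contDiffAt.toOpenPartialHomeomorph G he (by simp)
  have hga : G a = ((0, y₀), 0) := by simp [G, pathEquation, a]
  have hasrc : a ∈ g.source := hG.contDiffAt.mem_toOpenPartialHomeomorph_source he (by simp)
  have hgc : ∀ z, g z = G z := fun z => rfl
  have hsymm : g.symm ((0, y₀), 0) = a := by rw [← hga, ← hgc, g.left_inv hasrc]
  have htgt : ((0, y₀), 0) ∈ g.target := by rw [← hga, ← hgc]; exact g.map_source hasrc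
  obtain ⟨r', hr', hball⟩ := Metric.mem_nhds_iff.1 (g.open_source.mem_nhds hasrc)
  -- Invertibility of the derivative is an open condition. It is needed near `a`, because the local
  -- inverse must be smooth at all nearby points and not only at one.
  have hinv : ∀ᶠ z in 𝓝 a, ∃ e' : ((ℝ × Y) × C(I, Y)) ≃L[ℝ] ((ℝ × Y) × C(I, Y)),
      (e' : ((ℝ × Y) × C(I, Y)) →L[ℝ] ((ℝ × Y) × C(I, Y))) = fderiv ℝ G z := by
    have h1 : ContinuousAt (fderiv ℝ G) a := (hG.continuous_fderiv (by simp)).continuousAt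
    have h2 := ContinuousLinearEquiv.nhds e
    rw [← he.fderiv] at h2
    exact h1.eventually h2
  have hc0 : Tendsto (fun p : ℝ × Y => ((p, 0) : (ℝ × Y) × C(I, Y))) (𝓝 (0, y₀)) (𝓝 ((0, y₀), 0)) :=
    (Continuous.prodMk continuous_id continuous_const).tendsto _
  have hcs : Tendsto (fun p : ℝ × Y => g.symm (p, 0)) (𝓝 (0, y₀)) (𝓝 a) := by
    have := (g.continuousAt_symm htgt).tendsto.comp hc0
    rwa [hsymm] at this
  refine ⟨fun p => (g.symm (p, 0)).2, r', hr', congrArg Prod.snd hsymm, ?_⟩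
  filter_upwards [hcs.eventually hinv, hc0.eventually (g.open_target.mem_nhds htgt),
    hcs.eventually (Metric.ball_mem_nhds a hr'), Metric.ball_mem_nhds ((0, y₀) : ℝ × Y) hr'] with p h1 h2 h3 h4
  obtain ⟨e', he'⟩ := h1
  have hGp : G (g.symm (p, 0)) = (p, 0) := g.right_inv h2
  have hp1 : (g.symm (p, 0)).1 = p := congrArg Prod.fst hGp
  refine ⟨?_, ?_, ?_, ?_⟩
  · have h5 : HasFDerivAt g (e' : ((ℝ × Y) × C(I, Y)) →L[ℝ] ((ℝ × Y) × C(I, Y))) (g.symm (p, 0)) := by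
      rw [he']; exact (hG.differentiable (by simp) _).hasFDerivAt
    have h6 : ContDiffAt ℝ ∞ g.symm (p, 0) := g.contDiffAt_symm h2 h5 hG.contDiffAt
    have h7 : ContDiffAt ℝ ∞ (fun p : ℝ × Y => g.symm (p, 0)) p :=
      ContDiffAt.comp p h6 (contDiffAt_id.prodMk contDiffAt_const)
    exact h7.snd
  · rw [Prod.dist_eq, max_lt_iff] at h3
    exact h3.2
  · have h5 := congrArg Prod.snd hGp
    change _ - pathConst Y (g.symm (p, 0)).1.2 - (g.symm (p, 0)).1.1 • _ = 0 at h5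
    rw [hp1, sub_sub, sub_eq_zero] at h5
    exact h5
  -- Uniqueness in the ball is the injectivity of the local homeomorphism on its source.
  · intro γ hγ h5
    have h6 : (p, γ) ∈ g.source := hball (by
      rw [Metric.mem_ball, Prod.dist_eq, max_lt_iff]; exact ⟨h4, hγ⟩)
    have h7 : g (p, γ) = (p, 0) := by
      change (p, γ - pathConst Y p.2 - p.1 • pathIntegral Y (pathComp w γ)) = _
      rw [sub_sub, ← h5, sub_self]
    rw [← h7, g.left_inv h6]

/-- The substitution `τ ↦ s * τ` in the integral; it turns an initial piece of a solution into a
solution for a shorter time. -/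
theorem pathIntegral_scale (γ : C(I, Y)) {s : ℝ} (hs : s ∈ I) (a : I) :
    s • pathIntegral Y (γ.comp ⟨fun τ => ⟨s * τ, unitInterval.mul_mem hs τ.2⟩, by fun_prop⟩) a =
      pathIntegral Y γ ⟨s * a, unitInterval.mul_mem hs a.2⟩ := by
  rw [pathIntegral_apply, pathIntegral_apply]
  have h := intervalIntegral.smul_integral_comp_mul_left (a := 0) (b := a)
    (Set.IccExtend zero_le_one γ) s
  rw [mul_zero] at h
  rw [← h]
  congr 1
  refine intervalIntegral.integral_congr fun τ hτ => ?_
  rw [Set.uIcc_of_le a.2.1] at hτ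
  have hτ1 : τ ∈ I := ⟨hτ.1, hτ.2.trans a.2.2⟩
  rw [Set.IccExtend_of_mem _ _ hτ1, Set.IccExtend_of_mem _ _ (unitInterval.mul_mem hs hτ1)]
  rfl

/-- The local flow of a mixed holomorphic vector field is mixed holomorphic. -/
theorem exists_flow [FiniteDimensional ℝ Y] {w : Y → Y} {J : Y →L[ℝ] Y} {y₀ : Y}
    (hJ : ∀ u, J (J (J u)) = -J u) (hw : MixNear J J w y₀) {U : Set Y} (hU : U ∈ 𝓝 y₀) :
    ∃ (φ : ℝ × Y → Y) (r : ℝ), 0 < r ∧ ∀ t y, |t| < r → dist y y₀ < r →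
      Mix ((0 : ℝ →L[ℝ] ℝ).prodMap J) J φ (t, y) ∧ φ (t, y) ∈ U ∧
        HasDerivAt (fun s => φ (s, y)) (w (φ (t, y))) t ∧ φ (0, y) = y := by
  obtain ⟨w', hw', hww⟩ := exists_contDiff_eventuallyEq (hw.mono fun _ h => h.1)
  obtain ⟨Γ, r', hr', hΓ0, hΓ⟩ := exists_path_solution hw' y₀
  have hΓc : ContinuousAt Γ (0, y₀) := hΓ.self_of_nhds.1.continuousAt
  have hgood : ∀ᶠ y in 𝓝 y₀, Mix J J w' y ∧ w' y = w y ∧ y ∈ U := by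
    filter_upwards [hw, hww.eventuallyEq_nhds, hU] with y h1 h2 h3
    exact ⟨h1.congr h2, h2.self_of_nhds, h3⟩
  obtain ⟨ρ, hρ, hρgood⟩ := Metric.eventually_nhds_iff_ball.1 hgood
  -- The linearization, in the path variable, of the right side of the integral equation. It carries
  -- the time as a factor, hence vanishes at time zero and is small nearby, as
  -- `mix_of_small_perturbation` requires.
  let K : ℝ × Y → C(I, Y) →L[ℝ] C(I, Y) := fun p =>
    p.1 • (pathIntegral Y).comp (pathApply Y Y (pathComp (fderivMap hw') (Γ p)))
  have hKc : ContinuousAt K (0, y₀) := by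
    refine continuousAt_fst.smul ?_
    refine (continuousAt_const (y := pathIntegral Y)).clm_comp ?_
    refine (pathApply Y Y).continuous.continuousAt.comp ?_
    exact (ContinuousMap.continuous_postcomp (fderivMap hw')).continuousAt.comp hΓc
  have hK0 : K (0, y₀) = 0 := by
    ext x s
    exact zero_smul ℝ (pathIntegral Y _ s)
  have hK1 : ∀ᶠ p in 𝓝 ((0, y₀) : ℝ × Y), ‖K p‖ < 1 := by
    refine (ContinuousAt.norm (E := C(I, Y) →L[ℝ] C(I, Y)) hKc).eventually_lt continuousAt_const ?_
    rw [hK0]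
    exact (norm_zero (E := C(I, Y) →L[ℝ] C(I, Y))).trans_lt one_pos
  have hK2 : ∀ᶠ p in 𝓝 ((0, y₀) : ℝ × Y),
      ‖K p + (pathMap J).comp ((pathMap J).comp (K p))‖ < 1 := by
    refine (ContinuousAt.norm (E := C(I, Y) →L[ℝ] C(I, Y)) (hKc.add (continuousAt_const.clm_comp
      (continuousAt_const.clm_comp hKc)))).eventually_lt continuousAt_const ?_
    have h0 : K (0, y₀) + (pathMap J).comp ((pathMap J).comp (K (0, y₀))) = 0 := by
      ext x s
      have h1 : K (0, y₀) x s = 0 := by rw [hK0]; rfl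
      change K (0, y₀) x s + J (J (K (0, y₀) x s)) = 0
      rw [h1, map_zero, map_zero, add_zero]
    exact ((congrArg norm h0).trans (norm_zero (E := C(I, Y) →L[ℝ] C(I, Y)))).trans_lt one_pos
  have hΓρ : ∀ᶠ p in 𝓝 ((0, y₀) : ℝ × Y), Γ p ∈ Metric.ball (pathConst Y y₀) ρ := by
    have := hΓc.eventually (Metric.ball_mem_nhds _ hρ)
    rwa [hΓ0] at this
  obtain ⟨r, hr, hall⟩ := Metric.eventually_nhds_iff_ball.1
    (hΓ.eventually_nhds.and (hΓρ.and (hK1.and hK2)))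
  have hmem : ∀ {t : ℝ} {y : Y}, |t| < r → dist y y₀ < r → (t, y) ∈ Metric.ball ((0, y₀) : ℝ × Y) r := by
    intro t y ht hy
    rw [Metric.mem_ball, Prod.dist_eq, max_lt_iff, Real.dist_eq, sub_zero]
    exact ⟨ht, hy⟩
  have hJI : ∀ x : C(I, Y), pathMap J (pathMap J (pathMap J x)) = -pathMap J x := fun x => by
    ext s; exact hJ _
  have hpt : ∀ {p : ℝ × Y}, p ∈ Metric.ball ((0, y₀) : ℝ × Y) r → ∀ s, Γ p s ∈ Metric.ball y₀ ρ :=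
    fun hp s => (ContinuousMap.dist_apply_le_dist s).trans_lt (hall _ hp).2.1
  -- rescaling
  have hscale : ∀ {ε : ℝ} {y : Y}, |ε| < r → dist y y₀ < r → ∀ s (hs : s ∈ I),
      Γ (s * ε, y) 1 = Γ (ε, y) ⟨s, hs⟩ := by
    intro ε y hε hy s hs
    have hp := (hall _ (hmem hε hy)).1.self_of_nhds
    have hsε : |s * ε| < r := by
      rw [abs_mul, abs_of_nonneg hs.1]
      exact (mul_le_of_le_one_left (abs_nonneg _) hs.2).trans_lt hε
    have hp' := (hall _ (hmem hsε hy)).1.self_of_nhds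
    -- The initial piece of the solution for the time `ε`, stretched to the unit interval, solves
    -- the equation for the time `s * ε` and is identified by uniqueness in the ball.
    let γ : C(I, Y) := (Γ (ε, y)).comp ⟨fun τ => ⟨s * τ, unitInterval.mul_mem hs τ.2⟩, by fun_prop⟩
    have hγ : γ = Γ (s * ε, y) := by
      refine hp'.2.2.2 γ ?_ ?_
      · refine (ContinuousMap.dist_lt_iff hr').2 fun τ => ?_
        exact (ContinuousMap.dist_apply_le_dist (f := Γ (ε, y)) (g := pathConst Y y₀) _).trans_lt hp.2.1
      · ext τ
        have h1 := DFunLike.congr_fun hp.2.2.1 (⟨s * τ, unitInterval.mul_mem hs τ.2⟩ : I)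
        have h2 := pathIntegral_scale (pathComp w' (Γ (ε, y))) hs τ
        change Γ (ε, y) _ = y + ε • pathIntegral Y _ _ at h1
        change Γ (ε, y) _ = y + (s * ε) • pathIntegral Y _ τ
        refine h1.trans ?_
        rw [← h2, smul_smul, mul_comm ε s]
        rfl
    rw [← hγ]
    change Γ (ε, y) _ = _
    congr 1
    exact Subtype.ext (mul_one s)
  refine ⟨fun p => Γ p 1, r, hr, fun t y ht hy => ?_⟩
  have hp := hall _ (hmem ht hy)
  have hsm : ContDiffAt ℝ ∞ Γ (t, y) := hp.1.self_of_nhds.1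
  have hval : ∀ {y : Y}, dist y y₀ < r → Γ (0, y) = pathConst Y y := fun {y} hy => by
    have h1 := (hall _ (hmem (t := 0) (by simpa using hr) hy)).1.self_of_nhds.2.2.1
    change _ = pathConst Y y + (0 : ℝ) • _ at h1
    rwa [zero_smul, add_zero] at h1
  refine ⟨⟨(pathEval Y 1).contDiff.contDiffAt.comp _ hsm, ?_⟩, (hρgood _ (hpt (hmem ht hy) 1)).2.2, ?_, ?_⟩
  · have hd : HasFDerivAt Γ (fderiv ℝ Γ (t, y)) (t, y) := (hsm.differentiableAt (by simp)).hasFDerivAt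
    -- The integral equation, differentiated with respect to the initial value.
    have hlin : ∀ u : Y, fderiv ℝ Γ (t, y) (0, u) = pathConst Y u + K (t, y) (fderiv ℝ Γ (t, y) (0, u)) := by
      intro u
      have h1 : HasFDerivAt (fun p : ℝ × Y => pathConst Y p.2)
        ((pathConst Y).comp (ContinuousLinearMap.snd ℝ ℝ Y)) (t, y) :=
        (pathConst Y).hasFDerivAt.comp _ hasFDerivAt_snd
      have h2 : HasFDerivAt (fun p : ℝ × Y => pathIntegral Y (pathComp w' (Γ p))) _ (t, y) :=
        (pathIntegral Y).hasFDerivAt.comp _ ((hasFDerivAt_pathComp hw' _).comp _ hd)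
      have h3 := h1.add ((hasFDerivAt_fst (𝕜 := ℝ) (p := (t, y))).smul h2)
      have h4 : Γ =ᶠ[𝓝 (t, y)] fun p => pathConst Y p.2 + p.1 • pathIntegral Y (pathComp w' (Γ p)) :=
        hp.1.mono fun p hp => hp.2.2.1
      have h5 := DFunLike.congr_fun ((hd.congr_of_eventuallyEq h4.symm).unique h3) (0, u)
      refine h5.trans ?_
      simp [K]
    have hN : ∀ x, K (t, y) (pathMap J (pathMap J x)) = pathMap J (K (t, y) (pathMap J x)) := by
      intro x
      have h1 := (mix_pathComp hw' (J := J) (J' := J) (γ := Γ (t, y))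
        fun s => (hρgood _ (hpt (hmem ht hy) s)).1).2 x
      rw [(hasFDerivAt_pathComp hw' _).fderiv] at h1
      have h2 := congrArg (fun z => t • pathIntegral Y z) h1
      refine h2.trans ?_
      change t • pathIntegral Y (pathMap J _) = pathMap J (t • pathIntegral Y _)
      rw [pathIntegral_pathMap, map_smul]
      rfl
    intro u
    have h6 := mix_of_small_perturbation (A := (fderiv ℝ Γ (t, y)).comp (ContinuousLinearMap.inr ℝ ℝ Y))
      hJI hp.2.2.1 hp.2.2.2 hN (c := pathConst Y) (fun u => rfl) hlin u.2
    have h7 : fderiv ℝ (fun p => Γ p 1) (t, y) = (pathEval Y 1).comp (fderiv ℝ Γ (t, y)) :=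
      ((pathEval Y 1).hasFDerivAt.comp _ hd).fderiv
    rw [h7]
    exact DFunLike.congr_fun h6 1
  · change HasDerivAt (fun s => Γ (s, y) 1) (w (Γ (t, y) 1)) t
    rw [← (hρgood _ (hpt (hmem ht hy) 1)).2.1]
    have heq : ∀ {ε : ℝ}, |ε| < r → ∀ s : I,
        Γ (ε, y) s = y + ε • pathIntegral Y (pathComp w' (Γ (ε, y))) s := fun hε s =>
      DFunLike.congr_fun (hall _ (hmem hε hy)).1.self_of_nhds.2.2.1 s
    -- At time zero the derivative is read off from the difference quotients of the integral
    -- equation, which are integrals depending continuously on the time.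
    by_cases ht0 : t = 0
    · subst ht0
      have h1 : ContinuousAt (fun ε : ℝ => pathIntegral Y (pathComp w' (Γ (ε, y))) 1) 0 := by
        refine (pathEval Y 1).continuous.continuousAt.comp ((pathIntegral Y).continuous.continuousAt.comp
          ((ContinuousMap.continuous_postcomp w').continuousAt.comp ?_))
        exact ContinuousAt.comp (f := fun ε : ℝ => (ε, y)) hsm.continuousAt (by fun_prop)
      have h2 : HasDerivAt (fun ε : ℝ => ε • pathIntegral Y (pathComp w' (Γ (ε, y))) 1)
          (pathIntegral Y (pathComp w' (Γ (0, y))) 1) 0 := by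
        rw [hasDerivAt_iff_tendsto_slope_zero]
        refine (h1.tendsto.mono_left nhdsWithin_le_nhds).congr' ?_
        filter_upwards [self_mem_nhdsWithin] with ε hε
        rw [zero_add, zero_smul, sub_zero, smul_smul, inv_mul_cancel₀ hε, one_smul]
      have h3 : pathIntegral Y (pathComp w' (Γ (0, y))) 1 = w' (Γ (0, y) 1) := by
        rw [hval hy, pathIntegral_apply]
        simp [Set.IccExtend, Function.comp_def]
      rw [h3] at h2
      refine (h2.const_add y).congr_of_eventuallyEq ?_
      filter_upwards [Metric.ball_mem_nhds (0 : ℝ) hr] with ε hε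
      exact heq (by simpa using hε) 1
    -- For `t ≠ 0` a slightly longer time `ε = t * c` is used, so that `t / ε` is an interior point
    -- of the unit interval and the fundamental theorem of calculus applies to the single path `Γ
    -- (ε, y)`.
    · obtain ⟨c, hc1, hcr⟩ : ∃ c : ℝ, 1 < c ∧ |t| * c < r := by
        have hpos : 0 < |t| := abs_pos.2 ht0
        obtain ⟨x, hx1, hx2⟩ := exists_between ht
        exact ⟨x / |t|, by rwa [lt_div_iff₀ hpos, one_mul], by rwa [mul_div_cancel₀ _ hpos.ne']⟩
      set ε := t * c with hε
      have hc0 : 0 < c := one_pos.trans hc1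
      have hε0 : ε ≠ 0 := mul_ne_zero ht0 hc0.ne'
      have hεr : |ε| < r := by rwa [hε, abs_mul, abs_of_pos hc0]
      have hs : t / ε ∈ Set.Ioo (0 : ℝ) 1 := by
        have : t / ε = c⁻¹ := by rw [hε]; field_simp
        rw [this]
        exact ⟨inv_pos.2 hc0, inv_lt_one_of_one_lt₀ hc1⟩
      have h1 := hasDerivAt_pathIntegral (pathComp w' (Γ (ε, y))) hs
      have h2 : HasDerivAt (fun s : ℝ => s / ε) (1 / ε) t := (hasDerivAt_id t).div_const ε
      have h3 := ((h1.scomp t h2).const_smul ε).const_add y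
      have h4 : Γ (t, y) 1 = Γ (ε, y) ⟨t / ε, hs.1.le, hs.2.le⟩ := by
        have := hscale hεr hy (t / ε) ⟨hs.1.le, hs.2.le⟩
        rwa [div_mul_cancel₀ _ hε0] at this
      rw [smul_smul, mul_one_div_cancel hε0, one_smul, pathComp_apply, ← h4] at h3
      refine h3.congr_of_eventuallyEq ?_
      filter_upwards [h2.continuousAt.eventually (isOpen_Ioo.mem_nhds hs)] with s hs'
      have h5 : Γ (s, y) 1 = Γ (ε, y) ⟨s / ε, hs'.1.le, hs'.2.le⟩ := by
        have := hscale hεr hy (s / ε) ⟨hs'.1.le, hs'.2.le⟩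
        rwa [div_mul_cancel₀ _ hε0] at this
      rw [h5, heq hεr]
      change _ = y + ε • Set.IccExtend zero_le_one _ _
      rw [Set.IccExtend_of_mem _ _ ⟨hs'.1.le, hs'.2.le⟩]
  · change Γ (0, y) 1 = y
    rw [hval hy]; rfl

end Flow

/-! ### Linear coordinates of the model spaces, and the Hadamard lemma -/

section ModelSpace
open unitInterval
variable {n m : ℕ}

/-- The complex structure on the holomorphic directions. -/
def modelJ (n m : ℕ) : ModelSpace n m →L[ℝ] ModelSpace n m :=
  (0 : (Fin n → ℝ) →L[ℝ] (Fin n → ℝ)).prodMap (mulI (Fin m → ℂ))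

theorem modelJ_apply (u : ModelSpace n m) : modelJ n m u = (0, Complex.I • u.2) := rfl

theorem modelJ_cube (u : ModelSpace n m) : modelJ n m (modelJ n m (modelJ n m u)) = -modelJ n m u :=
  Prod.ext (by simp [modelJ_apply]) (mulI_cube _)

/-- The index set for the coordinates. -/
abbrev CoordIndex (n m : ℕ) : Type := Fin n ⊕ Fin m

/-- The directions of the coordinates. -/
def direction : CoordIndex n m → ModelSpace n m :=
  Sum.elim (fun i => (Pi.single i 1, 0)) (fun j => (0, Pi.single j 1))

/-- The linear coordinates, as complex valued functions. -/
def coordinate : CoordIndex n m → ModelSpace n m →L[ℝ] ℂ :=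
  Sum.elim
    (fun i => Complex.ofRealCLM.comp ((ContinuousLinearMap.proj (R := ℝ) (φ := fun _ : Fin n => ℝ) i).comp
      (ContinuousLinearMap.fst ℝ _ _)))
    (fun j => (ContinuousLinearMap.proj (R := ℝ) (φ := fun _ : Fin m => ℂ) j).comp
      (ContinuousLinearMap.snd ℝ _ _))

@[simp] theorem coordinate_inl (i : Fin n) (q : ModelSpace n m) : coordinate (.inl i) q = (q.1 i : ℂ) := rfl

@[simp] theorem coordinate_inr (j : Fin m) (q : ModelSpace n m) : coordinate (.inr j) q = q.2 j := rfl

theorem coordinate_direction (i j : CoordIndex n m) :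
    coordinate i (direction j) = if i = j then 1 else 0 := by
  rcases i with i | i <;> rcases j with j | j <;> simp [direction, Pi.single_apply, apply_ite]

theorem mix_coordinate (j : CoordIndex n m) (q : ModelSpace n m) :
    Mix (modelJ n m) (mulI ℂ) (coordinate j) q := by
  refine Mix.of_clm _ fun u => ?_
  rcases j with i | j <;> simp [modelJ_apply]

/-- The vector with given coordinates. -/
def ofCoordinates (n m : ℕ) : (CoordIndex n m → ℂ) →L[ℝ] ModelSpace n m :=
  (ContinuousLinearMap.pi fun i => Complex.reCLM.comp
    (ContinuousLinearMap.proj (R := ℝ) (φ := fun _ : CoordIndex n m => ℂ) (.inl i))).prod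
  (ContinuousLinearMap.pi fun j =>
    (ContinuousLinearMap.proj (R := ℝ) (φ := fun _ : CoordIndex n m => ℂ) (.inr j)))

theorem ofCoordinates_coordinate (q : ModelSpace n m) :
    ofCoordinates n m (fun j => coordinate j q) = q :=
  Prod.ext (funext fun i => Complex.ofReal_re _) rfl

theorem coordinate_ofCoordinates {c : CoordIndex n m → ℂ} (hc : ∀ i, (c (.inl i)).im = 0)
    (j : CoordIndex n m) : coordinate j (ofCoordinates n m c) = c j := by
  rcases j with i | j
  · exact Complex.ext rfl (hc i).symm
  · rfl

variable {E F : Type} [NormedAddCommGroup E] [NormedSpace ℝ E] [NormedAddCommGroup F]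
  [NormedSpace ℂ F] {J : E →L[ℝ] E} {x : E}

/-- Mixed holomorphy of a map into a model space, in terms of its coordinates. -/
theorem mix_ofCoordinates {c : E → CoordIndex n m → ℂ} (hc : ∀ j, Mix J (mulI ℂ) (fun y => c y j) x)
    (hr : ∀ᶠ y in 𝓝 x, ∀ i, (c y (.inl i)).im = 0) :
    Mix J (modelJ n m) (fun y => ofCoordinates n m (c y)) x := by
  have hd : HasFDerivAt c (ContinuousLinearMap.pi fun j => fderiv ℝ (fun y => c y j) x) x :=
    hasFDerivAt_pi.2 fun j => (hc j).differentiableAt.hasFDerivAt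
  refine ⟨(ofCoordinates n m).contDiff.contDiffAt.comp x (contDiffAt_pi.2 fun j => (hc j).1), fun u => ?_⟩
  have e : fderiv ℝ (fun y => ofCoordinates n m (c y)) x = (ofCoordinates n m).comp _ :=
    ((ofCoordinates n m).hasFDerivAt.comp x hd).fderiv
  rw [e]
  refine Prod.ext (funext fun i => ?_) (funext fun j => (hc (.inr j)).2 u)
  -- `modelJ` vanishes on the real coordinates, so the real part of `c' (J (J u)) = i * c' (J u)`
  -- has to be zero. It is, because these components of `c` are real near `x` and so have real
  -- differentials.
  change (fderiv ℝ (fun y => c y (.inl i)) x (J (J u))).re = 0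
  have h1 : HasFDerivAt (fun y => (c y (.inl i)).im) (Complex.imCLM.comp (fderiv ℝ (fun y => c y (.inl i)) x)) x :=
    Complex.imCLM.hasFDerivAt.comp x (hc (.inl i)).differentiableAt.hasFDerivAt
  have h2 : HasFDerivAt (fun y => (c y (.inl i)).im) (0 : E →L[ℝ] ℝ) x :=
    (hasFDerivAt_const (0 : ℝ) x).congr_of_eventuallyEq (hr.mono fun y hy => hy i)
  have h3 : (fderiv ℝ (fun y => c y (.inl i)) x (J u)).im = 0 := DFunLike.congr_fun (h1.unique h2) (J u)
  rw [(hc (.inl i)).2]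
  simp [h3]

/-- In the holomorphic directions complex scalars can be taken out of the differential, so one term
per complex coordinate replaces two real ones. -/
theorem Mix.fderiv_eq_sum {f : ModelSpace n m → F} {q : ModelSpace n m} (h : Mix (modelJ n m) (mulI F) f q)
    (v : ModelSpace n m) :
    fderiv ℝ f q v = ∑ j, coordinate j v • fderiv ℝ f q (direction j) := by
  have hI : ∀ j : Fin m, fderiv ℝ f q (0, Complex.I • Pi.single j 1) =
      Complex.I • fderiv ℝ f q (0, Pi.single j 1) := fun j => by
    have h1 := h.2 (modelJ n m (0, Pi.single j 1))
    rw [modelJ_cube, map_neg] at h1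
    have h2 : modelJ n m (modelJ n m (0, Pi.single j 1)) = -(0, Pi.single j 1) := by
      simp [modelJ_apply, smul_smul]
    rw [h2, map_neg, map_neg, neg_inj] at h1
    exact h1
  have hv : v = ∑ i, v.1 i • ((Pi.single i 1, 0) : ModelSpace n m) +
      ∑ j, ((v.2 j).re • ((0, Pi.single j 1) : ModelSpace n m) +
        (v.2 j).im • ((0, Complex.I • Pi.single j 1) : ModelSpace n m)) := by
    refine Prod.ext ?_ ?_
    · funext i
      simp [Prod.fst_sum, Finset.sum_apply, Pi.single_apply]
    · funext j
      simp only [Prod.snd_add, Prod.snd_sum, Prod.smul_snd, smul_zero, Finset.sum_const_zero, zero_add,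
        Finset.sum_apply, Pi.add_apply, Pi.smul_apply, Pi.single_apply]
      rw [Finset.sum_eq_single j (fun x _ hx => by simp [hx.symm]) fun h => absurd (Finset.mem_univ j) h]
      simpa using (Complex.re_add_im (v.2 j)).symm
  conv_lhs => rw [hv]
  rw [map_add, map_sum, map_sum, Fintype.sum_sum_type]
  congr 1
  · refine Finset.sum_congr rfl fun i _ => ?_
    rw [map_smul]
    exact (Complex.coe_smul _ _).symm
  · refine Finset.sum_congr rfl fun j _ => ?_
    rw [map_add, map_smul, map_smul, hI, ← Complex.coe_smul, ← Complex.coe_smul, smul_smul, ← add_smul,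
      Complex.re_add_im]
    rfl

/-- The straight path from zero to a vector. -/
def pathLine (E : Type) [NormedAddCommGroup E] [NormedSpace ℝ E] : E →L[ℝ] C(I, E) :=
  LinearMap.mkContinuous
    { toFun := fun v => ⟨fun s => (s : ℝ) • v, by fun_prop⟩
      map_add' := fun _ _ => by ext; simp
      map_smul' := fun c v => by ext1 s; exact smul_comm _ _ _ } 1 fun v => by
    rw [one_mul]
    refine (ContinuousMap.norm_le _ (norm_nonneg _)).2 fun s => ?_
    change ‖(s : ℝ) • v‖ ≤ _
    rw [norm_smul, Real.norm_of_nonneg s.2.1]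
    exact mul_le_of_le_one_left (norm_nonneg _) s.2.2

@[simp] theorem pathLine_apply (v : E) (s : I) : pathLine E v s = (s : ℝ) • v := rfl

/-- The Hadamard lemma for mixed holomorphic functions. -/
theorem MixNear.hadamard [CompleteSpace F] {f : ModelSpace n m → F} {q : ModelSpace n m}
    (hf : MixNear (modelJ n m) (mulI F) f q) :
    ∃ g : CoordIndex n m → ModelSpace n m → F, (∀ j, MixNear (modelJ n m) (mulI F) (g j) q) ∧
      ∀ᶠ p in 𝓝 q, f p = f q + ∑ j, (coordinate j p - coordinate j q) • g j p := by
  -- Composition operators on paths need a globally smooth map. Mixed holomorphy is used only on a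
  -- ball where the extension agrees with `f`.
  obtain ⟨w, hw, hwf⟩ := exists_contDiff_eventuallyEq (hf.mono fun _ h => h.1)
  have hwn : MixNear (modelJ n m) (mulI F) w q := hf.congr hwf
  obtain ⟨r, hr, hball⟩ := Metric.eventually_nhds_iff_ball.1 (hwn.eventually.and hwf)
  let w' : CoordIndex n m → C(ModelSpace n m, F) := fun j =>
    ⟨fun p => fderiv ℝ w p (direction j), (hw.continuous_fderiv (by simp)).clm_apply continuous_const⟩
  have hw' : ∀ j, ContDiff ℝ ∞ (w' j) := fun j =>
    (hw.fderiv_right (m := ∞) (by simp)).clm_apply contDiff_const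
  -- The segment from `q` to `p`. The Hadamard factors are the partial derivatives integrated along
  -- it, and they inherit mixed holomorphy from the composition operator.
  let P : ModelSpace n m → C(I, ModelSpace n m) := fun p => pathConst _ q + pathLine _ (p - q)
  have hPball : ∀ p ∈ Metric.ball q r, ∀ s, P p s ∈ Metric.ball q r := fun p hp s => by
    rw [mem_ball_iff_norm] at hp ⊢
    change ‖q + (s : ℝ) • (p - q) - q‖ < r
    rw [add_sub_cancel_left, norm_smul, Real.norm_of_nonneg s.2.1]
    exact (mul_le_of_le_one_left (norm_nonneg _) s.2.2).trans_lt hp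
  have hP : ∀ p, Mix (modelJ n m) (pathMap (modelJ n m)) P p := fun p =>
    (Mix.const _).add (Mix.comp modelJ_cube (f := fun p => p - q) (J' := modelJ n m)
      (Mix.of_clm _ fun u => by ext s : 1; simp)
      ((Mix.of_clm (J' := modelJ n m) (ContinuousLinearMap.id ℝ _) fun u => rfl).sub (Mix.const q)))
  refine ⟨fun j p => pathIntegral F (pathComp (w' j) (P p)) 1, fun j => ?_, ?_⟩
  · filter_upwards [Metric.ball_mem_nhds q hr] with p hp
    have h1 : Mix (modelJ n m) (pathMap (mulI F)) (fun p => pathComp (w' j) (P p)) p :=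
      Mix.comp modelJ_cube (mix_pathComp (hw' j) fun s => (hball _ (hPball p hp s)).1.fderiv_apply _) (hP p)
    refine Mix.comp modelJ_cube (g := fun γ => pathIntegral F γ 1) ?_ h1
    refine Mix.of_clm ((pathEval F 1).comp (pathIntegral F)) fun u => ?_
    rw [ContinuousLinearMap.comp_apply, pathIntegral_pathMap]
    rfl
  · filter_upwards [Metric.ball_mem_nhds q hr] with p hp
    rw [← (hball p hp).2, ← (hball q (Metric.mem_ball_self hr)).2]
    have hd : ∀ τ ∈ Set.uIcc (0 : ℝ) 1, HasDerivAt (fun τ : ℝ => w (q + τ • (p - q)))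
        (fderiv ℝ w (q + τ • (p - q)) (p - q)) τ := fun τ _ => by
      have h2 : HasDerivAt (fun τ : ℝ => q + τ • (p - q)) (p - q) τ := by
        simpa using ((hasDerivAt_id τ).smul_const (p - q)).const_add q
      exact (hw.differentiable (by simp) _).hasFDerivAt.comp_hasDerivAt τ h2
    have hcont : ∀ v, Continuous fun τ : ℝ => fderiv ℝ w (q + τ • (p - q)) v := fun v =>
      ((hw.continuous_fderiv (by simp)).comp (by fun_prop)).clm_apply continuous_const
    have h3 := intervalIntegral.integral_eq_sub_of_hasDerivAt hd ((hcont _).intervalIntegrable 0 1)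
    have h4 : ∀ τ ∈ Set.uIcc (0 : ℝ) 1, fderiv ℝ w (q + τ • (p - q)) (p - q) =
        ∑ j, coordinate j (p - q) • fderiv ℝ w (q + τ • (p - q)) (direction j) := fun τ hτ => by
      rw [Set.uIcc_of_le zero_le_one] at hτ
      exact ((hball _ (hPball p hp ⟨τ, hτ⟩)).1.mix).fderiv_eq_sum _
    have h5 := intervalIntegral.integral_finsetSum (μ := MeasureTheory.volume) (s := Finset.univ)
      (f := fun j τ => coordinate j (p - q) • fderiv ℝ w (q + τ • (p - q)) (direction j))
      fun j _ => ((hcont (direction j)).const_smul (coordinate j (p - q))).intervalIntegrable 0 1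
    rw [intervalIntegral.integral_congr h4, h5] at h3
    rw [one_smul, add_sub_cancel, zero_smul, add_zero] at h3
    rw [← sub_eq_iff_eq_add', ← h3]
    refine Finset.sum_congr rfl fun j _ => ?_
    rw [intervalIntegral.integral_smul, map_sub, pathIntegral_apply]
    congr 1
    refine intervalIntegral.integral_congr fun τ hτ => ?_
    have hτ' : τ ∈ Set.Icc (0 : ℝ) 1 := by rwa [Set.uIcc_of_le zero_le_one] at hτ
    rw [Set.IccExtend_of_mem _ _ hτ']
    rfl

end ModelSpace

/-! ### Grassmann algebra valued points -/

theorem zmod_two_cases : ∀ i : ZMod 2, i = 0 ∨ i = 1 := by decide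

/-- A parity preserving homomorphism from the stalk at a point to a Grassmann algebra. -/
structure LPoint (M : RingedSuperspace.{u, v}) (k : ℕ) where
  pt : M
  eval : ∀ U : Opens M, pt ∈ U → (M.sections U →ₐ[ℂ] Grassmann k)
  eval_res : ∀ {U V : Opens M} (h : U ≤ V) (hx : pt ∈ U) (f : M.sections V),
    eval U hx (M.res h f) = eval V (h hx) f
  eval_parity : ∀ {U : Opens M} (hx : pt ∈ U) (i : ZMod 2) (f : M.sections U),
    f ∈ M.parity U i → eval U hx f ∈ Grassmann.parity k i

namespace LPoint
variable {M : RingedSuperspace.{u, v}} {k k' : ℕ} (A B : LPoint M k)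

open Classical in
/-- The value of a section at a Grassmann algebra valued point, zero if it is not defined there. -/
def app (U : Opens M) : M.sections U →ₗ[ℂ] Grassmann k :=
  if h : A.pt ∈ U then (A.eval U h).toLinearMap else 0

variable {A B} {U V : Opens M}

theorem app_of_mem (h : A.pt ∈ U) (f : M.sections U) : A.app U f = A.eval U h f := by
  rw [app, dif_pos h]; rfl

theorem app_of_notMem (h : A.pt ∉ U) (f : M.sections U) : A.app U f = 0 := by
  rw [app, dif_neg h]; rfl

theorem app_res (h : U ≤ V) (hx : A.pt ∈ U) (f : M.sections V) : A.app U (M.res h f) = A.app V f := by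
  rw [app_of_mem hx, app_of_mem (h hx), A.eval_res]

theorem app_mul (f g : M.sections U) : A.app U (f * g) = A.app U f * A.app U g := by
  by_cases h : A.pt ∈ U
  · simp only [app_of_mem h, map_mul]
  · simp only [app_of_notMem h, mul_zero]

theorem app_algebraMap (h : A.pt ∈ U) (c : ℂ) :
    A.app U (algebraMap ℂ _ c) = algebraMap ℂ _ c := by
  rw [app_of_mem h, AlgHom.commutes]

theorem app_parity {i : ZMod 2} {f : M.sections U} (hf : f ∈ M.parity U i) :
    A.app U f ∈ Grassmann.parity k i := by
  by_cases h : A.pt ∈ U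
  · rw [app_of_mem h]; exact A.eval_parity h i f hf
  · rw [app_of_notMem h]; exact Submodule.zero_mem _

theorem ext_of_app (h : A.pt = B.pt) (happ : ∀ U, A.pt ∈ U → ∀ f : M.sections U, A.app U f = B.app U f) :
    A = B := by
  obtain ⟨x, ev, hA, hA'⟩ := A
  obtain ⟨y, ev', hB, hB'⟩ := B
  obtain rfl : x = y := h
  have : ev = ev' := by
    funext U hU
    refine AlgHom.ext fun f => ?_
    have := happ U hU f
    rwa [app_of_mem (A := ⟨x, ev, hA, hA'⟩) hU, app_of_mem (A := ⟨x, ev', hB, hB'⟩) hU] at this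
  subst this
  rfl

/-- The induced homomorphism from the stalk to `ℂ`. -/
def toPointEval (A : LPoint M k) : MixedSupermanifold.PointEval M A.pt where
  eval U h := (Grassmann.aug k).comp (A.eval U h)
  eval_res h hx f := congrArg (Grassmann.aug k) (A.eval_res h hx f)

/-- Composition with a parity preserving homomorphism of Grassmann algebras. -/
def map (σ : Grassmann k →ₐ[ℂ] Grassmann k') (hσ : ∀ v, σ (ExteriorAlgebra.ι ℂ v) ∈ Grassmann.parity k' 1)
    (A : LPoint M k) : LPoint M k' where
  pt := A.pt
  eval U h := σ.comp (A.eval U h)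
  eval_res h hx f := congrArg σ (A.eval_res h hx f)
  eval_parity hx i f hf := Grassmann.map_parity_of_odd σ hσ i (A.eval_parity hx i f hf)

@[simp] theorem map_app (σ : Grassmann k →ₐ[ℂ] Grassmann k')
    (hσ : ∀ v, σ (ExteriorAlgebra.ι ℂ v) ∈ Grassmann.parity k' 1) (f : M.sections U) :
    (A.map σ hσ).app U f = σ (A.app U f) := by
  by_cases h : A.pt ∈ U
  · rw [app_of_mem h, app_of_mem (A := A.map σ hσ) h]; rfl
  · rw [app_of_notMem h, app_of_notMem (A := A.map σ hσ) h, map_zero]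

@[simp] theorem map_pt (σ : Grassmann k →ₐ[ℂ] Grassmann k')
    (hσ : ∀ v, σ (ExteriorAlgebra.ι ℂ v) ∈ Grassmann.parity k' 1) : (A.map σ hσ).pt = A.pt := rfl

theorem aug_app {M : MixedSupermanifold.{u, v}} {A : LPoint M.toRingedSuperspace k} {U : Opens M.carrier}
    (h : A.pt ∈ U) (f : M.sections U) : Grassmann.aug k (A.app U f) = M.value f ⟨A.pt, h⟩ := by
  rw [app_of_mem h, M.value_eq f ⟨A.pt, h⟩ A.toPointEval]
  rfl

/-- A point of the base, where all odd sections vanish. -/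
def ofPoint {M : MixedSupermanifold.{u, v}} (k : ℕ) (x : M.carrier) : LPoint M.toRingedSuperspace k where
  pt := x
  eval U h := (Algebra.ofId ℂ (Grassmann k)).comp ((Pi.evalAlgHom ℂ (fun _ : U => ℂ) ⟨x, h⟩).comp M.value)
  eval_res h hx f := congrArg (algebraMap ℂ (Grassmann k)) (M.value_res h f ⟨x, hx⟩)
  eval_parity hx i f hf := by
    rcases zmod_two_cases i with rfl | rfl
    · exact Grassmann.algebraMap_mem_even _
    · have h0 : M.value f ⟨x, hx⟩ = 0 := by rw [M.value_odd hf]; rfl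
      change algebraMap ℂ (Grassmann k) (M.value f ⟨x, hx⟩) ∈ _
      rw [h0, map_zero]
      exact Submodule.zero_mem _

theorem ofPoint_app {M : MixedSupermanifold.{u, v}} {x : M.carrier} {U : Opens M.carrier} (h : x ∈ U)
    (f : M.sections U) : (ofPoint k x).app U f = algebraMap ℂ _ (M.value f ⟨x, h⟩) := by
  rw [app_of_mem (A := ofPoint k x) h]; rfl

end LPoint

/-! ### Sections in local parametrizations -/

theorem mem_modelSections_of_mix {n m k : ℕ} {U : Opens (ModelSpace n m)} {g : U → Grassmann k}
    (h : ∀ p ∈ U, Mix (modelJ n m) (mulI _) (extendZero U g) p) : g ∈ modelSections n m k U := by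
  rw [mem_modelSections]
  intro l p hp
  have e : extendZero U (fun p => l (g p)) = fun q => l (extendZero U g q) := by
    funext q
    by_cases hq : q ∈ U
    · rw [extendZero_of_mem _ hq, extendZero_of_mem _ hq]
    · simp [extendZero, hq]
  have h1 := (h p hp).dual l
  rw [e]
  refine ⟨h1.1, fun w => ?_⟩
  -- This vector is chosen so that `modelJ` maps it to `(0, w)`.
  have h2 := h1.2 (0, -(Complex.I • w))
  simpa [modelJ_apply, smul_smul] using h2

theorem mix_of_mem_modelSections {n m k : ℕ} {U : Opens (ModelSpace n m)} {g : U → Grassmann k}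
    (h : g ∈ modelSections n m k U) {p : ModelSpace n m} (hp : p ∈ U) :
    Mix (modelJ n m) (mulI _) (extendZero U g) p := by
  refine mix_of_dual fun l => ?_
  have e : extendZero U (fun p => l (g p)) = fun q => l (extendZero U g q) := by
    funext q
    by_cases hq : q ∈ U
    · rw [extendZero_of_mem _ hq, extendZero_of_mem _ hq]
    · simp [extendZero, hq]
  have h1 := mem_modelSections.1 h l p hp
  rw [e] at h1
  refine ⟨h1.1, fun u => ?_⟩
  exact h1.2 (Complex.I • u.2)

namespace RingedSuperspace.Parametrization
variable {M : RingedSuperspace.{u, v}} (ψ : M.Parametrization)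

/-- The expression of a section in a parametrization, extended by zero. -/
def expr (U : Opens M) (f : M.sections U) : ModelSpace ψ.n ψ.m → Grassmann ψ.k :=
  extendZero (ψ.preimage U) (ψ.pullback U f).1

/-- The open subspace which is parametrized. -/
def range : Opens M := ⟨Set.range ψ.hom.base, ψ.isOpenImmersion.1.isOpen_range⟩

variable {ψ} {U V : Opens M} {p : ModelSpace ψ.n ψ.m}

theorem mem_preimage_range (hp : p ∈ ψ.domain) : p ∈ ψ.preimage ψ.range :=
  ψ.mem_preimage.2 ⟨hp, ⟨p, hp⟩, rfl⟩

theorem mem_domain (hp : p ∈ ψ.preimage U) : p ∈ ψ.domain := (ψ.mem_preimage.1 hp).1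

theorem base_mem (hp : p ∈ ψ.preimage U) : ψ.hom.base ⟨p, mem_domain hp⟩ ∈ U := (ψ.mem_preimage.1 hp).2

theorem expr_eq (f : M.sections U) (hp : p ∈ ψ.preimage U) : ψ.expr U f p = (ψ.pullback U f).1 ⟨p, hp⟩ :=
  extendZero_of_mem _ hp

theorem expr_res (h : U ≤ V) (f : M.sections V) (hp : p ∈ ψ.preimage U) :
    ψ.expr U (M.res h f) p = ψ.expr V f p := by
  rw [expr_eq _ hp, expr_eq _ (ψ.preimage_mono h hp), ψ.pullback_res]
  rfl

theorem expr_res_eventuallyEq (h : U ≤ V) (f : M.sections V) (hp : p ∈ ψ.preimage U) :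
    ψ.expr U (M.res h f) =ᶠ[𝓝 p] ψ.expr V f := by
  filter_upwards [(ψ.preimage U).isOpen.mem_nhds hp] with q hq using expr_res h f hq

theorem expr_mul (f g : M.sections U) : ψ.expr U (f * g) = fun q => ψ.expr U f q * ψ.expr U g q := by
  funext q
  by_cases hq : q ∈ ψ.preimage U
  · simp only [expr_eq _ hq, map_mul]; rfl
  · simp [expr, extendZero, hq]

theorem expr_add (f g : M.sections U) : ψ.expr U (f + g) = fun q => ψ.expr U f q + ψ.expr U g q := by
  funext q
  by_cases hq : q ∈ ψ.preimage U
  · simp only [expr_eq _ hq, map_add]; rfl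
  · simp [expr, extendZero, hq]

theorem expr_algebraMap (c : ℂ) (hp : p ∈ ψ.preimage U) :
    ψ.expr U (algebraMap ℂ _ c) =ᶠ[𝓝 p] fun _ => algebraMap ℂ _ c := by
  filter_upwards [(ψ.preimage U).isOpen.mem_nhds hp] with q hq
  rw [expr_eq _ hq, AlgHom.commutes]; rfl

theorem expr_parity {i : ZMod 2} {f : M.sections U} (hf : f ∈ M.parity U i) (q : ModelSpace ψ.n ψ.m) :
    ψ.expr U f q ∈ Grassmann.parity ψ.k i := by
  by_cases hq : q ∈ ψ.preimage U
  · rw [expr_eq _ hq]; exact ψ.pullback_parity i hf _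
  · simp [expr, extendZero, hq]

theorem mixNear_expr (f : M.sections U) (hp : p ∈ ψ.preimage U) :
    MixNear (modelJ _ _) (mulI _) (ψ.expr U f) p := by
  filter_upwards [(ψ.preimage U).isOpen.mem_nhds hp] with q hq
  exact mix_of_mem_modelSections (ψ.pullback U f).2 hq

theorem eq_of_expr (hU : U ≤ ψ.range) {f g : M.sections U} (h : ∀ p ∈ ψ.preimage U, ψ.expr U f p = ψ.expr U g p) :
    f = g := by
  apply (ψ.isOpenImmersion.2 U hU).1
  refine Subtype.ext (funext fun q => ?_)
  have := h q.1 q.2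
  rwa [expr_eq _ q.2, expr_eq _ q.2] at this

theorem exists_expr_eq (hU : U ≤ ψ.range) {g : ModelSpace ψ.n ψ.m → Grassmann ψ.k}
    (hg : ∀ p ∈ ψ.preimage U, Mix (modelJ _ _) (mulI _) g p) :
    ∃ f : M.sections U, ∀ p ∈ ψ.preimage U, ψ.expr U f p = g p := by
  have hmem : (fun p : ψ.preimage U => g p.1) ∈ modelSections ψ.n ψ.m ψ.k (ψ.preimage U) := by
    refine mem_modelSections_of_mix fun p hp => (hg p hp).congr ?_
    filter_upwards [(ψ.preimage U).isOpen.mem_nhds hp] with q hq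
    rw [extendZero_of_mem _ hq]
  obtain ⟨f, hf⟩ := (ψ.isOpenImmersion.2 U hU).2 ⟨_, hmem⟩
  refine ⟨f, fun p hp => ?_⟩
  rw [expr_eq _ hp]
  exact congrFun (congrArg Subtype.val hf) ⟨p, hp⟩

/-- In the decomposition of `f` into homogeneous parts, the part of the wrong parity has values in
both summands of the Grassmann algebra, hence zero expression in the chart, and therefore vanishes.
-/
theorem exists_mem_parity (hU : U ≤ ψ.range) {i : ZMod 2} {f : M.sections U}
    (hf : ∀ p ∈ ψ.preimage U, ψ.expr U f p ∈ Grassmann.parity ψ.k i) : f ∈ M.parity U i := by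
  obtain ⟨a, b, ha, hb, rfl⟩ := Submodule.codisjoint_iff_exists_add_eq.1 (M.isCompl U).codisjoint f
  have key : ∀ p ∈ ψ.preimage U, ∀ j, j ≠ i → ∀ c c' : M.sections U, c ∈ M.parity U j → c' ∈ M.parity U i →
      ψ.expr U (c + c') p ∈ Grassmann.parity ψ.k i → ψ.expr U c p = 0 := by
    intro p hp j hj c c' hc hc' h
    rw [expr_add] at h
    have h1 := (Submodule.add_mem_iff_left _ (expr_parity hc' p)).1 h
    have h2 := expr_parity (ψ := ψ) hc p
    have hd := Grassmann.isCompl_parity (k := ψ.k).disjoint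
    rcases zmod_two_cases i with rfl | rfl <;> rcases zmod_two_cases j with rfl | rfl
    · exact absurd rfl hj
    · exact Submodule.disjoint_def.1 hd _ h1 h2
    · exact Submodule.disjoint_def.1 hd _ h2 h1
    · exact absurd rfl hj
  have hz : ∀ c : M.sections U, (∀ p ∈ ψ.preimage U, ψ.expr U c p = 0) → c = 0 := fun c hc =>
    eq_of_expr hU fun p hp => by
      rw [hc p hp, expr_eq _ hp, map_zero]; rfl
  rcases zmod_two_cases i with rfl | rfl
  · rw [hz b fun p hp => key p hp 1 (by decide) b a hb ha (by rw [add_comm]; exact hf p hp), add_zero]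
    exact ha
  · rw [hz a fun p hp => key p hp 0 (by decide) a b ha hb (hf p hp), zero_add]
    exact hb

variable (ψ) in
theorem exists_coordinateSection (j : CoordIndex ψ.n ψ.m) : ∃ f : M.sections ψ.range,
    ∀ p ∈ ψ.domain, ψ.expr ψ.range f p = algebraMap ℂ _ (coordinate j p) := by
  obtain ⟨f, hf⟩ := exists_expr_eq (ψ := ψ) (U := ψ.range) le_rfl
    (g := fun p => algebraMap ℂ _ (coordinate j p)) fun p _ =>
      Mix.clm_comp_complex (Algebra.linearMap ℂ (Grassmann ψ.k)).toContinuousLinearMap (mix_coordinate j p)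
  exact ⟨f, fun p hp => hf p (mem_preimage_range hp)⟩

variable (ψ) in
theorem exists_oddSection (l : Fin ψ.k) : ∃ f : M.sections ψ.range,
    ∀ p ∈ ψ.domain, ψ.expr ψ.range f p = Grassmann.gen l := by
  obtain ⟨f, hf⟩ := exists_expr_eq (ψ := ψ) (U := ψ.range) le_rfl
    (g := fun p => Grassmann.gen l) fun p _ => Mix.const _
  exact ⟨f, fun p hp => hf p (mem_preimage_range hp)⟩

variable (ψ) in
/-- The even coordinates of a parametrization, as sections. -/
def coordinateSection (j : CoordIndex ψ.n ψ.m) : M.sections ψ.range := (ψ.exists_coordinateSection j).choose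

variable (ψ) in
/-- The odd coordinates of a parametrization, as sections. -/
def oddSection (l : Fin ψ.k) : M.sections ψ.range := (ψ.exists_oddSection l).choose

theorem expr_coordinateSection (j : CoordIndex ψ.n ψ.m) (hp : p ∈ ψ.domain) :
    ψ.expr ψ.range (ψ.coordinateSection j) p = algebraMap ℂ _ (coordinate j p) :=
  (ψ.exists_coordinateSection j).choose_spec p hp

theorem expr_oddSection (l : Fin ψ.k) (hp : p ∈ ψ.domain) :
    ψ.expr ψ.range (ψ.oddSection l) p = Grassmann.gen l :=
  (ψ.exists_oddSection l).choose_spec p hp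

theorem coordinateSection_mem (j : CoordIndex ψ.n ψ.m) : ψ.coordinateSection j ∈ M.parity ψ.range 0 :=
  exists_mem_parity (ψ := ψ) le_rfl fun p hp => by
    rw [expr_coordinateSection j (mem_domain hp)]; exact Grassmann.algebraMap_mem_even _

theorem oddSection_mem (l : Fin ψ.k) : ψ.oddSection l ∈ M.parity ψ.range 1 :=
  exists_mem_parity (ψ := ψ) le_rfl fun p hp => by
    rw [expr_oddSection l (mem_domain hp)]; exact Grassmann.gen_mem_odd l

/-- The constant term of a Grassmann valued point is a homomorphism from the stalk to `ℂ`, and there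
is only one of these over a given point of a chart. -/
theorem aug_app {k₀ : ℕ} {A : LPoint M k₀} (hp : p ∈ ψ.preimage U)
    (hA : A.pt = ψ.hom.base ⟨p, mem_domain hp⟩) (f : M.sections U) :
    Grassmann.aug k₀ (A.app U f) = Grassmann.aug ψ.k (ψ.expr U f p) := by
  have hU : A.pt ∈ U := hA ▸ base_mem hp
  rw [LPoint.app_of_mem hU, expr_eq _ hp]
  have key : ∀ (x : M) (ev : MixedSupermanifold.PointEval M x) (hx : x ∈ U), x = ψ.hom.base ⟨p, mem_domain hp⟩ →
      ev.eval U hx f = Grassmann.aug ψ.k ((ψ.pullback U f).1 ⟨p, hp⟩) := by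
    rintro x ev hx rfl
    exact ev.eq_parametrizationEval ψ ⟨p, mem_domain hp⟩ hx f
  exact key A.pt A.toPointEval hU hA

end RingedSuperspace.Parametrization

/-! ### Coordinates of Grassmann algebra valued points -/

namespace RingedSuperspace.Parametrization
variable {M : RingedSuperspace.{u, v}} {ψ : M.Parametrization} {U V : Opens M}
  {p : ModelSpace ψ.n ψ.m} {k₀ : ℕ}

/-- Near a point, a section is determined by its value there modulo the coordinates. -/
theorem exists_decomposition (f : M.sections U) (hp : p ∈ ψ.preimage U) :
    ∃ (W : Opens M) (hWU : W ≤ U) (hWR : W ≤ ψ.range) (c : ℂ) (α : Fin ψ.k → M.sections W)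
      (g : CoordIndex ψ.n ψ.m → M.sections W), p ∈ ψ.preimage W ∧
      M.res hWU f = algebraMap ℂ _ c + ∑ l, M.res hWR (ψ.oddSection l) * α l +
        ∑ j, M.res hWR (ψ.coordinateSection j - algebraMap ℂ _ (coordinate j p)) * g j := by
  -- The Hadamard lemma accounts for the variation in the even coordinates. The value at `p` that
  -- remains is a constant plus multiples of the odd generators.
  obtain ⟨g, hg, he⟩ := (mixNear_expr f hp).hadamard
  obtain ⟨c, α, hα⟩ := Grassmann.exists_eq_add_sum_gen (ψ.expr U f p)
  have hev : ∀ᶠ q in 𝓝 p, q ∈ ψ.preimage U ∧ (∀ j, Mix (modelJ _ _) (mulI _) (g j) q) ∧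
      ψ.expr U f q = ψ.expr U f p + ∑ j, (coordinate j q - coordinate j p) • g j q :=
    Eventually.and ((ψ.preimage U).isOpen.mem_nhds hp) ((eventually_all.2 hg).and he)
  obtain ⟨S, hS, hSo, hpS⟩ := eventually_nhds_iff.1 hev
  have hSd : S ⊆ ψ.domain := fun q hq => mem_domain (hS q hq).1
  let W : Opens M := ⟨ψ.hom.base '' (Subtype.val ⁻¹' S),
    ψ.isOpenImmersion.1.isOpenMap _ (hSo.preimage continuous_subtype_val)⟩
  have hW : ∀ {q}, q ∈ ψ.preimage W ↔ q ∈ S := by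
    intro q
    rw [ψ.mem_preimage]
    constructor
    · rintro ⟨hq, ⟨q', hq', e⟩⟩
      rw [ψ.isOpenImmersion.1.injective e] at hq'
      exact hq'
    · exact fun hq => ⟨hSd hq, ⟨q, hSd hq⟩, hq, rfl⟩
  have hWU : W ≤ U := by
    rintro _ ⟨q, hq, rfl⟩
    exact base_mem (hS q.1 hq).1
  have hWR : W ≤ ψ.range := by
    rintro _ ⟨q, hq, rfl⟩
    exact ⟨q, rfl⟩
  have hα' : ∀ l, ∃ a : M.sections W, ∀ q ∈ ψ.preimage W, ψ.expr W a q = α l := fun l =>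
    exists_expr_eq hWR fun q _ => Mix.const _
  have hg' : ∀ j, ∃ a : M.sections W, ∀ q ∈ ψ.preimage W, ψ.expr W a q = g j q := fun j =>
    exists_expr_eq hWR fun q hq => (hS q (hW.1 hq)).2.1 j
  choose α' hα' using hα'
  choose g' hg' using hg'
  refine ⟨W, hWU, hWR, c, α', g', hW.2 hpS, eq_of_expr hWR fun q hq => ?_⟩
  let ev : M.sections W →ₐ[ℂ] Grassmann ψ.k :=
    (Pi.evalAlgHom ℂ (fun _ : ψ.preimage W => Grassmann ψ.k) ⟨q, hq⟩).comp
      ((modelSections ψ.n ψ.m ψ.k (ψ.preimage W)).val.comp (ψ.pullback W))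
  have hev' : ∀ h, ψ.expr W h q = ev h := fun h => expr_eq h hq
  have hqd : q ∈ ψ.domain := mem_domain hq
  rw [expr_res _ _ hq, (hS q (hW.1 hq)).2.2, hα, hev', map_add, map_add, map_sum, map_sum, AlgHom.commutes]
  congr 1
  · congr 1
    refine Finset.sum_congr rfl fun l _ => ?_
    rw [map_mul, ← hev', ← hev', hα' l q hq, expr_res _ _ hq, expr_oddSection l hqd]
  · refine Finset.sum_congr rfl fun j _ => ?_
    rw [map_mul, map_sub, map_sub, AlgHom.commutes, AlgHom.commutes, ← hev' (g' j), ← hev' (M.res _ _),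
      hg' j q hq, expr_res _ _ hq, expr_coordinateSection j hqd, Algebra.smul_def,
      map_sub (algebraMap ℂ (Grassmann ψ.k))]

/-- Twisted derivations of the stalk are determined by their values on the coordinates. -/
theorem twisted_derivation_eq_zero {A B : LPoint M k₀} (hp : p ∈ ψ.domain)
    (hA : A.pt = ψ.hom.base ⟨p, hp⟩) (hB : B.pt = ψ.hom.base ⟨p, hp⟩)
    (D : ∀ U : Opens M, M.sections U → Grassmann k₀)
    (hadd : ∀ U : Opens M, A.pt ∈ U → ∀ f g : M.sections U, D U (f + g) = D U f + D U g)
    (hmul : ∀ U : Opens M, A.pt ∈ U → ∀ f g : M.sections U,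
      D U (f * g) = D U f * A.app U g + B.app U f * D U g)
    (hres : ∀ {U V : Opens M} (h : U ≤ V), A.pt ∈ U → ∀ f : M.sections V, D U (M.res h f) = D V f)
    (hconst : ∀ U : Opens M, A.pt ∈ U → ∀ c : ℂ, D U (algebraMap ℂ _ c) = 0)
    (hcoord : ∀ j, D ψ.range (ψ.coordinateSection j) = 0) (hodd : ∀ l, D ψ.range (ψ.oddSection l) = 0)
    (U : Opens M) (hU : A.pt ∈ U) (f : M.sections U) : D U f = 0 := by
  -- `D f` is pushed down the filtration by one step at a time. In the decomposition of `f`, each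
  -- coordinate factor `a` satisfies `D a = 0` and has a value at `B` without constant term, so `D
  -- (a * b) = B a * D b` lies one step deeper than `D b`.
  have key : ∀ (r : ℕ) (U : Opens M) (hU : A.pt ∈ U) (f : M.sections U), D U f ∈ Grassmann.nilFilt k₀ r := by
    intro r
    induction r with
    | zero => exact fun U hU f => Grassmann.mem_nilFilt_zero _
    | succ r ih =>
      intro U hU f
      have hpU : p ∈ ψ.preimage U := ψ.mem_preimage.2 ⟨hp, hA ▸ hU⟩
      obtain ⟨W, hWU, hWR, c, α, g, hpW, hf⟩ := exists_decomposition f hpU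
      have hAW : A.pt ∈ W := hA ▸ base_mem hpW
      have hBW : B.pt ∈ W := hB ▸ base_mem hpW
      have hR : A.pt ∈ ψ.range := hWR hAW
      let D' : M.sections W →+ Grassmann k₀ := AddMonoidHom.mk' (D W) (hadd W hAW)
      have hD' : ∀ h, D W h = D' h := fun _ => rfl
      have hterm : ∀ a b : M.sections W, D W a = 0 → Grassmann.aug k₀ (B.app W a) = 0 →
          D W (a * b) ∈ Grassmann.nilFilt k₀ (r + 1) := fun a b h1 h2 => by
        rw [hmul W hAW, h1, zero_mul, zero_add]
        exact Grassmann.mul_mem_nilFilt_succ h2 (ih W hAW b)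
      rw [← hres hWU hAW, hf, hD', map_add, map_add, map_sum, map_sum]
      refine Submodule.add_mem _ (Submodule.add_mem _ ?_ (Submodule.sum_mem _ fun l _ => ?_))
        (Submodule.sum_mem _ fun j _ => ?_)
      · rw [← hD', hconst W hAW]; exact Submodule.zero_mem _
      · refine hterm _ _ (by rw [hres hWR hAW, hodd]) ?_
        exact Grassmann.aug_odd (LPoint.app_parity (M.res_parity _ _ _ (oddSection_mem l)))
      · refine hterm _ _ ?_ ?_
        · rw [hres hWR hAW, sub_eq_add_neg, ← map_neg, hadd _ hR, hcoord, hconst _ hR, add_zero]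
        · rw [LPoint.app_res hWR hBW, map_sub, map_sub, LPoint.app_algebraMap (hWR hBW),
            aug_app (mem_preimage_range hp) hB, expr_coordinateSection j hp, AlgHom.commutes,
            AlgHom.commutes, sub_self]
  have := key (Grassmann.nilDegree k₀) U hU f
  rwa [Grassmann.nilFilt_eq_bot le_rfl, Submodule.mem_bot] at this

/-- Grassmann algebra valued points are determined by their coordinates. -/
theorem lpoint_ext {A B : LPoint M k₀} (hAB : A.pt = B.pt) (hR : A.pt ∈ ψ.range)
    (hcoord : ∀ j, A.app ψ.range (ψ.coordinateSection j) = B.app ψ.range (ψ.coordinateSection j))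
    (hodd : ∀ l, A.app ψ.range (ψ.oddSection l) = B.app ψ.range (ψ.oddSection l)) : A = B := by
  obtain ⟨p, hp⟩ := hR
  refine LPoint.ext_of_app hAB fun U hU f => ?_
  rw [← sub_eq_zero]
  -- The difference of two homomorphisms is a derivation twisted by both: `A f * A g - B f * B g =
  -- (A f - B f) * A g + B f * (A g - B g)`.
  refine twisted_derivation_eq_zero (p := p.1) p.2 hp.symm (hAB ▸ hp.symm) (fun U f => A.app U f - B.app U f)
    ?_ ?_ ?_ ?_ (fun j => sub_eq_zero.2 (hcoord j)) (fun l => sub_eq_zero.2 (hodd l)) U hU f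
  · intro U hU f g
    simp only [map_add]; abel
  · intro U hU f g
    simp only [LPoint.app_mul]; noncomm_ring
  · intro U V h hU f
    simp only [LPoint.app_res h hU, LPoint.app_res h (hAB ▸ hU)]
  · intro U hU c
    simp only [LPoint.app_algebraMap hU, LPoint.app_algebraMap (hAB ▸ hU : B.pt ∈ U), sub_self]

variable (ψ) in
/-- The space of coordinates for Grassmann algebra valued points. -/
abbrev PhaseSpace (k₀ : ℕ) : Type := Phase (ModelSpace ψ.n ψ.m) (CoordIndex ψ.n ψ.m) ψ.k k₀

variable (ψ k₀) in
/-- The fibre part of the phase space point with given values of the coordinates. -/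
def fibOfValues : ((CoordIndex ψ.n ψ.m → Grassmann k₀) × (Fin ψ.k → Grassmann k₀)) →L[ℂ]
    PhaseFib (CoordIndex ψ.n ψ.m) ψ.k k₀ :=
  (((ContinuousLinearMap.pi fun j => (Grassmann.evenNilProj k₀).comp (ContinuousLinearMap.proj j)).comp
    (ContinuousLinearMap.fst ℂ _ _)).prod
  ((ContinuousLinearMap.pi fun l => (Grassmann.oddProj k₀).comp (ContinuousLinearMap.proj l)).comp
    (ContinuousLinearMap.snd ℂ _ _)) : _ →L[ℂ]
    ((CoordIndex ψ.n ψ.m → Grassmann.evenNil k₀) × (Fin ψ.k → Grassmann.parity k₀ 1)))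

variable (ψ k₀) in
/-- The phase space point with given values of the coordinates. -/
def phaseOfValues : ((CoordIndex ψ.n ψ.m → Grassmann k₀) × (Fin ψ.k → Grassmann k₀)) →L[ℝ] ψ.PhaseSpace k₀ :=
  ((ofCoordinates ψ.n ψ.m).comp ((ContinuousLinearMap.pi fun j =>
    ((Grassmann.augL k₀).restrictScalars ℝ).comp (ContinuousLinearMap.proj (R := ℝ)
      (φ := fun _ : CoordIndex ψ.n ψ.m => Grassmann k₀) j)).comp (ContinuousLinearMap.fst ℝ _ _))).prod
  ((fibOfValues ψ k₀).restrictScalars ℝ)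

theorem phaseOfValues_fst (c : (CoordIndex ψ.n ψ.m → Grassmann k₀) × (Fin ψ.k → Grassmann k₀)) :
    (phaseOfValues ψ k₀ c).1 = ofCoordinates _ _ fun j => Grassmann.aug k₀ (c.1 j) := rfl

theorem coeff_phaseOfValues (c : (CoordIndex ψ.n ψ.m → Grassmann k₀) × (Fin ψ.k → Grassmann k₀))
    (j : CoordIndex ψ.n ψ.m) :
    PhaseFib.coeff ψ.k k₀ j (phaseOfValues ψ k₀ c).2 = Grassmann.evenNilProj k₀ (c.1 j) := rfl

theorem odd_phaseOfValues (c : (CoordIndex ψ.n ψ.m → Grassmann k₀) × (Fin ψ.k → Grassmann k₀))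
    (l : Fin ψ.k) :
    PhaseFib.odd _ ψ.k k₀ (phaseOfValues ψ k₀ c).2 l = Grassmann.oddProj k₀ (c.2 l) := rfl

variable (ψ) in
/-- The values of the coordinates. -/
def values (A : LPoint M k₀) : (CoordIndex ψ.n ψ.m → Grassmann k₀) × (Fin ψ.k → Grassmann k₀) :=
  (fun j => A.app ψ.range (ψ.coordinateSection j), fun l => A.app ψ.range (ψ.oddSection l))

variable (ψ) in
/-- The coordinates of a Grassmann algebra valued point. -/
def coords (A : LPoint M k₀) : ψ.PhaseSpace k₀ := phaseOfValues ψ k₀ (ψ.values A)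

theorem coords_fst {A : LPoint M k₀} (hp : p ∈ ψ.domain) (hA : A.pt = ψ.hom.base ⟨p, hp⟩) :
    (ψ.coords A).1 = p := by
  rw [coords, phaseOfValues_fst]
  conv_rhs => rw [← ofCoordinates_coordinate p]
  congr 1
  funext j
  change Grassmann.aug k₀ (A.app _ _) = _
  rw [aug_app (mem_preimage_range hp) hA, expr_coordinateSection j hp, AlgHom.commutes]
  rfl

theorem coords_fst_mem {A : LPoint M k₀} (hA : A.pt ∈ ψ.range) :
    ∃ h : (ψ.coords A).1 ∈ ψ.domain, A.pt = ψ.hom.base ⟨(ψ.coords A).1, h⟩ := by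
  obtain ⟨p, hp⟩ := hA
  have h1 := coords_fst p.2 hp.symm
  exact ⟨h1 ▸ p.2, by simp only [h1]; exact hp.symm⟩

variable (ψ) in
/-- Evaluation at the Grassmann algebra valued point with given coordinates. -/
def lpointOf (y : ψ.PhaseSpace k₀) (hy : y.1 ∈ ψ.domain) : LPoint M k₀ where
  pt := ψ.hom.base ⟨y.1, hy⟩
  eval U h :=
    have hU : y.1 ∈ ψ.preimage U := ψ.mem_preimage.2 ⟨hy, h⟩
    have hconst : ∀ c : ℂ, taylor direction (ψ.expr U (algebraMap ℂ _ c)) y = algebraMap ℂ (Grassmann k₀) c :=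
      fun c => by
        rw [(taylor_congr (expr_algebraMap c hU)).self_of_nhds, taylor_const, AlgHom.commutes]
    { toFun := fun f => taylor direction (ψ.expr U f) y
      map_one' := by simpa using hconst 1
      map_mul' := fun f g => by
        rw [expr_mul, taylor_mul modelJ_cube (mixNear_expr f hU) (mixNear_expr g hU)]
      map_zero' := by simpa using hconst 0
      map_add' := fun f g => by
        rw [expr_add, taylor_add modelJ_cube (mixNear_expr f hU) (mixNear_expr g hU)]
      commutes' := hconst }
  eval_res h hx f :=
    (taylor_congr (expr_res_eventuallyEq h f (ψ.mem_preimage.2 ⟨hy, hx⟩))).self_of_nhds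
  eval_parity hx i f hf := taylor_mem_parity i (Eventually.of_forall fun q => expr_parity hf q)

theorem lpointOf_app {y : ψ.PhaseSpace k₀} (hy : y.1 ∈ ψ.preimage U) (f : M.sections U) :
    (ψ.lpointOf y (mem_domain hy)).app U f = taylor direction (ψ.expr U f) y := by
  rw [LPoint.app_of_mem (A := ψ.lpointOf y (mem_domain hy)) (base_mem hy)]
  rfl

theorem taylor_coordinateSection {y : ψ.PhaseSpace k₀} (hy : y.1 ∈ ψ.domain) (j : CoordIndex ψ.n ψ.m) :
    taylor direction (ψ.expr ψ.range (ψ.coordinateSection j)) y =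
      algebraMap ℂ _ (coordinate j y.1) + PhaseFib.coeff ψ.k k₀ j y.2 := by
  have e : ψ.expr ψ.range (ψ.coordinateSection j) =ᶠ[𝓝 y.1] fun q => algebraMap ℂ _ (coordinate j q) := by
    filter_upwards [ψ.domain.isOpen.mem_nhds hy] with q hq using expr_coordinateSection j hq
  rw [(taylor_congr e).self_of_nhds, taylor_clm, Finset.sum_eq_single j]
  · rw [coordinate_direction, if_pos rfl, map_one, mul_one]
  · intro i _ hi
    rw [coordinate_direction, if_neg hi.symm, map_zero, mul_zero]
  · exact fun h => absurd (Finset.mem_univ j) h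

theorem taylor_oddSection {y : ψ.PhaseSpace k₀} (hy : y.1 ∈ ψ.domain) (l : Fin ψ.k) :
    taylor direction (ψ.expr ψ.range (ψ.oddSection l)) y = PhaseFib.odd _ ψ.k k₀ y.2 l := by
  have e : ψ.expr ψ.range (ψ.oddSection l) =ᶠ[𝓝 y.1] fun q => Grassmann.gen l := by
    filter_upwards [ψ.domain.isOpen.mem_nhds hy] with q hq using expr_oddSection l hq
  rw [(taylor_congr e).self_of_nhds, taylor_const, Grassmann.substOdd_gen]

/-- Every Grassmann algebra valued point is given by its coordinates. -/
theorem lpointOf_coords {A : LPoint M k₀} (hA : A.pt ∈ ψ.range) :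
    ψ.lpointOf (ψ.coords A) (coords_fst_mem hA).1 = A := by
  obtain ⟨h, hpt⟩ := coords_fst_mem hA
  have hR := mem_preimage_range h
  refine (lpoint_ext (ψ := ψ) hpt hA (fun j => ?_) fun l => ?_).symm
  · have h1 := aug_app hR hpt (ψ.coordinateSection j)
    rw [expr_coordinateSection j h, AlgHom.commutes] at h1
    have h2 := Grassmann.coe_evenNilProj (LPoint.app_parity (A := A) (coordinateSection_mem (ψ := ψ) j))
    rw [lpointOf_app hR, taylor_coordinateSection h]
    refine Eq.trans ?_ (congrArg (fun z => algebraMap ℂ _ (coordinate j (ψ.coords A).1) + z) h2.symm)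
    rw [h1]
    exact (add_sub_cancel _ _).symm
  · rw [lpointOf_app hR, taylor_oddSection h, coords, odd_phaseOfValues]
    exact (Grassmann.coe_oddProj (LPoint.app_parity (oddSection_mem l))).symm

theorem app_eq_taylor {A : LPoint M k₀} (hA : A.pt ∈ ψ.range) (hU : A.pt ∈ U) (f : M.sections U) :
    A.app U f = taylor direction (ψ.expr U f) (ψ.coords A) := by
  obtain ⟨h, hpt⟩ := coords_fst_mem hA
  rw [← lpointOf_app (ψ.mem_preimage.2 ⟨h, hpt ▸ hU⟩), lpointOf_coords hA]

end RingedSuperspace.Parametrization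

/-! ### Integral curves of Grassmann algebra valued points -/

/-- The curve `A` of Grassmann algebra valued points is an integral curve of the vector field `X`. -/
structure IsIntegral {M : RingedSuperspace.{u, v}} (X : EvenVectorField M) {k : ℕ} (A : ℝ → LPoint M k)
    (S : Set ℝ) : Prop where
  cont : ∀ t ∈ S, ContinuousAt (fun s => (A s).pt) t
  deriv : ∀ t ∈ S, ∀ U : Opens M, (A t).pt ∈ U → ∀ f : M.sections U,
    HasDerivAt (fun s => (A s).app U f) ((A t).app U (X.toFun U f)) t

section IsIntegral
variable {M : RingedSuperspace.{u, v}} {X : EvenVectorField M} {k k' : ℕ} {A B : ℝ → LPoint M k} {S S' : Set ℝ}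

theorem IsIntegral.mono (h : IsIntegral X A S) (hS : S' ⊆ S) : IsIntegral X A S' :=
  ⟨fun t ht => h.cont t (hS ht), fun t ht => h.deriv t (hS ht)⟩

theorem IsIntegral.of_eventuallyEq (h : ∀ t ∈ S, ∃ B : ℝ → LPoint M k, IsIntegral X B {t} ∧ A =ᶠ[𝓝 t] B) :
    IsIntegral X A S := by
  refine ⟨fun t ht => ?_, fun t ht U hU f => ?_⟩ <;> obtain ⟨B, hB, e⟩ := h t ht
  · exact (hB.cont t rfl).congr (e.mono fun s hs => by simp only [hs])
  · rw [e.self_of_nhds] at hU ⊢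
    exact (hB.deriv t rfl U hU f).congr_of_eventuallyEq (e.mono fun s hs => by simp only [hs])

theorem IsIntegral.map (h : IsIntegral X A S) (σ : Grassmann k →ₐ[ℂ] Grassmann k')
    (hσ : ∀ v, σ (ExteriorAlgebra.ι ℂ v) ∈ Grassmann.parity k' 1) :
    IsIntegral X (fun t => (A t).map σ hσ) S := by
  refine ⟨h.cont, fun t ht U hU f => ?_⟩
  simp only [LPoint.map_app]
  exact (((σ.toLinearMap.toContinuousLinearMap).restrictScalars ℝ).hasFDerivAt.comp_hasDerivAt t
    (h.deriv t ht U hU f))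

theorem IsIntegral.comp_add (h : IsIntegral X A S) (c : ℝ) :
    IsIntegral X (fun t => A (t + c)) ((fun t => t + c) ⁻¹' S) := by
  refine ⟨fun t ht => ?_, fun t ht U hU f => ?_⟩
  · exact ContinuousAt.comp (g := fun s => (A s).pt) (h.cont _ ht) (by fun_prop)
  · have := h.deriv (t + c) ht U hU f
    exact this.comp_add_const t c

end IsIntegral

namespace RingedSuperspace.Parametrization
variable {M : RingedSuperspace.{u, v}} {ψ : M.Parametrization} {U V : Opens M} {k₀ : ℕ} {X : EvenVectorField M}

variable (ψ X) in
/-- The vector field on the phase space induced by a vector field on `M`. -/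
def field (y : ψ.PhaseSpace k₀) : ψ.PhaseSpace k₀ :=
  phaseOfValues ψ k₀ (fun j => taylor direction (ψ.expr ψ.range (X.toFun _ (ψ.coordinateSection j))) y,
    fun l => taylor direction (ψ.expr ψ.range (X.toFun _ (ψ.oddSection l))) y)

variable (ψ X) in
/-- The real coordinates of the vector field are real. -/
def RealField : Prop := ∀ p ∈ ψ.domain, ∀ i,
  (Grassmann.aug ψ.k (ψ.expr ψ.range (X.toFun _ (ψ.coordinateSection (.inl i))) p)).im = 0

theorem mix_phaseOfValues {E : Type} [NormedAddCommGroup E] [NormedSpace ℝ E] {J : E →L[ℝ] E} {x : E}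
    {c : E → CoordIndex ψ.n ψ.m → Grassmann k₀} {e : E → Fin ψ.k → Grassmann k₀}
    (hc : ∀ j, Mix J (mulI _) (fun y => c y j) x) (he : ∀ l, Mix J (mulI _) (fun y => e y l) x)
    (hr : ∀ᶠ y in 𝓝 x, ∀ i, (Grassmann.aug k₀ (c y (.inl i))).im = 0) :
    Mix J (phaseJ _ ψ.k k₀ (modelJ ψ.n ψ.m)) (fun y => phaseOfValues ψ k₀ (c y, e y)) x := by
  refine Mix.prodMk (f := fun y => ofCoordinates ψ.n ψ.m fun j => Grassmann.aug k₀ (c y j))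
    (g := fun y => fibOfValues ψ k₀ (c y, e y)) ?_ ?_
  · exact mix_ofCoordinates (fun j => Mix.clm_comp_complex (Grassmann.augL k₀) (hc j)) hr
  · refine Mix.clm_comp_complex (fibOfValues ψ k₀) ?_
    exact Mix.prodMk (J' := mulI (CoordIndex ψ.n ψ.m → Grassmann k₀)) (J₁ := mulI (Fin ψ.k → Grassmann k₀))
      (Mix.pi hc) (Mix.pi he)

theorem mixNear_taylor_expr {y : ψ.PhaseSpace k₀} (hy : y.1 ∈ ψ.preimage U) (f : M.sections U) :
    MixNear (phaseJ _ ψ.k k₀ (modelJ ψ.n ψ.m)) (mulI _) (taylor direction (ψ.expr U f)) y :=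
  (mixNear_expr f hy).taylor modelJ_cube

/-- Only real parts of the first `n` coordinates enter the phase space, and taking real parts is not
holomorphic. Reality of the field makes these coordinates real to begin with. -/
theorem mixNear_field (hX : ψ.RealField X) {y : ψ.PhaseSpace k₀} (hy : y.1 ∈ ψ.domain) :
    MixNear (phaseJ _ ψ.k k₀ (modelJ ψ.n ψ.m)) (phaseJ _ ψ.k k₀ (modelJ ψ.n ψ.m)) (ψ.field X) y := by
  have ho : ∀ᶠ z : ψ.PhaseSpace k₀ in 𝓝 y, z.1 ∈ ψ.domain :=
    continuous_fst.continuousAt.eventually (ψ.domain.isOpen.mem_nhds hy)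
  filter_upwards [ho.eventually_nhds] with z hz
  refine mix_phaseOfValues (fun j => (mixNear_taylor_expr (mem_preimage_range hz.self_of_nhds) _).mix)
    (fun l => (mixNear_taylor_expr (mem_preimage_range hz.self_of_nhds) _).mix) ?_
  filter_upwards [hz] with z' hz' i
  rw [aug_taylor]
  exact hX _ hz' i

/-- The coordinates of an integral curve solve an ordinary differential equation. -/
theorem hasDerivAt_coords {A : ℝ → LPoint M k₀} {t : ℝ} (h : IsIntegral X A {t}) (hR : (A t).pt ∈ ψ.range) :
    HasDerivAt (fun s => ψ.coords (A s)) (ψ.field X (ψ.coords (A t))) t := by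
  have h1 : HasDerivAt (fun s => ψ.values (A s))
      (fun j => (A t).app ψ.range (X.toFun _ (ψ.coordinateSection j)),
        fun l => (A t).app ψ.range (X.toFun _ (ψ.oddSection l))) t :=
    HasDerivAt.prodMk (hasDerivAt_pi.2 fun j => h.deriv t rfl _ hR _)
      (hasDerivAt_pi.2 fun l => h.deriv t rfl _ hR _)
  have h2 := (phaseOfValues ψ k₀).hasFDerivAt.comp_hasDerivAt t h1
  simp only [app_eq_taylor hR hR] at h2
  exact h2

/-- As functions of `f`, both sides are derivations twisted by evaluation at the point `y`, so it
suffices to compare them on coordinates. There they agree because `phaseOfValues` loses nothing: the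
components of `X` have the right parities and its real components are real. -/
theorem fderiv_taylor_field (hX : ψ.RealField X) {y : ψ.PhaseSpace k₀} (hy : y.1 ∈ ψ.preimage U) (f : M.sections U) :
    fderiv ℝ (taylor direction (ψ.expr U f)) y (ψ.field X y) =
      taylor direction (ψ.expr U (X.toFun U f)) y := by
  have hd : y.1 ∈ ψ.domain := mem_domain hy
  have hdn : ∀ᶠ z : ψ.PhaseSpace k₀ in 𝓝 y, z.1 ∈ ψ.domain :=
    continuous_fst.continuousAt.eventually (ψ.domain.isOpen.mem_nhds hd)
  have hUn : ∀ {U : Opens M}, y.1 ∈ ψ.preimage U → ∀ᶠ z : ψ.PhaseSpace k₀ in 𝓝 y, z.1 ∈ ψ.preimage U := fun {U} hU =>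
    continuous_fst.continuousAt.eventually ((ψ.preimage U).isOpen.mem_nhds hU)
  set A := ψ.lpointOf y hd with hA
  have hpre : ∀ {U : Opens M}, A.pt ∈ U → y.1 ∈ ψ.preimage U := fun hU => ψ.mem_preimage.2 ⟨hd, hU⟩
  have hdiff : ∀ {U : Opens M}, A.pt ∈ U → ∀ f : M.sections U,
      DifferentiableAt ℝ (taylor direction (ψ.expr U f) : ψ.PhaseSpace k₀ → _) y := fun hU f =>
    (mixNear_taylor_expr (hpre hU) f).mix.differentiableAt
  have happ : ∀ {U : Opens M}, A.pt ∈ U → ∀ f : M.sections U, A.app U f = taylor direction (ψ.expr U f) y :=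
    fun hU f => lpointOf_app (hpre hU) f
  have key := twisted_derivation_eq_zero (ψ := ψ) (A := A) (B := A) hd rfl rfl
    (fun U f => fderiv ℝ (taylor direction (ψ.expr U f)) y (ψ.field X y) - A.app U (X.toFun U f))
    ?_ ?_ ?_ ?_ ?_ ?_ U (base_mem hy) f
  · rw [happ (base_mem hy), sub_eq_zero] at key
    exact key
  · intro U hU f g
    have e : (taylor direction (ψ.expr U (f + g)) : ψ.PhaseSpace k₀ → _) =ᶠ[𝓝 y]
        fun z => taylor direction (ψ.expr U f) z + taylor direction (ψ.expr U g) z := by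
      filter_upwards [hUn (hpre hU)] with z hz
      rw [expr_add, taylor_add modelJ_cube (mixNear_expr f hz) (mixNear_expr g hz)]
    rw [e.fderiv_eq, fderiv_fun_add (hdiff hU f) (hdiff hU g), map_add, map_add, add_apply]
    abel
  · intro U hU f g
    have e : (taylor direction (ψ.expr U (f * g)) : ψ.PhaseSpace k₀ → _) =ᶠ[𝓝 y]
        fun z => taylor direction (ψ.expr U f) z * taylor direction (ψ.expr U g) z := by
      filter_upwards [hUn (hpre hU)] with z hz
      rw [expr_mul, taylor_mul modelJ_cube (mixNear_expr f hz) (mixNear_expr g hz)]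
    rw [e.fderiv_eq, fderiv_fun_mul' (hdiff hU f) (hdiff hU g), X.leibniz, map_add, LPoint.app_mul,
      LPoint.app_mul, happ hU f, happ hU g]
    simp only [add_apply, ContinuousLinearMap.smul_apply, smul_eq_mul, MulOpposite.smul_eq_mul_unop,
      MulOpposite.unop_op]
    noncomm_ring
  · intro U V h hU f
    have e : (taylor direction (ψ.expr U (M.res h f)) : ψ.PhaseSpace k₀ → _) =ᶠ[𝓝 y]
        taylor direction (ψ.expr V f) := by
      filter_upwards [hUn (hpre hU)] with z hz
      exact (taylor_congr (expr_res_eventuallyEq h f hz)).self_of_nhds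
    simp only [e.fderiv_eq, X.map_res, LPoint.app_res h hU]
  · intro U hU c
    have e : (taylor direction (ψ.expr U (algebraMap ℂ _ c)) : ψ.PhaseSpace k₀ → _) =ᶠ[𝓝 y]
        fun _ => algebraMap ℂ _ c := by
      filter_upwards [hUn (hpre hU)] with z hz
      rw [(taylor_congr (expr_algebraMap c hz)).self_of_nhds, taylor_const, AlgHom.commutes]
    have h1 : X.toFun U (algebraMap ℂ _ c) = 0 := by
      have h2 := X.leibniz (1 : M.sections U) 1
      simp only [one_mul, mul_one, left_eq_add] at h2
      rw [Algebra.algebraMap_eq_smul_one, map_smul, h2, smul_zero]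
    simp [e.fderiv_eq, h1]
  · intro j
    let L : ψ.PhaseSpace k₀ →L[ℝ] Grassmann k₀ :=
      ((Algebra.linearMap ℂ (Grassmann k₀)).toContinuousLinearMap.restrictScalars ℝ).comp
        ((coordinate j).comp (ContinuousLinearMap.fst ℝ _ _)) + phaseCoeff j
    have e : (taylor direction (ψ.expr ψ.range (ψ.coordinateSection j)) : ψ.PhaseSpace k₀ → _) =ᶠ[𝓝 y] L := by
      filter_upwards [hdn] with z hz using taylor_coordinateSection hz j
    have hRA : A.pt ∈ ψ.range := base_mem (mem_preimage_range hd)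
    rw [e.fderiv_eq, L.fderiv, happ hRA]
    have h2 : taylor direction (ψ.expr ψ.range (X.toFun _ (ψ.coordinateSection j))) y ∈ Grassmann.parity k₀ 0 :=
      taylor_mem_parity 0 (Eventually.of_forall fun q => expr_parity (X.map_parity 0 _ (coordinateSection_mem j)) q)
    have h3 : coordinate j (ψ.field X y).1 = Grassmann.aug k₀
        (taylor direction (ψ.expr ψ.range (X.toFun _ (ψ.coordinateSection j))) y) := by
      rw [field, phaseOfValues_fst, coordinate_ofCoordinates]
      intro i
      rw [aug_taylor]
      exact hX _ hd i
    change algebraMap ℂ _ (coordinate j (ψ.field X y).1) + PhaseFib.coeff ψ.k k₀ j (ψ.field X y).2 - _ = 0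
    rw [h3, field, coeff_phaseOfValues, Grassmann.coe_evenNilProj h2, add_sub_cancel, sub_self]
  · intro l
    let L : ψ.PhaseSpace k₀ →L[ℝ] Grassmann k₀ :=
      (((Grassmann.parity k₀ 1).subtypeL.comp ((ContinuousLinearMap.proj (R := ℂ)
        (φ := fun _ : Fin ψ.k => Grassmann.parity k₀ 1) l).comp (PhaseFib.odd (CoordIndex ψ.n ψ.m) ψ.k k₀))).restrictScalars ℝ).comp
        (ContinuousLinearMap.snd ℝ _ _)
    have e : (taylor direction (ψ.expr ψ.range (ψ.oddSection l)) : ψ.PhaseSpace k₀ → _) =ᶠ[𝓝 y] L := by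
      filter_upwards [hdn] with z hz using taylor_oddSection hz l
    have hRA : A.pt ∈ ψ.range := base_mem (mem_preimage_range hd)
    rw [e.fderiv_eq, L.fderiv, happ hRA]
    have h2 : taylor direction (ψ.expr ψ.range (X.toFun _ (ψ.oddSection l))) y ∈ Grassmann.parity k₀ 1 :=
      taylor_mem_parity 1 (Eventually.of_forall fun q => expr_parity (X.map_parity 1 _ (oddSection_mem l)) q)
    change (PhaseFib.odd _ ψ.k k₀ (ψ.field X y).2 l : Grassmann k₀) - _ = 0
    rw [field, odd_phaseOfValues, Grassmann.coe_oddProj h2, sub_self]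

theorem continuousAt_pt {α : Type*} [TopologicalSpace α] {A : α → LPoint M k₀} {y : α → ψ.PhaseSpace k₀} {t : α}
    (hy : ContinuousAt y t) (hA : ∀ᶠ s in 𝓝 t, ∃ h, A s = ψ.lpointOf (y s) h) :
    ContinuousAt (fun s => (A s).pt) t := by
  obtain ⟨h, e⟩ := hA.self_of_nhds
  have hc : ContinuousAt (fun s => (y s).1) t := continuous_fst.continuousAt.comp hy
  rw [ContinuousAt, e]
  intro N hN
  have h2 : ψ.hom.base ⁻¹' N ∈ 𝓝 (⟨(y t).1, h⟩ : ψ.domain) := ψ.hom.base.continuous.continuousAt hN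
  obtain ⟨N', hN', hs⟩ := (mem_nhds_subtype (ψ.domain : Set (ModelSpace ψ.n ψ.m)) ⟨(y t).1, h⟩ _).1 h2
  change ∀ᶠ s in 𝓝 t, (A s).pt ∈ N
  filter_upwards [hc.eventually hN', hA] with s hs1 hs2
  obtain ⟨h', e'⟩ := hs2
  rw [e']
  exact hs (show (⟨(y s).1, h'⟩ : ψ.domain) ∈ Subtype.val ⁻¹' N' from hs1)

/-- Solutions of the ordinary differential equation in coordinates are integral curves. -/
theorem isIntegral_of_hasDerivAt (hX : ψ.RealField X) {A : ℝ → LPoint M k₀} {y : ℝ → ψ.PhaseSpace k₀} {S : Set ℝ}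
    (hA : ∀ t ∈ S, ∀ᶠ s in 𝓝 t, ∃ h, A s = ψ.lpointOf (y s) h)
    (hy : ∀ t ∈ S, HasDerivAt y (ψ.field X (y t)) t) : IsIntegral X A S := by
  refine ⟨fun t ht => continuousAt_pt (hy t ht).continuousAt (hA t ht), fun t ht U hU f => ?_⟩
  obtain ⟨h, e⟩ := (hA t ht).self_of_nhds
  have hU' : (y t).1 ∈ ψ.preimage U := ψ.mem_preimage.2 ⟨h, by rw [e] at hU; exact hU⟩
  have hc : ContinuousAt (fun s => (y s).1) t := continuous_fst.continuousAt.comp (hy t ht).continuousAt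
  have h1 := (mixNear_taylor_expr hU' f).mix.differentiableAt.hasFDerivAt.comp_hasDerivAt t (hy t ht)
  rw [fderiv_taylor_field hX hU', ← lpointOf_app hU', ← e] at h1
  refine h1.congr_of_eventuallyEq ?_
  filter_upwards [hc.eventually ((ψ.preimage U).isOpen.mem_nhds hU'), hA t ht] with s hs1 hs2
  obtain ⟨h', e'⟩ := hs2
  rw [e', Function.comp_apply, ← lpointOf_app hs1]

end RingedSuperspace.Parametrization

/-- Integral curves are determined by their initial values. -/
theorem IsIntegral.eqOn {M : MixedSupermanifold.{u, v}} {X : EvenVectorField M.toRingedSuperspace} {k : ℕ}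
    (hX : ∀ ψ : M.Parametrization, ψ.RealField X)
    {A B : ℝ → LPoint M.toRingedSuperspace k} {S : Set ℝ} (hS : IsOpen S) (hSc : IsPreconnected S)
    (hA : IsIntegral X A S) (hB : IsIntegral X B S) {t₀ : ℝ} (ht₀ : t₀ ∈ S) (h : A t₀ = B t₀) :
    Set.EqOn A B S := by
  have := M.t2
  -- The set of agreement is shown to be open and relatively closed in `S`. Openness is the
  -- uniqueness theorem in a chart, where the field is locally Lipschitz because it is smooth.
  let u : Set ℝ := {t | t ∈ S ∧ A t = B t}
  have hu : IsOpen u := by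
    rw [isOpen_iff_mem_nhds]
    rintro t ⟨ht, e⟩
    obtain ⟨ψ, hψ⟩ := M.locallyModel (A t).pt
    have hR : (A t).pt ∈ ψ.range := hψ
    have hd := (RingedSuperspace.Parametrization.coords_fst_mem hR).1
    have hw := (RingedSuperspace.Parametrization.mixNear_field (hX ψ) hd).mix.1
    obtain ⟨K, s, hs, hK⟩ := (hw.of_le (by simp : (1 : WithTop ℕ∞) ≤ ∞)).exists_lipschitzOnWith
    have hev : ∀ {A : ℝ → LPoint M.toRingedSuperspace k}, IsIntegral X A S → (A t).pt ∈ ψ.range →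
        ψ.coords (A t) ∈ interior s → ∀ᶠ r in 𝓝 t, HasDerivAt (fun r => ψ.coords (A r)) (ψ.field X (ψ.coords (A r))) r ∧
          ψ.coords (A r) ∈ s := by
      intro A hA hR hs'
      have h1 := RingedSuperspace.Parametrization.hasDerivAt_coords (hA.mono (Set.singleton_subset_iff.2 ht)) hR
      filter_upwards [hS.mem_nhds ht, (hA.cont t ht).eventually (ψ.range.isOpen.mem_nhds hR),
        h1.continuousAt.eventually (isOpen_interior.mem_nhds hs')] with r hr1 hr2 hr3
      exact ⟨RingedSuperspace.Parametrization.hasDerivAt_coords (hA.mono (Set.singleton_subset_iff.2 hr1)) hr2,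
        interior_subset hr3⟩
    have hsA : ψ.coords (A t) ∈ interior s := mem_interior_iff_mem_nhds.2 hs
    have hRB : (B t).pt ∈ ψ.range := e ▸ hR
    have h1 := ODE_solution_unique_of_eventually (v := fun _ => ψ.field X) (s := fun _ => s)
      (Eventually.of_forall fun _ => hK) (hev hA hR hsA) (hev hB hRB (e ▸ hsA)) (by simp only [e])
    filter_upwards [h1, hS.mem_nhds ht, (hA.cont t ht).eventually (ψ.range.isOpen.mem_nhds hR),
      (hB.cont t ht).eventually (ψ.range.isOpen.mem_nhds hRB)] with r hr1 hr2 hr3 hr4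
    refine ⟨hr2, ?_⟩
    rw [← RingedSuperspace.Parametrization.lpointOf_coords hr3, ← RingedSuperspace.Parametrization.lpointOf_coords hr4]
    congr 1
  -- For the base points the limit argument uses that `M` is Hausdorff; for the values of sections
  -- it uses continuity of both curves in the Grassmann algebra.
  have hcl : closure u ∩ S ⊆ u := by
    rintro t ⟨htu, ht⟩
    rw [mem_closure_iff_frequently] at htu
    refine ⟨ht, ?_⟩
    have hpt : (A t).pt = (B t).pt := by
      by_contra hne
      obtain ⟨N, N', hN, hN', hA1, hB1, hd⟩ := t2_separation hne
      obtain ⟨s, hs, h1, h2⟩ := (htu.and_eventually (((hA.cont t ht).eventually (hN.mem_nhds hA1)).and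
        ((hB.cont t ht).eventually (hN'.mem_nhds hB1)))).exists
      rw [← hs.2] at h2
      exact Set.disjoint_left.1 hd h1 h2
    refine LPoint.ext_of_app hpt fun U hU f => ?_
    by_contra hne
    have h1 := (hA.deriv t ht U hU f).continuousAt
    have h2 := (hB.deriv t ht U (hpt ▸ hU) f).continuousAt
    obtain ⟨s, hs, h3⟩ := (htu.and_eventually ((h1.sub h2).eventually_ne (sub_ne_zero.2 hne))).exists
    exact h3 (by simp only [Pi.sub_apply, hs.2, sub_self])
  have := hSc.subset_of_closure_inter_subset hu ⟨t₀, ht₀, ht₀, h⟩ hcl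
  exact fun t ht => (this ht).2

/-! ### Families of Grassmann algebra valued points -/

/-- The family `C` of Grassmann algebra valued points is mixed holomorphic at `p`. -/
structure MixFam {M : RingedSuperspace.{u, v}} {k : ℕ} {E : Type} [NormedAddCommGroup E] [NormedSpace ℝ E]
    (J : E →L[ℝ] E) (C : E → LPoint M k) (p : E) : Prop where
  cont : ContinuousAt (fun q => (C q).pt) p
  mix : ∀ U : Opens M, (C p).pt ∈ U → ∀ f : M.sections U, Mix J (mulI _) (fun q => (C q).app U f) p

section MixFam
variable {M : RingedSuperspace.{u, v}} {k k' : ℕ} {E E' : Type} [NormedAddCommGroup E] [NormedSpace ℝ E]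
  [NormedAddCommGroup E'] [NormedSpace ℝ E'] {J : E →L[ℝ] E} {J' : E' →L[ℝ] E'} {C D : E → LPoint M k} {p : E}

theorem MixFam.congr (h : MixFam J C p) (e : D =ᶠ[𝓝 p] C) : MixFam J D p := by
  refine ⟨h.cont.congr (e.mono fun q hq => by simp only [hq]), fun U hU f => ?_⟩
  rw [e.self_of_nhds] at hU
  exact (h.mix U hU f).congr (e.mono fun q hq => by simp only [hq])

theorem MixFam.map (h : MixFam J C p) (σ : Grassmann k →ₐ[ℂ] Grassmann k')
    (hσ : ∀ v, σ (ExteriorAlgebra.ι ℂ v) ∈ Grassmann.parity k' 1) : MixFam J (fun q => (C q).map σ hσ) p := by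
  refine ⟨h.cont, fun U hU f => ?_⟩
  simp only [LPoint.map_app]
  exact Mix.clm_comp_complex σ.toLinearMap.toContinuousLinearMap (h.mix U hU f)

theorem MixFam.comp (hJ' : ∀ u, J' (J' (J' u)) = -J' u) {g : E' → E} {q : E'} (h : MixFam J C (g q))
    (hg : Mix J' J g q) : MixFam J' (fun q => C (g q)) q :=
  ⟨ContinuousAt.comp (g := fun q => (C q).pt) h.cont hg.1.continuousAt,
    fun U hU f => Mix.comp hJ' (h.mix U hU f) hg⟩

theorem MixFam.const (A : LPoint M k) : MixFam J (fun _ => A) p := ⟨continuousAt_const, fun _ _ _ => Mix.const _⟩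

end MixFam

/-- The partial complex structure on `ℝ × E`. -/
def timeJ {E : Type} [NormedAddCommGroup E] [NormedSpace ℝ E] (J : E →L[ℝ] E) : ℝ × E →L[ℝ] ℝ × E :=
  (0 : ℝ →L[ℝ] ℝ).prodMap J

theorem timeJ_cube {E : Type} [NormedAddCommGroup E] [NormedSpace ℝ E] {J : E →L[ℝ] E}
    (hJ : ∀ u, J (J (J u)) = -J u) (u : ℝ × E) : timeJ J (timeJ J (timeJ J u)) = -timeJ J u :=
  Prod.ext (by simp [timeJ]) (hJ _)

theorem mix_slice {E : Type} [NormedAddCommGroup E] [NormedSpace ℝ E] {J : E →L[ℝ] E} (t : ℝ) (p : E) :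
    Mix J (timeJ J) (fun q => (t, q)) p :=
  Mix.prodMk (Mix.const t) (Mix.of_clm (ContinuousLinearMap.id ℝ E) fun _ => rfl)

namespace RingedSuperspace.Parametrization
variable {M : RingedSuperspace.{u, v}} {ψ : M.Parametrization} {U V : Opens M} {k₀ : ℕ} {X : EvenVectorField M}
  {E : Type} [NormedAddCommGroup E] [NormedSpace ℝ E] {J : E →L[ℝ] E} {C : E → LPoint M k₀} {p : E}

theorem mixFam_of_lpointOf (hJ : ∀ u, J (J (J u)) = -J u) {y : E → ψ.PhaseSpace k₀}
    (hy : Mix J (phaseJ _ ψ.k k₀ (modelJ _ _)) y p)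
    (hC : ∀ᶠ q in 𝓝 p, ∃ h, C q = ψ.lpointOf (y q) h) : MixFam J C p := by
  refine ⟨continuousAt_pt hy.1.continuousAt hC, fun U hU f => ?_⟩
  obtain ⟨h, e⟩ := hC.self_of_nhds
  have hU' : (y p).1 ∈ ψ.preimage U := ψ.mem_preimage.2 ⟨h, by rw [e] at hU; exact hU⟩
  have hc : ContinuousAt (fun q => (y q).1) p := continuous_fst.continuousAt.comp hy.1.continuousAt
  refine (Mix.comp hJ (mixNear_taylor_expr hU' f).mix hy).congr ?_
  filter_upwards [hc.eventually ((ψ.preimage U).isOpen.mem_nhds hU'), hC] with q hq1 hq2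
  obtain ⟨h', e'⟩ := hq2
  rw [e', ← lpointOf_app hq1]

theorem mix_coords (hC : MixFam J C p) (hR : (C p).pt ∈ ψ.range) :
    Mix J (phaseJ _ ψ.k k₀ (modelJ _ _)) (fun q => ψ.coords (C q)) p := by
  refine mix_phaseOfValues (fun j => hC.mix _ hR _) (fun l => hC.mix _ hR _) ?_
  filter_upwards [hC.cont.eventually (ψ.range.isOpen.mem_nhds hR)] with q hq i
  obtain ⟨h, hpt⟩ := coords_fst_mem hq
  rw [aug_app (mem_preimage_range h) hpt, expr_coordinateSection _ h, AlgHom.commutes]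
  exact Complex.ofReal_im _

/-- Scaling by zero leaves only constant terms, so it kills the nilpotent and odd coordinates and
keeps the base point. The coordinates depend continuously on `ρ`. -/
theorem tendsto_coords_scale {A : LPoint M k₀} (hR : A.pt ∈ ψ.range) :
    Tendsto (fun ρ : ℝ => ψ.coords (A.map (Grassmann.scale k₀ ρ) (Grassmann.scale_ι_mem ρ))) (𝓝 0)
      (𝓝 ((ψ.coords A).1, 0)) := by
  have hc : Continuous fun ρ : ℝ => ψ.coords (A.map (Grassmann.scale k₀ ρ) (Grassmann.scale_ι_mem ρ)) := by
    refine (phaseOfValues ψ k₀).continuous.comp (Continuous.prodMk (continuous_pi fun j => ?_) (continuous_pi fun l => ?_))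
    · simp only [LPoint.map_app]; exact Grassmann.continuous_scale _
    · simp only [LPoint.map_app]; exact Grassmann.continuous_scale _
  have h0 : ψ.coords (A.map (Grassmann.scale k₀ 0) (Grassmann.scale_ι_mem 0)) = ((ψ.coords A).1, 0) := by
    obtain ⟨h, hpt⟩ := coords_fst_mem hR
    refine Prod.ext (coords_fst h hpt) (PhaseFib.ext ?_ ?_)
    · funext j
      refine Subtype.ext ?_
      change (Grassmann.evenNilProj k₀ ((A.map _ _).app _ _) : Grassmann k₀) = 0
      rw [LPoint.map_app, Grassmann.scale_zero, Grassmann.coe_evenNilProj (Grassmann.algebraMap_mem_even _),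
        AlgHom.commutes]
      exact sub_self _
    · funext l
      change Grassmann.oddProj k₀ ((A.map _ _).app _ _) = 0
      rw [LPoint.map_app, Grassmann.scale_zero, Grassmann.aug_odd (LPoint.app_parity (oddSection_mem l)), map_zero,
        map_zero]
  rw [← h0]
  exact hc.tendsto 0

open Classical in
/-- Local existence of families of integral curves, with a uniform time of existence. -/
theorem exists_local_family (hX : ψ.RealField X) {x : M} (hx : x ∈ ψ.range) :
    ∃ (ε : ℝ) (O : Opens M), 0 < ε ∧ x ∈ O ∧ ∀ {E : Type} [NormedAddCommGroup E] [NormedSpace ℝ E]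
      {J : E →L[ℝ] E} {C : E → LPoint M k₀} {p₀ : E}, (∀ u, J (J (J u)) = -J u) →
      (∀ᶠ p in 𝓝 p₀, MixFam J C p) → (C p₀).pt ∈ O →
      ∃ B : ℝ → E → LPoint M k₀, ∀ᶠ p in 𝓝 p₀, B 0 p = C p ∧ ∀ t, |t| < ε →
        MixFam (timeJ J) (fun q : ℝ × E => B q.1 q.2) (t, p) ∧ IsIntegral X (fun s => B s p) {t} := by
  obtain ⟨q₀, rfl⟩ := hx
  let a : ModelSpace ψ.n ψ.m := q₀.1
  set y₀ : ψ.PhaseSpace k₀ := (a, 0) with hy₀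
  have : FiniteDimensional ℝ (PhaseFib (CoordIndex ψ.n ψ.m) ψ.k k₀) := FiniteDimensional.complexToReal _
  have : FiniteDimensional ℝ (ψ.PhaseSpace k₀) := inferInstance
  have : CompleteSpace (ψ.PhaseSpace k₀) := FiniteDimensional.complete ℝ _
  have hdn : {y : ψ.PhaseSpace k₀ | y.1 ∈ ψ.domain} ∈ 𝓝 y₀ :=
    continuous_fst.continuousAt (ψ.domain.isOpen.mem_nhds q₀.2)
  obtain ⟨φ, r, hr, hφ⟩ := exists_flow (phaseJ_cube modelJ_cube) (mixNear_field hX (y := y₀) q₀.2) hdn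
  let coe : ψ.domain → ModelSpace ψ.n ψ.m := fun q => q.1
  have hcoe : Continuous coe := continuous_subtype_val
  let O : Opens M := ⟨ψ.hom.base '' {q | coe q ∈ Metric.ball a r},
    ψ.isOpenImmersion.1.isOpenMap _ (Metric.isOpen_ball.preimage hcoe)⟩
  refine ⟨r, O, hr, ⟨q₀, Metric.mem_ball_self hr, rfl⟩, ?_⟩
  intro E _ _ J C p₀ hJ hC hO
  have hO' : (C p₀).pt ∈ ψ.range ∧ dist (ψ.coords (C p₀)).1 a < r := by
    obtain ⟨q, hq, hq'⟩ := hO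
    exact ⟨⟨q, hq'⟩, by rw [coords_fst q.2 hq'.symm]; exact hq⟩
  obtain ⟨hR, hdist⟩ := hO'
  -- The flow `φ` is available only near points without nilpotent part, while the nilpotent
  -- coordinates of `C p₀` may be large. A small `ρ ≠ 0` brings the scaled point into the ball, and
  -- the result is scaled back by `ρ⁻¹` afterwards. Since integral curves are preserved by
  -- homomorphisms of the Grassmann algebra, `r` does not depend on the nilpotent part.
  obtain ⟨ρ, hρ, hρ0⟩ : ∃ ρ : ℝ, dist (ψ.coords ((C p₀).map (Grassmann.scale k₀ ρ) (Grassmann.scale_ι_mem ρ))) y₀ < r ∧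
      ρ ≠ 0 := by
    have h1 := (tendsto_coords_scale hR).eventually (Metric.isOpen_ball.mem_nhds (x := ((ψ.coords (C p₀)).1, 0))
      (s := Metric.ball y₀ r) (by
        rw [Metric.mem_ball, Prod.dist_eq, dist_self]; exact max_lt hdist hr))
    exact ((h1.filter_mono nhdsWithin_le_nhds).and (self_mem_nhdsWithin (a := (0 : ℝ)) (s := {0}ᶜ))).exists
  let C' : E → LPoint M k₀ := fun p => (C p).map (Grassmann.scale k₀ ρ) (Grassmann.scale_ι_mem ρ)
  let y : E → ψ.PhaseSpace k₀ := fun p => ψ.coords (C' p)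
  have hgood : ∀ᶠ p in 𝓝 p₀, Mix J (phaseJ _ ψ.k k₀ (modelJ _ _)) y p ∧ (C p).pt ∈ ψ.range ∧ dist (y p) y₀ < r := by
    have h1 : ∀ᶠ p in 𝓝 p₀, (C p).pt ∈ ψ.range :=
      hC.self_of_nhds.cont.eventually (ψ.range.isOpen.mem_nhds hR)
    have h2 : ∀ {p}, MixFam J C p → (C p).pt ∈ ψ.range → Mix J (phaseJ _ ψ.k k₀ (modelJ _ _)) y p :=
      fun hp hp' => mix_coords (hp.map _ _) hp'
    have h3 : ∀ᶠ p in 𝓝 p₀, dist (y p) y₀ < r :=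
      (h2 hC.self_of_nhds hR).1.continuousAt.eventually (Metric.isOpen_ball.mem_nhds hρ)
    filter_upwards [hC, h1, h3] with p hp1 hp2 hp3 using ⟨h2 hp1 hp2, hp2, hp3⟩
  -- The default value is irrelevant, as for `|t| < r` and parameters near `p₀` the flow stays in
  -- the chart.
  let B' : ℝ → E → LPoint M k₀ := fun t p =>
    if h : (φ (t, y p)).1 ∈ ψ.domain then ψ.lpointOf (φ (t, y p)) h else C' p
  refine ⟨fun t p => (B' t p).map (Grassmann.scale k₀ ρ⁻¹) (Grassmann.scale_ι_mem ρ⁻¹), ?_⟩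
  have hB' : ∀ {t p}, |t| < r → dist (y p) y₀ < r → ∃ h, B' t p = ψ.lpointOf (φ (t, y p)) h := fun {t p} ht hp =>
    ⟨(hφ t _ ht hp).2.1, dif_pos (hφ t _ ht hp).2.1⟩
  filter_upwards [hgood.eventually_nhds] with p hp
  have hp0 := hp.self_of_nhds
  refine ⟨?_, fun t ht => ⟨MixFam.map (C := fun q : ℝ × E => B' q.1 q.2) ?_ _ _, IsIntegral.map ?_ _ _⟩⟩
  · obtain ⟨h, e⟩ := hB' (t := 0) (by simpa using hr) hp0.2.2
    have h1 : B' 0 p = C' p := by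
      rw [e, ← lpointOf_coords (A := C' p) hp0.2.1]
      congr 1
      exact (hφ 0 _ (by simpa using hr) hp0.2.2).2.2.2
    refine LPoint.ext_of_app (by rw [LPoint.map_pt, h1]; rfl) fun U hU f => ?_
    rw [LPoint.map_app, h1, LPoint.map_app, Grassmann.scale_inv_scale hρ0]
  · refine mixFam_of_lpointOf (timeJ_cube hJ) (y := fun q : ℝ × E => φ (q.1, y q.2)) ?_ ?_
    · refine Mix.comp (timeJ_cube hJ) (g := φ) (f := fun q : ℝ × E => (q.1, y q.2)) (hφ t _ ht hp0.2.2).1 ?_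
      refine Mix.prodMk (Mix.of_clm (ContinuousLinearMap.fst ℝ ℝ E) fun u => rfl) ?_
      exact Mix.comp (timeJ_cube hJ) (g := y) (f := fun q : ℝ × E => q.2) hp0.1
        (Mix.of_clm (ContinuousLinearMap.snd ℝ ℝ E) fun u => rfl)
    · have h1 : ∀ᶠ q : ℝ × E in 𝓝 (t, p), |q.1| < r :=
        (continuous_fst.abs.continuousAt (x := (t, p))).eventually (isOpen_Iio.mem_nhds ht)
      have h2 : ∀ᶠ q : ℝ × E in 𝓝 (t, p), dist (y q.2) y₀ < r :=
        (continuous_snd.continuousAt (x := (t, p))).eventually (hp.mono fun q hq => hq.2.2)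
      filter_upwards [h1, h2] with q hq1 hq2 using hB' hq1 hq2
  · refine isIntegral_of_hasDerivAt hX (y := fun s => φ (s, y p)) ?_ ?_
    · rintro _ rfl
      filter_upwards [continuous_abs.continuousAt.eventually (isOpen_Iio.mem_nhds ht)] with s hs using hB' hs hp0.2.2
    · rintro _ rfl
      exact (hφ _ _ ht hp0.2.2).2.2.1

end RingedSuperspace.Parametrization

/-! ### Global families of integral curves -/

theorem IsIntegral.of_singleton {M : RingedSuperspace.{u, v}} {X : EvenVectorField M} {k : ℕ} {A : ℝ → LPoint M k}
    {S : Set ℝ} (h : ∀ t ∈ S, IsIntegral X A {t}) : IsIntegral X A S :=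
  ⟨fun t ht => (h t ht).cont t rfl, fun t ht => (h t ht).deriv t rfl⟩

section Global
variable {M : MixedSupermanifold.{u, v}} {X : EvenVectorField M.toRingedSuperspace} {k k' : ℕ}
  {A B : ℝ → LPoint M.toRingedSuperspace k} {S I : Set ℝ} {E : Type} [NormedAddCommGroup E] [NormedSpace ℝ E]
  {J : E →L[ℝ] E} {C : E → LPoint M.toRingedSuperspace k} {p₀ : E} {T t : ℝ}
  {A₀ A₁ A₁' : LPoint M.toRingedSuperspace k}

theorem LPoint.ofPoint_pt_app (A : LPoint M.toRingedSuperspace k) (U : Opens M.carrier) (f : M.sections U) :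
    (LPoint.ofPoint k' A.pt).app U f = algebraMap ℂ _ (Grassmann.aug k (A.app U f)) := by
  by_cases h : A.pt ∈ U
  · rw [ofPoint_app h, aug_app h]
  · rw [app_of_notMem h, app_of_notMem (A := LPoint.ofPoint k' A.pt) h, map_zero, map_zero]

theorem IsIntegral.ofPoint (h : IsIntegral X A S) : IsIntegral X (fun t => LPoint.ofPoint k' (A t).pt) S := by
  refine ⟨h.cont, fun t ht U hU f => ?_⟩
  simp only [LPoint.ofPoint_pt_app]
  exact ((((Algebra.linearMap ℂ (Grassmann k')).toContinuousLinearMap.comp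
    (Grassmann.augL k)).restrictScalars ℝ).hasFDerivAt.comp_hasDerivAt t (h.deriv t ht U hU f))

/-- The base curves of integral curves are determined by their initial values. -/
theorem IsIntegral.pt_eq (hX : ∀ ψ : M.Parametrization, ψ.RealField X) {B : ℝ → LPoint M.toRingedSuperspace k'}
    (hS : IsOpen S) (hSc : IsPreconnected S) (hA : IsIntegral X A S) (hB : IsIntegral X B S) {t₀ : ℝ} (ht₀ : t₀ ∈ S)
    (h : (A t₀).pt = (B t₀).pt) (ht : t ∈ S) : (A t).pt = (B t).pt :=
  congrArg LPoint.pt (IsIntegral.eqOn hX hS hSc (hA.ofPoint (k' := 0)) (hB.ofPoint (k' := 0)) ht₀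
    (by simp only [h]) ht)

theorem isPreconnected_inter_real {S S' : Set ℝ} (h : IsPreconnected S) (h' : IsPreconnected S') :
    IsPreconnected (S ∩ S') :=
  (h.ordConnected.inter h'.ordConnected).isPreconnected

variable (X) in
/-- `B` is a family of integral curves with initial values `C`, over the times in `K` and near `p₀`. -/
def IsFamily (J : E →L[ℝ] E) (C : E → LPoint M.toRingedSuperspace k) (p₀ : E) (K : Set ℝ)
    (B : ℝ → E → LPoint M.toRingedSuperspace k) : Prop :=
  ∀ᶠ p in 𝓝 p₀, B 0 p = C p ∧ ∀ t ∈ K, MixFam (timeJ J) (fun q : ℝ × E => B q.1 q.2) (t, p) ∧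
    IsIntegral X (fun s => B s p) {t}

-- The family is continued beyond `T` by the curves that start at its values at `T`. On the overlap,
-- a connected set of times containing `T`, both pieces agree by uniqueness, so either description
-- may be used near a given time.
open Classical in
theorem IsFamily.extend (hX : ∀ ψ : M.Parametrization, ψ.RealField X) (hJ : ∀ u, J (J (J u)) = -J u)
    {ε : ℝ} (hε : 0 < ε) {B₁ B₂ : ℝ → E → LPoint M.toRingedSuperspace k} {K : Set ℝ}
    (hK : IsOpen K) (hKc : IsPreconnected K) (h0 : 0 ∈ K) (hT : T ∈ K) (h₁ : IsFamily X J C p₀ K B₁)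
    (h₂ : IsFamily X J (B₁ T) p₀ {t | |t| < ε} B₂) :
    ∃ B, IsFamily X J C p₀ (K ∪ Set.Ioo (T - ε) (T + ε)) B := by
  have hmem : ∀ {t}, t ∈ Set.Ioo (T - ε) (T + ε) ↔ |t - T| < ε := fun {t} => by
    rw [abs_lt, Set.mem_Ioo]; constructor <;> rintro ⟨_, _⟩ <;> constructor <;> linarith
  let B : ℝ → E → LPoint M.toRingedSuperspace k := fun t p => if t ∈ K then B₁ t p else B₂ (t - T) p
  have hB₁ : ∀ t ∈ K, ∀ p, B t p = B₁ t p := fun t ht p => if_pos ht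
  have hint : ∀ {p}, (∀ t ∈ {t : ℝ | |t| < ε}, IsIntegral X (fun s => B₂ s p) {t}) →
      IsIntegral X (fun s => B₂ (s - T) p) (Set.Ioo (T - ε) (T + ε)) := fun {p} h =>
    ((IsIntegral.of_singleton h).comp_add (-T)).mono fun t ht => by
      change |t + -T| < ε
      rw [← sub_eq_add_neg]; exact hmem.1 ht
  have hB₂ : ∀ᶠ p in 𝓝 p₀, ∀ t ∈ Set.Ioo (T - ε) (T + ε), B t p = B₂ (t - T) p := by
    filter_upwards [h₁, h₂] with p hp1 hp2 t ht
    by_cases hK' : t ∈ K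
    · rw [hB₁ t hK']
      refine IsIntegral.eqOn hX (hK.inter isOpen_Ioo) (isPreconnected_inter_real hKc isPreconnected_Ioo)
        ((IsIntegral.of_singleton fun t ht => (hp1.2 t ht).2).mono Set.inter_subset_left)
        ((hint fun t ht => (hp2.2 t ht).2).mono Set.inter_subset_right) (t₀ := T) ⟨hT, ?_⟩ ?_ ⟨hK', ht⟩
      · exact hmem.2 (by simpa using hε)
      · simp only [sub_self, hp2.1]
    · exact if_neg hK'
  refine ⟨B, ?_⟩
  filter_upwards [h₁, h₂, hB₂.eventually_nhds] with p hp1 hp2 hp3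
  refine ⟨(hB₁ 0 h0 p).trans hp1.1, ?_⟩
  rintro t (ht | ht)
  · have e : ∀ᶠ q : ℝ × E in 𝓝 (t, p), B q.1 q.2 = B₁ q.1 q.2 := by
      filter_upwards [continuous_fst.continuousAt.eventually (hK.mem_nhds ht)] with q hq using hB₁ _ hq _
    refine ⟨(hp1.2 t ht).1.congr e, IsIntegral.of_eventuallyEq ?_⟩
    rintro _ rfl
    refine ⟨_, (hp1.2 _ ht).2, ?_⟩
    filter_upwards [hK.mem_nhds ht] with s hs using hB₁ s hs p
  · have e : ∀ᶠ q : ℝ × E in 𝓝 (t, p), B q.1 q.2 = B₂ (q.1 - T) q.2 := by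
      filter_upwards [continuous_fst.continuousAt.eventually (isOpen_Ioo.mem_nhds ht),
        continuous_snd.continuousAt.eventually hp3] with q hq hq' using hq' _ hq
    constructor
    · have h1 := (hp2.2 (t - T) (hmem.1 ht)).1
      refine (MixFam.comp (timeJ_cube hJ) (g := fun q : ℝ × E => (q.1 - T, q.2)) (q := (t, p)) h1 ?_).congr e
      refine Mix.prodMk ?_ (Mix.of_clm (ContinuousLinearMap.snd ℝ ℝ E) fun u => rfl)
      refine ⟨(contDiff_fst.sub contDiff_const).contDiffAt, fun u => ?_⟩
      have : HasFDerivAt (fun q : ℝ × E => q.1 - T) (ContinuousLinearMap.fst ℝ ℝ E) (t, p) :=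
        hasFDerivAt_fst.sub_const T
      rw [this.fderiv]
      simp [timeJ]
    · refine IsIntegral.of_eventuallyEq ?_
      rintro _ rfl
      refine ⟨_, (hint fun t ht => (hp2.2 t ht).2).mono (Set.singleton_subset_iff.2 ht), ?_⟩
      filter_upwards [isOpen_Ioo.mem_nhds ht] with s hs using hp3.self_of_nhds s hs

/-- Families of integral curves exist as long as the integral curve through the base point exists. -/
theorem exists_family (hX : ∀ ψ : M.Parametrization, ψ.RealField X) (hI : IsOpen I) (hIc : IsPreconnected I)
    (h0 : 0 ∈ I) (hT : T ∈ I) {γ : ℝ → LPoint M.toRingedSuperspace k'} (hγ : IsIntegral X γ I)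
    (hJ : ∀ u, J (J (J u)) = -J u) (hC : ∀ᶠ p in 𝓝 p₀, MixFam J C p) (hpt : (C p₀).pt = (γ 0).pt) :
    ∃ K, IsOpen K ∧ IsPreconnected K ∧ 0 ∈ K ∧ T ∈ K ∧ ∃ B, IsFamily X J C p₀ K B := by
  -- Continuation: the times up to which a family exists form an open subset that is relatively
  -- closed in `I`. The neighbourhood of parameters may shrink with `T`.
  let u : Set ℝ := {T | ∃ K, IsOpen K ∧ IsPreconnected K ∧ 0 ∈ K ∧ T ∈ K ∧ ∃ B, IsFamily X J C p₀ K B}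
  have hu : IsOpen u := by
    rw [isOpen_iff_mem_nhds]
    rintro t ⟨K, hK, hKc, h0, ht, hB⟩
    filter_upwards [hK.mem_nhds ht] with s hs using ⟨K, hK, hKc, h0, hs, hB⟩
  have hball : ∀ ε : ℝ, {t : ℝ | |t| < ε} = Metric.ball 0 ε := fun ε => by
    ext t; simp
  have hu0 : (0 : ℝ) ∈ u := by
    obtain ⟨ψ, hψ⟩ := M.locallyModel (C p₀).pt
    obtain ⟨ε, O, hε, hO, H⟩ := RingedSuperspace.Parametrization.exists_local_family (k₀ := k) (hX ψ) (x := (C p₀).pt) hψ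
    obtain ⟨B, hB⟩ := H hJ hC hO
    refine ⟨{t | |t| < ε}, hball ε ▸ Metric.isOpen_ball, hball ε ▸ (convex_ball 0 ε).isPreconnected,
      by simpa using hε, by simpa using hε, B, hB⟩
  have hcl : closure u ∩ I ⊆ u := by
    rintro t ⟨htu, ht⟩
    obtain ⟨ψ, hψ⟩ := M.locallyModel (γ t).pt
    -- This `ε` serves every Grassmann valued point with base point in `O`. Restarting at a time `s`
    -- with `|t - s| < ε` therefore reaches `t`.
    obtain ⟨ε, O, hε, hO, H⟩ := RingedSuperspace.Parametrization.exists_local_family (k₀ := k) (hX ψ) (x := (γ t).pt) hψ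
    have hnear : ∀ᶠ s in 𝓝 t, |t - s| < ε := by
      have : Continuous fun s => |t - s| := by fun_prop
      exact (this.continuousAt (x := t)).eventually (isOpen_Iio.mem_nhds (by simpa using hε))
    obtain ⟨s, ⟨K, hK, hKc, hK0, hs, B, hB⟩, hsI, hsO, hst⟩ := ((mem_closure_iff_frequently.1 htu).and_eventually
      ((hI.eventually_mem ht).and (((hγ.cont t ht).eventually (O.isOpen.mem_nhds hO)).and hnear))).exists
    have hB0 := hB.self_of_nhds
    -- Whatever its nilpotent part, the curve through `p₀` has the same base curve as `γ`, so its
    -- point at time `s` lies over `O`.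
    have hpt' : (B s p₀).pt = (γ s).pt :=
      IsIntegral.pt_eq hX (hK.inter hI) (isPreconnected_inter_real hKc hIc) (A := fun s => B s p₀)
        ((IsIntegral.of_singleton fun t ht => (hB0.2 t ht).2).mono Set.inter_subset_left)
        (hγ.mono Set.inter_subset_right) ⟨hK0, h0⟩ (by rw [hB0.1, hpt]) ⟨hs, hsI⟩
    have hC' : ∀ᶠ p in 𝓝 p₀, MixFam J (B s) p := by
      filter_upwards [hB] with p hp
      exact MixFam.comp hJ (g := fun p => (s, p)) (hp.2 s hs).1 (mix_slice s p)
    obtain ⟨B₂, hB₂⟩ := H hJ hC' (by rw [hpt']; exact hsO)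
    obtain ⟨B', hB'⟩ := hB.extend hX hJ hε hK hKc hK0 hs hB₂
    refine ⟨_, hK.union isOpen_Ioo, hKc.union s hs ?_ isPreconnected_Ioo, Or.inl hK0, Or.inr ?_, B', hB'⟩
    · constructor <;> linarith
    · rw [abs_lt] at hst
      constructor <;> linarith [hst.1, hst.2]
  exact hIc.subset_of_closure_inter_subset hu ⟨0, h0, hu0⟩ hcl hT

/-! ### The flow of Grassmann algebra valued points -/

variable (X) in
/-- The integral curve starting at `A₀` reaches `A₁` at the time `t`. -/
def Reaches (A₀ : LPoint M.toRingedSuperspace k) (t : ℝ) (A₁ : LPoint M.toRingedSuperspace k) : Prop :=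
  ∃ K, IsOpen K ∧ IsPreconnected K ∧ 0 ∈ K ∧ t ∈ K ∧ ∃ A : ℝ → LPoint M.toRingedSuperspace k,
    IsIntegral X A K ∧ A 0 = A₀ ∧ A t = A₁

theorem Reaches.unique (hX : ∀ ψ : M.Parametrization, ψ.RealField X) (h : Reaches X A₀ t A₁)
    (h' : Reaches X A₀ t A₁') : A₁ = A₁' := by
  obtain ⟨K, hK, hKc, h0, ht, A, hA, rfl, rfl⟩ := h
  obtain ⟨K', hK', hKc', h0', ht', A', hA', e, rfl⟩ := h'
  exact IsIntegral.eqOn hX (hK.inter hK') (isPreconnected_inter_real hKc hKc') (hA.mono Set.inter_subset_left)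
    (hA'.mono Set.inter_subset_right) ⟨h0, h0'⟩ e.symm ⟨ht, ht'⟩

theorem Reaches.ofPoint (h : Reaches X A₀ t A₁) : Reaches X (LPoint.ofPoint k' A₀.pt) t (LPoint.ofPoint k' A₁.pt) := by
  obtain ⟨K, hK, hKc, h0, ht, A, hA, rfl, rfl⟩ := h
  exact ⟨K, hK, hKc, h0, ht, _, hA.ofPoint, rfl, rfl⟩

open Classical in
variable (X) in
/-- The flow of Grassmann algebra valued points. -/
def flowPt (A₀ : LPoint M.toRingedSuperspace k) (t : ℝ) : LPoint M.toRingedSuperspace k :=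
  if h : ∃ A₁, Reaches X A₀ t A₁ then h.choose else A₀

theorem Reaches.flowPt_eq (hX : ∀ ψ : M.Parametrization, ψ.RealField X) (h : Reaches X A₀ t A₁) :
    flowPt X A₀ t = A₁ := by
  have h' : ∃ A₁, Reaches X A₀ t A₁ := ⟨_, h⟩
  rw [flowPt, dif_pos h']
  exact h'.choose_spec.unique hX h

variable (X) in
/-- The times and points where the flow is defined. -/
def flowSet : Set (ℝ × M.carrier) := {q | ∃ A₁, Reaches X (LPoint.ofPoint 0 q.2) q.1 A₁}

theorem Reaches.mem_flowSet (h : Reaches X A₀ t A₁) : (t, A₀.pt) ∈ flowSet X := ⟨_, h.ofPoint⟩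

/-- The flow depends smoothly on the time and on parameters. -/
theorem eventually_flowPt (hX : ∀ ψ : M.Parametrization, ψ.RealField X) (hJ : ∀ u, J (J (J u)) = -J u)
    (hC : ∀ᶠ p in 𝓝 p₀, MixFam J C p) (h : (t, (C p₀).pt) ∈ flowSet X) :
    ∀ᶠ q : ℝ × E in 𝓝 (t, p₀), Reaches X (C q.2) q.1 (flowPt X (C q.2) q.1) ∧
      MixFam (timeJ J) (fun q => flowPt X (C q.2) q.1) q ∧ IsIntegral X (flowPt X (C q.2)) {q.1} := by
  obtain ⟨_, I, hI, hIc, h0, ht, γ, hγ, hγ0, -⟩ := h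
  obtain ⟨K, hK, hKc, hK0, hKt, B, hB⟩ := exists_family hX hI hIc h0 ht hγ hJ hC (by rw [hγ0]; rfl)
  have hev : ∀ᶠ q : ℝ × E in 𝓝 (t, p₀), q.1 ∈ K ∧ ∀ s ∈ K, Reaches X (C q.2) s (B s q.2) := by
    filter_upwards [continuous_fst.continuousAt.eventually (hK.mem_nhds hKt),
      continuous_snd.continuousAt.eventually hB] with q hq hq'
    exact ⟨hq, fun s hs => ⟨K, hK, hKc, hK0, hs, _, IsIntegral.of_singleton fun t ht => (hq'.2 t ht).2, hq'.1, rfl⟩⟩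
  filter_upwards [hev.eventually_nhds, continuous_snd.continuousAt.eventually hB] with q hq hq'
  have hq0 := hq.self_of_nhds
  have e := fun s hs => (hq0.2 s hs).flowPt_eq hX
  refine ⟨(e _ hq0.1).symm ▸ hq0.2 _ hq0.1, (hq'.2 _ hq0.1).1.congr ?_, IsIntegral.of_eventuallyEq ?_⟩
  · filter_upwards [hq] with r hr using (hr.2 _ hr.1).flowPt_eq hX
  · rintro _ rfl
    refine ⟨_, (hq'.2 _ hq0.1).2, ?_⟩
    filter_upwards [hK.mem_nhds hq0.1] with s hs using e s hs

/-- Membership in `flowSet` is tested on the point without nilpotent part. The theorem on families,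
applied to a constant family with a dummy parameter, transfers it to all Grassmann valued points
over the same base point. -/
theorem reaches_flowPt (hX : ∀ ψ : M.Parametrization, ψ.RealField X) (h : (t, A₀.pt) ∈ flowSet X) :
    Reaches X A₀ t (flowPt X A₀ t) :=
  (eventually_flowPt (E := ℝ) (J := 0) (C := fun _ => A₀) (p₀ := 0) hX (by simp)
    (Eventually.of_forall fun _ => MixFam.const A₀) h).self_of_nhds.1

theorem flowPt_zero (hX : ∀ ψ : M.Parametrization, ψ.RealField X) (h : (0, A₀.pt) ∈ flowSet X) :
    flowPt X A₀ 0 = A₀ := by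
  obtain ⟨K, -, -, -, -, A, -, h0, h1⟩ := reaches_flowPt hX h
  exact h1.symm.trans h0

theorem flowPt_pt (hX : ∀ ψ : M.Parametrization, ψ.RealField X) (h : (t, A₀.pt) ∈ flowSet X) :
    (flowPt X A₀ t).pt = (flowPt X (LPoint.ofPoint 0 A₀.pt) t).pt := by
  rw [((reaches_flowPt hX h).ofPoint (k' := 0)).flowPt_eq hX]; rfl

theorem zero_mem_flowSet (hX : ∀ ψ : M.Parametrization, ψ.RealField X) (x : M.carrier) : (0, x) ∈ flowSet X := by
  obtain ⟨ψ, hψ⟩ := M.locallyModel x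
  obtain ⟨ε, O, hε, hO, H⟩ := RingedSuperspace.Parametrization.exists_local_family (k₀ := 0) (hX ψ) (x := x) hψ
  obtain ⟨B, hB⟩ := H (E := ℝ) (J := 0) (C := fun _ => LPoint.ofPoint 0 x) (p₀ := 0) (by simp)
    (Eventually.of_forall fun _ => MixFam.const _) hO
  have h := hB.self_of_nhds
  exact ⟨_, Metric.ball 0 ε, Metric.isOpen_ball, (convex_ball 0 ε).isPreconnected, Metric.mem_ball_self hε,
    Metric.mem_ball_self hε, _, IsIntegral.of_singleton fun t ht => (h.2 t (by simpa using ht)).2, h.1, rfl⟩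

theorem isPreconnected_flowSet (x : M.carrier) : IsPreconnected {t | (t, x) ∈ flowSet X} := by
  refine isPreconnected_of_forall 0 fun t ht => ?_
  obtain ⟨A₁, K, hK, hKc, h0, htK, A, hA, e, -⟩ := ht
  exact ⟨K, fun s hs => ⟨_, K, hK, hKc, h0, hs, A, hA, e, rfl⟩, h0, htK, hKc⟩

end Global

/-! ### Sections are determined by their values at Grassmann algebra valued points -/

namespace RingedSuperspace.Parametrization
variable {M : RingedSuperspace.{u, v}} (ψ : M.Parametrization)

/-- The universal Grassmann algebra valued point over a point of a parametrization. -/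
def point (p : ModelSpace ψ.n ψ.m) (hp : p ∈ ψ.domain) : LPoint M ψ.k where
  pt := ψ.hom.base ⟨p, hp⟩
  eval U h := (Pi.evalAlgHom ℂ (fun _ : ψ.preimage U => Grassmann ψ.k) ⟨p, ψ.mem_preimage.2 ⟨hp, h⟩⟩).comp
    ((modelSections ψ.n ψ.m ψ.k (ψ.preimage U)).val.comp (ψ.pullback U))
  eval_res h hx f := by
    change (ψ.pullback _ (M.res h f)).1 _ = (ψ.pullback _ f).1 _
    rw [ψ.pullback_res]; rfl
  eval_parity hx i f hf := ψ.pullback_parity i hf _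

open Classical in
/-- The universal points, extended to all parameters by a constant family. -/
def pointD (a : ψ.domain) (p : ModelSpace ψ.n ψ.m) : LPoint M ψ.k :=
  if h : p ∈ ψ.domain then ψ.point p h else ψ.point a.1 a.2

variable {ψ} {U : Opens M} {p : ModelSpace ψ.n ψ.m} {a : ψ.domain}

theorem point_app (hp : p ∈ ψ.preimage U) (f : M.sections U) :
    (ψ.point p (mem_domain hp)).app U f = ψ.expr U f p := by
  rw [LPoint.app_of_mem (A := ψ.point p (mem_domain hp)) (base_mem hp), expr_eq _ hp]; rfl

theorem pointD_of_mem (hp : p ∈ ψ.domain) : ψ.pointD a p = ψ.point p hp := dif_pos hp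

theorem pointD_pt (hp : p ∈ ψ.domain) : (ψ.pointD a p).pt = ψ.hom.base ⟨p, hp⟩ := by
  rw [pointD_of_mem hp]; rfl

variable (ψ) in
/-- A parametrization of the product with the real line, on points. -/
def timeChart (q : ℝ × ψ.domain) : ℝ × M := (q.1, ψ.hom.base q.2)

theorem isOpenEmbedding_timeChart : IsOpenEmbedding ψ.timeChart :=
  IsOpenEmbedding.id.prodMap ψ.isOpenImmersion.1

theorem mixFam_pointD (hp : p ∈ ψ.domain) : MixFam (modelJ ψ.n ψ.m) (ψ.pointD a) p := by
  refine ⟨?_, fun U hU f => ?_⟩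
  · refine (ψ.domain.isOpen.isOpenEmbedding_subtypeVal.continuousAt_iff (x := (⟨p, hp⟩ : ψ.domain))
      (g := fun q : ModelSpace ψ.n ψ.m => (ψ.pointD a q).pt)).1 ?_
    have e : (fun q => (ψ.pointD a q).pt) ∘ (Subtype.val : ψ.domain → _) = ψ.hom.base := by
      funext q
      rw [Function.comp_apply, pointD_of_mem q.2]; rfl
    have hc : ContinuousAt ψ.hom.base (⟨p, hp⟩ : ψ.domain) := ψ.hom.base.continuous.continuousAt
    rw [← e] at hc
    exact hc
  · rw [pointD_of_mem hp] at hU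
    have hU' : p ∈ ψ.preimage U := ψ.mem_preimage.2 ⟨hp, hU⟩
    refine (mixNear_expr f hU').mix.congr ?_
    filter_upwards [(ψ.preimage U).isOpen.mem_nhds hU'] with q hq
    rw [pointD_of_mem (mem_domain hq), point_app hq]

end RingedSuperspace.Parametrization

open RingedSuperspace.Parametrization

namespace MixedSupermanifold
variable {M : MixedSupermanifold.{u, v}} {N : Opens M.carrier}

theorem exists_chart (x : M.carrier) : ∃ (ψ : M.Parametrization) (a : ψ.domain), ψ.hom.base a = x := M.locallyModel x

/-- The ranges of charts cover `N`; this is the uniqueness part of the gluing property. -/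
theorem section_ext {f g : M.sections N}
    (h : ∀ (ψ : M.Parametrization), ∀ p ∈ ψ.preimage N, ψ.expr N f p = ψ.expr N g p) : f = g := by
  choose ψ a hψ using exists_chart (M := M)
  have hψ : ∀ x, x ∈ (ψ x).range := fun x => ⟨a x, hψ x⟩
  have hle : ∀ x : N, N ⊓ (ψ x.1).range ≤ N := fun x => inf_le_left
  have hcov : N = ⨆ x : N, N ⊓ (ψ x.1).range :=
    le_antisymm (fun x hx => Opens.mem_iSup.2 (Exists.intro (⟨x, hx⟩ : N) (And.intro hx (hψ x)))) (iSup_le hle)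
  obtain ⟨_, -, hu⟩ := M.glue_cover (fun x : N => N ⊓ (ψ x.1).range) hcov hle
    (fun x => M.res (hle x) f) (fun i j P hi hj => by rw [M.res_res, M.res_res])
  rw [hu f fun _ => rfl, hu g fun x => ?_]
  refine eq_of_expr (ψ := ψ x.1) inf_le_right fun p hp => ?_
  rw [expr_res _ _ hp, expr_res _ _ hp, h _ _ ((ψ x.1).preimage_mono (hle x) hp)]

/-- The universal points of charts already determine a section, since evaluating there returns its
local expression. -/
theorem section_ext_of_app {f g : M.sections N}
    (h : ∀ (k : ℕ) (A : LPoint M.toRingedSuperspace k), A.pt ∈ N → A.app N f = A.app N g) : f = g :=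
  section_ext fun ψ p hp => by
    rw [← point_app hp, ← point_app hp]
    exact h _ _ (base_mem hp)

theorem mem_parity_of_app {i : ZMod 2} {f : M.sections N}
    (h : ∀ (k : ℕ) (A : LPoint M.toRingedSuperspace k), A.pt ∈ N → A.app N f ∈ Grassmann.parity k i) :
    f ∈ M.parity N i := by
  obtain ⟨c, d, hc, hd, rfl⟩ := Submodule.codisjoint_iff_exists_add_eq.1 (M.isCompl N).codisjoint f
  have key : ∀ (j j' : ZMod 2) (a b : M.sections N), a ∈ M.parity N j → b ∈ M.parity N j' →
      Disjoint (Grassmann.parity · j) (Grassmann.parity · j') →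
      (∀ (k : ℕ) (A : LPoint M.toRingedSuperspace k), A.pt ∈ N → A.app N (a + b) ∈ Grassmann.parity k j) → b = 0 := by
    intro j j' a b ha hb hdis h
    refine section_ext_of_app fun k A hA => ?_
    have h1 := h k A hA
    rw [map_add] at h1
    have h2 := (Submodule.add_mem_iff_right _ (LPoint.app_parity ha)).1 h1
    rw [map_zero]
    exact Submodule.disjoint_def.1 (Pi.disjoint_iff.1 hdis k) _ h2 (LPoint.app_parity hb)
  have hdis : Disjoint (Grassmann.parity · 0) (Grassmann.parity · 1) :=
    Pi.disjoint_iff.2 fun k => Grassmann.isCompl_parity.disjoint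
  rcases zmod_two_cases i with rfl | rfl
  · rw [key 0 1 c d hc hd hdis h, add_zero]; exact hc
  · rw [key 1 0 d c hd hc hdis.symm (by simpa only [add_comm] using h), zero_add]; exact hd

/-- Local sections with prescribed values at all Grassmann valued points agree on overlaps by
`section_ext_of_app`, and so they glue. -/
theorem exists_section {Φ : ∀ k, LPoint M.toRingedSuperspace k → Grassmann k}
    (H : ∀ x ∈ N, ∃ ψ : M.Parametrization, x ∈ ψ.range ∧ ∃ g : M.sections (N ⊓ ψ.range),
      ∀ (k : ℕ) (A : LPoint M.toRingedSuperspace k), A.pt ∈ N ⊓ ψ.range → A.app _ g = Φ k A) :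
    ∃ g : M.sections N, ∀ (k : ℕ) (A : LPoint M.toRingedSuperspace k), A.pt ∈ N → A.app N g = Φ k A := by
  choose ψ hψ g hg using fun x : N => H x.1 x.2
  have hle : ∀ x : N, N ⊓ (ψ x).range ≤ N := fun x => inf_le_left
  have hcov : N = ⨆ x : N, N ⊓ (ψ x).range :=
    le_antisymm (fun x hx => Opens.mem_iSup.2 (Exists.intro (⟨x, hx⟩ : N) (And.intro hx (hψ ⟨x, hx⟩)))) (iSup_le hle)
  obtain ⟨f, hf, -⟩ := M.glue_cover (fun x : N => N ⊓ (ψ x).range) hcov hle g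
    (fun i j P hi hj => section_ext_of_app fun k A hA => by
      rw [LPoint.app_res hi hA, LPoint.app_res hj hA, hg i k A (hi hA), hg j k A (hj hA)])
  refine ⟨f, fun k A hA => ?_⟩
  have hA' : A.pt ∈ N ⊓ (ψ ⟨A.pt, hA⟩).range := ⟨hA, hψ ⟨A.pt, hA⟩⟩
  rw [← hg _ k A hA', ← hf, LPoint.app_res _ hA']

end MixedSupermanifold

/-! ### Taylor expansion of families of points -/

section taylorPt
variable {M : RingedSuperspace.{u, v}} {n m k k₀ : ℕ} {U : Opens M}
  {C : ModelSpace n m → LPoint M k} {y : Phase (ModelSpace n m) (CoordIndex n m) k k₀}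

theorem eventually_pt_mem {p : ModelSpace n m} (hC : MixFam (modelJ n m) C p) (hU : (C p).pt ∈ U) :
    ∀ᶠ q in 𝓝 p, (C q).pt ∈ U := hC.cont.eventually (U.isOpen.mem_nhds hU)

theorem mixNear_app {p : ModelSpace n m} (hC : ∀ᶠ q in 𝓝 p, MixFam (modelJ n m) C q) (hU : (C p).pt ∈ U)
    (f : M.sections U) : MixNear (modelJ n m) (mulI _) (fun q => (C q).app U f) p := by
  filter_upwards [hC, eventually_pt_mem hC.self_of_nhds hU] with q hq hqU using hq.mix U hqU f

/-- The value of the family `C` at the Grassmann algebra valued point with coordinates `y`. -/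
def taylorPt (C : ModelSpace n m → LPoint M k) (y : Phase (ModelSpace n m) (CoordIndex n m) k k₀)
    (hC : ∀ᶠ q in 𝓝 y.1, MixFam (modelJ n m) C q) : LPoint M k₀ where
  pt := (C y.1).pt
  eval U h :=
    have hconst : ∀ c : ℂ, taylor direction (fun q => (C q).app U (algebraMap ℂ _ c)) y = algebraMap ℂ (Grassmann k₀) c :=
      fun c => by
        have e : (fun q => (C q).app U (algebraMap ℂ _ c)) =ᶠ[𝓝 y.1] fun _ => algebraMap ℂ _ c := by
          filter_upwards [eventually_pt_mem hC.self_of_nhds h] with q hq using LPoint.app_algebraMap hq c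
        rw [(taylor_congr e).self_of_nhds, taylor_const, AlgHom.commutes]
    { toFun := fun f => taylor direction (fun q => (C q).app U f) y
      map_one' := by simpa using hconst 1
      map_mul' := fun f g => by
        simp only [LPoint.app_mul]
        rw [taylor_mul modelJ_cube (mixNear_app hC h f) (mixNear_app hC h g)]
      map_zero' := by simpa using hconst 0
      map_add' := fun f g => by
        simp only [map_add]
        rw [taylor_add modelJ_cube (mixNear_app hC h f) (mixNear_app hC h g)]
      commutes' := hconst }
  eval_res {U V} h hx f := by
    refine (taylor_congr ?_).self_of_nhds
    filter_upwards [eventually_pt_mem hC.self_of_nhds hx] with q hq using LPoint.app_res h hq f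
  eval_parity hx i f hf := taylor_mem_parity i (Eventually.of_forall fun q => LPoint.app_parity hf)

theorem taylorPt_app (hC : ∀ᶠ q in 𝓝 y.1, MixFam (modelJ n m) C q) (hU : (C y.1).pt ∈ U) (f : M.sections U) :
    (taylorPt C y hC).app U f = taylor direction (fun q => (C q).app U f) y := by
  rw [LPoint.app_of_mem (A := taylorPt C y hC) hU]; rfl

end taylorPt

/-! ### The flow of universal points and the pullback of sections -/

section Flow
variable {M : MixedSupermanifold.{u, v}} {X : EvenVectorField M.toRingedSuperspace} {k : ℕ} {t : ℝ}
  {A : LPoint M.toRingedSuperspace k} {U N : Opens M.carrier}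

theorem eventually_flowPt_pointD (hX : ∀ ψ : M.Parametrization, ψ.RealField X) {ψ : M.Parametrization} {a : ψ.domain}
    {p : ModelSpace ψ.n ψ.m} (hp : p ∈ ψ.domain) (h : (t, ψ.hom.base ⟨p, hp⟩) ∈ flowSet X) :
    ∀ᶠ q : ℝ × ModelSpace ψ.n ψ.m in 𝓝 (t, p), Reaches X (ψ.pointD a q.2) q.1 (flowPt X (ψ.pointD a q.2) q.1) ∧
      MixFam (timeJ (modelJ _ _)) (fun q => flowPt X (ψ.pointD a q.2) q.1) q ∧
      IsIntegral X (flowPt X (ψ.pointD a q.2)) {q.1} := by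
  refine eventually_flowPt hX modelJ_cube ?_ (by rw [pointD_of_mem hp]; exact h)
  filter_upwards [ψ.domain.isOpen.mem_nhds hp] with q hq using mixFam_pointD hq

/-- The theorem on families, applied to the universal points of a chart, shows that all nearby pairs
of a time and a chart point are reached. The chart, multiplied by the line, is an open embedding and
carries this neighbourhood to `ℝ × M`. -/
theorem isOpen_flowSet (hX : ∀ ψ : M.Parametrization, ψ.RealField X) : IsOpen (flowSet X) := by
  rw [isOpen_iff_mem_nhds]
  rintro ⟨t, x⟩ h
  obtain ⟨ψ, a, rfl⟩ := M.exists_chart x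
  have h1 := eventually_flowPt_pointD hX (a := a) a.2 h
  have h2 : Tendsto (fun q : ℝ × ψ.domain => ((q.1, q.2.1) : ℝ × ModelSpace ψ.n ψ.m)) (𝓝 (t, a)) (𝓝 (t, a.1)) :=
    (continuous_fst.prodMk (continuous_subtype_val.comp continuous_snd)).tendsto (t, a)
  have h3 := (isOpenEmbedding_timeChart (ψ := ψ)).map_nhds_eq (t, a)
  change flowSet X ∈ 𝓝 (ψ.timeChart (t, a))
  rw [← h3]
  change ∀ᶠ q in 𝓝 (t, a), ψ.timeChart q ∈ flowSet X
  filter_upwards [h2.eventually h1] with q hq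
  have h4 := hq.1.mem_flowSet
  rw [pointD_pt q.2.2] at h4
  exact h4

theorem continuousAt_flowPt (hX : ∀ ψ : M.Parametrization, ψ.RealField X) {q : ℝ × M.carrier} (h : q ∈ flowSet X) :
    ContinuousAt (fun q : ℝ × M.carrier => (flowPt X (LPoint.ofPoint 0 q.2) q.1).pt) q := by
  obtain ⟨t, x⟩ := q
  obtain ⟨ψ, a, rfl⟩ := M.exists_chart x
  have h1 := eventually_flowPt_pointD hX (a := a) a.2 h
  have h2 : ContinuousAt (fun q : ℝ × ψ.domain => ((q.1, q.2.1) : ℝ × ModelSpace ψ.n ψ.m)) (t, a) :=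
    (continuous_fst.prodMk (continuous_subtype_val.comp continuous_snd)).continuousAt
  refine ((isOpenEmbedding_timeChart (ψ := ψ)).continuousAt_iff (x := (t, a))).1 ?_
  refine (ContinuousAt.comp (g := fun q : ℝ × ModelSpace ψ.n ψ.m => (flowPt X (ψ.pointD a q.2) q.1).pt)
    (x := (t, a)) h1.self_of_nhds.2.1.cont h2).congr ?_
  filter_upwards [h2.eventually h1] with q hq
  have h3 := flowPt_pt hX hq.1.mem_flowSet
  rw [pointD_pt q.2.2] at h3
  exact h3

open Classical in
/-- The flow of an arbitrary Grassmann algebra valued point is the Taylor expansion of the flow of the universal one. -/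
theorem flowPt_app_eq_taylor (hX : ∀ ψ : M.Parametrization, ψ.RealField X) {ψ : M.Parametrization} {a : ψ.domain}
    (hA : A.pt ∈ ψ.range) (ht : (t, A.pt) ∈ flowSet X) (hU : (flowPt X A t).pt ∈ U) (f : M.sections U) :
    (flowPt X A t).app U f = taylor direction (fun q => (flowPt X (ψ.pointD a q) t).app U f) (ψ.coords A) := by
  obtain ⟨hp, hpt⟩ := coords_fst_mem hA
  set y := ψ.coords A with hy
  let S : Set ℝ := {s | (s, A.pt) ∈ flowSet X}
  have hS : IsOpen S := (isOpen_flowSet hX).preimage (by fun_prop : Continuous fun s : ℝ => (s, A.pt))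
  have hev : ∀ s ∈ S, ∀ᶠ q : ℝ × ModelSpace ψ.n ψ.m in 𝓝 (s, y.1),
      Reaches X (ψ.pointD a q.2) q.1 (flowPt X (ψ.pointD a q.2) q.1) ∧
      MixFam (timeJ (modelJ _ _)) (fun q => flowPt X (ψ.pointD a q.2) q.1) q ∧
      IsIntegral X (flowPt X (ψ.pointD a q.2)) {q.1} := fun s hs =>
    eventually_flowPt_pointD hX hp (by rw [← hpt]; exact hs)
  have hmix : ∀ s ∈ S, ∀ᶠ q in 𝓝 y.1, MixFam (modelJ _ _) (fun q => flowPt X (ψ.pointD a q) s) q := fun s hs => by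
    have h1 : Tendsto (fun q : ModelSpace ψ.n ψ.m => (s, q)) (𝓝 y.1) (𝓝 (s, y.1)) :=
      (by fun_prop : Continuous fun q : ModelSpace ψ.n ψ.m => (s, q)).tendsto _
    filter_upwards [h1.eventually (hev s hs)] with q hq
    exact MixFam.comp modelJ_cube (g := fun q => (s, q)) hq.2.1 (mix_slice s q)
  -- The Taylor expansions form a curve of Grassmann valued points. It is shown to be an integral
  -- curve that starts at `A`, so it coincides with the flow of `A` by uniqueness. Outside `S` the
  -- value is arbitrary.
  let T : ℝ → LPoint M.toRingedSuperspace k := fun s =>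
    if hs : s ∈ S then taylorPt (fun q => flowPt X (ψ.pointD a q) s) y (hmix s hs) else A
  have hT : ∀ s (hs : s ∈ S), T s = taylorPt (fun q => flowPt X (ψ.pointD a q) s) y (hmix s hs) :=
    fun s hs => dif_pos hs
  have hTpt : ∀ s ∈ S, (T s).pt = (flowPt X (ψ.pointD a y.1) s).pt := fun s hs => by rw [hT s hs]; rfl
  have hint : IsIntegral X T S := by
    refine ⟨fun s hs => ?_, fun s hs U hU f => ?_⟩
    · refine ((hev s hs).self_of_nhds.2.2.cont s rfl).congr ?_
      filter_upwards [hS.mem_nhds hs] with r hr using (hTpt r hr).symm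
    · have hc := (hev s hs).self_of_nhds.2.1.cont
      have hU' : (flowPt X (ψ.pointD a y.1) s).pt ∈ U := hTpt s hs ▸ hU
      have hUev : ∀ᶠ q : ℝ × ModelSpace ψ.n ψ.m in 𝓝 (s, y.1), (flowPt X (ψ.pointD a q.2) q.1).pt ∈ U :=
        hc.eventually (U.isOpen.mem_nhds hU')
      have hg : MixNear (timeJ (modelJ _ _)) (mulI _)
          (fun q : ℝ × ModelSpace ψ.n ψ.m => (flowPt X (ψ.pointD a q.2) q.1).app U f) (s, y.1) := by
        filter_upwards [hev s hs, hUev] with q hq hqU using hq.2.1.mix U hqU f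
      -- The time derivative passes through the Taylor expansion and replaces `f` by `X f`, because
      -- the universal points move along integral curves.
      have h1 := hasDerivAt_taylor (b := direction) (y := y) modelJ_cube hg
      rw [hT s hs, taylorPt_app _ hU']
      have e : (fun q => fderiv ℝ (fun q : ℝ × ModelSpace ψ.n ψ.m => (flowPt X (ψ.pointD a q.2) q.1).app U f) (s, q) (1, 0))
          =ᶠ[𝓝 y.1] fun q => (flowPt X (ψ.pointD a q) s).app U (X.toFun U f) := by
        have h2 : Tendsto (fun q : ModelSpace ψ.n ψ.m => (s, q)) (𝓝 y.1) (𝓝 (s, y.1)) :=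
          (by fun_prop : Continuous fun q : ModelSpace ψ.n ψ.m => (s, q)).tendsto _
        filter_upwards [h2.eventually (hev s hs), h2.eventually hUev] with q hq hqU
        have h3 := (hq.2.1.mix U hqU f).differentiableAt.hasFDerivAt
        have h4 : HasDerivAt (fun r : ℝ => ((r, q) : ℝ × ModelSpace ψ.n ψ.m)) (1, 0) s :=
          (hasDerivAt_id s).prodMk (hasDerivAt_const s q)
        have h5 := HasFDerivAt.comp_hasDerivAt (f := fun r : ℝ => ((r, q) : ℝ × ModelSpace ψ.n ψ.m)) s h3 h4
        exact h5.unique (hq.2.2.deriv s rfl U hqU f)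
      rw [(taylor_congr e).self_of_nhds] at h1
      refine h1.congr_of_eventuallyEq ?_
      have h5 : Tendsto (fun r : ℝ => ((r, y.1) : ℝ × ModelSpace ψ.n ψ.m)) (𝓝 s) (𝓝 (s, y.1)) :=
        (by fun_prop : Continuous fun r : ℝ => ((r, y.1) : ℝ × ModelSpace ψ.n ψ.m)).tendsto _
      filter_upwards [hS.mem_nhds hs, h5.eventually hUev] with r hr hrU
      rw [hT r hr, taylorPt_app _ hrU]
  have h0 : (0 : ℝ) ∈ S := zero_mem_flowSet hX _
  have hpt0 : (ψ.pointD a y.1).pt = A.pt := by rw [pointD_of_mem hp, hpt]; rfl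
  -- At time zero the flow is the identity, so the expanded functions are the local expressions of
  -- sections, and their expansions at the coordinates of `A` are the values at `A`.
  have hTA : T 0 = A := by
    have hz : flowPt X (ψ.pointD a y.1) 0 = ψ.pointD a y.1 := flowPt_zero hX (by rw [hpt0]; exact h0)
    refine LPoint.ext_of_app (by rw [hTpt 0 h0, hz, hpt0]) fun U hU f => ?_
    have hU' : (flowPt X (ψ.pointD a y.1) 0).pt ∈ U := hTpt 0 h0 ▸ hU
    have hAU : A.pt ∈ U := by rw [hz, hpt0] at hU'; exact hU'
    rw [hT 0 h0, taylorPt_app _ hU', app_eq_taylor hA hAU]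
    refine (taylor_congr ?_).self_of_nhds
    have hyU : y.1 ∈ ψ.preimage U := ψ.mem_preimage.2 ⟨hp, hpt ▸ hAU⟩
    filter_upwards [(ψ.preimage U).isOpen.mem_nhds hyU] with q hq
    rw [flowPt_zero hX (zero_mem_flowSet hX _), pointD_of_mem (mem_domain hq), point_app hq]
  have hre : Reaches X A t (T t) := ⟨S, hS, isPreconnected_flowSet _, h0, ht, T, hint, hTA, rfl⟩
  have hfl := hre.flowPt_eq hX
  rw [hfl] at hU ⊢
  have hU' : (flowPt X (ψ.pointD a y.1) t).pt ∈ U := hTpt t ht ▸ hU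
  rw [hT t ht, taylorPt_app _ hU']

/-- In a chart, the flow of the universal point at time `t` is the local expression of a section.
Its value at any other Grassmann valued point is correct because both sides are Taylor expansions of
the same function, which makes the local sections glue. -/
theorem exists_flowSection (hX : ∀ ψ : M.Parametrization, ψ.RealField X)
    (hN : ∀ x ∈ N, (t, x) ∈ flowSet X ∧ (flowPt X (LPoint.ofPoint 0 x) t).pt ∈ U) (f : M.sections U) :
    ∃ g : M.sections N, ∀ (k : ℕ) (A : LPoint M.toRingedSuperspace k), A.pt ∈ N →
      A.app N g = (flowPt X A t).app U f := by
  refine MixedSupermanifold.exists_section fun x hx => ?_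
  obtain ⟨ψ, a, rfl⟩ := M.exists_chart x
  refine ⟨ψ, ⟨a, rfl⟩, ?_⟩
  have hpt : ∀ {k} {A : LPoint M.toRingedSuperspace k}, A.pt ∈ N → (flowPt X A t).pt ∈ U := fun {k A} hA => by
    rw [flowPt_pt hX (hN _ hA).1]; exact (hN _ hA).2
  obtain ⟨g, hg⟩ := exists_expr_eq (ψ := ψ) (U := N ⊓ ψ.range) inf_le_right
    (g := fun p => (flowPt X (ψ.pointD a p) t).app U f) fun p hp => by
      have hd := mem_domain hp
      have hpN : ψ.hom.base ⟨p, hd⟩ ∈ N := (base_mem hp).1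
      have h1 := (eventually_flowPt_pointD hX (a := a) hd (hN _ hpN).1).self_of_nhds.2.1
      refine (MixFam.comp (C := fun q : ℝ × ModelSpace ψ.n ψ.m => flowPt X (ψ.pointD a q.2) q.1) modelJ_cube
        (g := fun q => (t, q)) h1 (mix_slice t p)).mix U (hpt ?_) f
      rw [pointD_pt hd]
      exact hpN
  refine ⟨g, fun k A hA => ?_⟩
  rw [app_eq_taylor hA.2 hA, flowPt_app_eq_taylor (a := a) hX hA.2 (hN _ hA.1).1 (hpt hA.1)]
  refine (taylor_congr ?_).self_of_nhds
  obtain ⟨hp, e⟩ := coords_fst_mem hA.2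
  have hpp : (ψ.coords A).1 ∈ ψ.preimage (N ⊓ ψ.range) := ψ.mem_preimage.2 ⟨hp, e ▸ hA⟩
  filter_upwards [(ψ.preimage (N ⊓ ψ.range)).isOpen.mem_nhds hpp] with q hq using hg q hq

end Flow

/-! ### The maximal flow -/

theorem hasDerivAt_of_dual {F : Type*} [NormedAddCommGroup F] [NormedSpace ℂ F] [FiniteDimensional ℂ F]
    {g : ℝ → F} {g' : F} {t : ℝ} (h : ∀ l : Module.Dual ℂ F, HasDerivAt (fun s => l (g s)) (l g') t) :
    HasDerivAt g g' t := by
  let b := Module.finBasis ℂ F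
  have h1 : HasDerivAt (fun s => ∑ i, b.coord i (g s) • b i) (∑ i, b.coord i g' • b i) t :=
    HasDerivAt.fun_sum fun i _ => (h (b.coord i)).smul_const (b i)
  simpa only [Module.Basis.coord_apply, b.sum_repr] using h1

section MaximalFlow
open RingedSuperspace.Parametrization
variable {M : MixedSupermanifold.{u, v}} {X : EvenVectorField M.toRingedSuperspace} {k : ℕ} {t : ℝ}
  {A : LPoint M.toRingedSuperspace k} {U N : Opens M.carrier}

/-- The flow domain, as an open set. -/
def flowOpens (hX : ∀ ψ : M.Parametrization, ψ.RealField X) : Opens M.timeProduct :=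
  ⟨flowSet X, isOpen_flowSet hX⟩

/-- The flow on points of the base. -/
def flowBase (hX : ∀ ψ : M.Parametrization, ψ.RealField X) :
    C(M.timeProduct.restrict (flowOpens hX), M.toRingedSuperspace) where
  toFun q := (flowPt X (LPoint.ofPoint 0 q.1.2) q.1.1).pt
  continuous_toFun := continuous_iff_continuousAt.2 fun q =>
    ContinuousAt.comp (f := fun q : flowOpens hX => q.1) (continuousAt_flowPt hX q.2)
      continuous_subtype_val.continuousAt

/-- The part of the flow domain which is mapped to `U`. -/
def flowPreimage (hX : ∀ ψ : M.Parametrization, ψ.RealField X) (U : Opens M.carrier) : Opens (ℝ × M.carrier) :=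
  M.timeProduct.imageOpens (flowOpens hX) (Opens.comap (flowBase hX) U)

variable {hX : ∀ ψ : M.Parametrization, ψ.RealField X}

theorem mem_flowPreimage {q : ℝ × M.carrier} : q ∈ flowPreimage hX U ↔
    q ∈ flowSet X ∧ (flowPt X (LPoint.ofPoint 0 q.2) q.1).pt ∈ U := by
  constructor
  · rintro ⟨q, hq, rfl⟩; exact ⟨q.2, hq⟩
  · rintro ⟨h, hU⟩; exact ⟨⟨q, h⟩, hU, rfl⟩

theorem flowPt_mem (hA : A.pt ∈ M.slice (flowPreimage hX U) t) : (flowPt X A t).pt ∈ U := by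
  rw [flowPt_pt hX (mem_flowPreimage.1 hA).1]
  exact (mem_flowPreimage.1 hA).2

variable (hX) in
/-- The pullback of a section under the flow at the time `t`. -/
def flowSection (f : M.sections U) (t : ℝ) : M.sections (M.slice (flowPreimage hX U) t) :=
  (exists_flowSection hX (fun _ hx => mem_flowPreimage.1 hx) f).choose

theorem flowSection_app (f : M.sections U) (hA : A.pt ∈ M.slice (flowPreimage hX U) t) :
    A.app _ (flowSection hX f t) = (flowPt X A t).app U f :=
  (exists_flowSection hX (fun _ hx => mem_flowPreimage.1 hx) f).choose_spec k A hA

theorem coeff_flowSection {ψ : M.Parametrization} (l : Module.Dual ℂ (Grassmann ψ.k)) (f : M.sections U)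
    {q : ℝ × ModelSpace ψ.n ψ.m} (hq : q.2 ∈ ψ.preimage (M.slice (flowPreimage hX U) q.1)) (a : ψ.domain) :
    ψ.coeff (flowSection hX f) l q = l ((flowPt X (ψ.pointD a q.2) q.1).app U f) := by
  rw [ψ.coeff_eq _ l hq, pointD_of_mem (mem_domain hq), ← flowSection_app (hX := hX) f (base_mem hq), point_app hq,
    expr_eq _ hq]

theorem isSmoothFamily_flowSection (f : M.sections U) : M.IsSmoothFamily (flowSection hX f) := by
  intro ψ l q hq
  have hd := mem_domain hq
  let a : ψ.domain := ⟨q.2, hd⟩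
  have h1 := mem_flowPreimage.1 (base_mem hq)
  have h2 := (eventually_flowPt_pointD hX (a := a) hd h1.1).self_of_nhds.2.1
  have h3 : (flowPt X (ψ.pointD a q.2) q.1).pt ∈ U := flowPt_mem (hX := hX) (by
    rw [pointD_pt hd]; exact base_mem hq)
  refine ((h2.mix U h3 f).dual l).1.congr_of_eventuallyEq ?_
  filter_upwards [ψ.eventually_mem hq] with r hr using coeff_flowSection l f hr a

variable (hX) in
/-- The flow of a vector field on its maximal domain. -/
def maximalFlow : Hom (M.timeProduct.restrict (flowOpens hX)) M.toRingedSuperspace where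
  base := flowBase hX
  pullback U :=
    { toFun := fun f => (⟨flowSection hX f, isSmoothFamily_flowSection f⟩ : M.timeSections (flowPreimage hX U))
      map_one' := Subtype.ext (funext fun t => MixedSupermanifold.section_ext_of_app fun k A hA => by
        rw [flowSection_app _ hA]
        change _ = A.app _ 1
        rw [LPoint.app_of_mem (A := A) hA, LPoint.app_of_mem (A := flowPt X A t) (flowPt_mem hA), map_one, map_one])
      map_mul' := fun f g => Subtype.ext (funext fun t => MixedSupermanifold.section_ext_of_app fun k A hA => by
        rw [flowSection_app _ hA]
        change _ = A.app _ (flowSection hX f t * flowSection hX g t)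
        rw [LPoint.app_mul, LPoint.app_mul, flowSection_app _ hA, flowSection_app _ hA])
      map_zero' := Subtype.ext (funext fun t => MixedSupermanifold.section_ext_of_app fun k A hA => by
        rw [flowSection_app _ hA, map_zero]
        exact (map_zero _).symm)
      map_add' := fun f g => Subtype.ext (funext fun t => MixedSupermanifold.section_ext_of_app fun k A hA => by
        rw [flowSection_app _ hA, map_add]
        change _ = A.app _ (flowSection hX f t + flowSection hX g t)
        rw [map_add, flowSection_app _ hA, flowSection_app _ hA])
      commutes' := fun c => Subtype.ext (funext fun t => MixedSupermanifold.section_ext_of_app fun k A hA => by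
        rw [flowSection_app _ hA, LPoint.app_algebraMap (flowPt_mem hA)]
        exact (LPoint.app_algebraMap hA c).symm) }
  pullback_res {U U'} h f := Subtype.ext (funext fun t => MixedSupermanifold.section_ext_of_app fun k A hA => by
    have hle : M.slice (flowPreimage hX U) t ≤ M.slice (flowPreimage hX U') t :=
      fun x hx => mem_flowPreimage.2 ⟨(mem_flowPreimage.1 hx).1, h (mem_flowPreimage.1 hx).2⟩
    change A.app (M.slice (flowPreimage hX U) t) (flowSection hX (M.res h f) t) =
      A.app _ (M.res hle (flowSection hX f t))
    rw [flowSection_app _ hA, LPoint.app_res h (flowPt_mem hA)]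
    exact ((LPoint.app_res hle hA _).trans (flowSection_app f (hle hA))).symm)
  pullback_parity {U} i f hf t := MixedSupermanifold.mem_parity_of_app fun k A hA => by
    change A.app _ (flowSection hX f t) ∈ _
    rw [flowSection_app (U := U) f hA]
    exact LPoint.app_parity hf
  isLocal {U} f x hx := by
    rintro ⟨W, hW, hxW, hu⟩
    -- The ordinary point below `x` detects invertibility: the pullback of `f` is a unit there, so
    -- the value of `f` at the image point is nonzero, and in a mixed supermanifold this makes the
    -- germ of `f` invertible.
    let A : LPoint M.toRingedSuperspace 0 := LPoint.ofPoint 0 x.1.2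
    have hxN : A.pt ∈ M.slice (flowPreimage hX U) x.1.1 := mem_flowPreimage.2 ⟨x.2, hx⟩
    have hle : M.slice (M.timeProduct.imageOpens (flowOpens hX) W) x.1.1 ≤ M.slice (flowPreimage hX U) x.1.1 := by
      rintro y ⟨q, hq, e⟩
      exact ⟨q, hW hq, e⟩
    have hmem : A.pt ∈ M.slice (M.timeProduct.imageOpens (flowOpens hX) W) x.1.1 := ⟨x, hxW, rfl⟩
    let π : M.timeSections (M.timeProduct.imageOpens (flowOpens hX) W) →ₐ[ℂ]
        M.sections (M.slice (M.timeProduct.imageOpens (flowOpens hX) W) x.1.1) :=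
      (Pi.evalAlgHom ℂ _ x.1.1).comp (M.timeSections _).val
    have h1 : IsUnit (M.res hle (flowSection hX f x.1.1)) := hu.map π
    have h2 := (h1.map (A.eval _ hmem)).map (Grassmann.aug 0)
    rw [← LPoint.app_of_mem hmem, LPoint.app_res hle hmem, flowSection_app f hxN,
      LPoint.aug_app (M := M) (flowPt_mem hxN)] at h2
    exact M.isUnitAt_of_value_ne_zero f ⟨_, flowPt_mem hxN⟩ h2.ne_zero

theorem isFlow_maximalFlow : IsFlow X (flowOpens hX) (maximalFlow hX) where
  zero_mem x := zero_mem_flowSet hX x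
  hasTimeDeriv U f ψ l t p hp := by
    have hd := mem_domain hp
    let a : ψ.domain := ⟨p, hd⟩
    have hp' : p ∈ ψ.preimage (M.slice (flowPreimage hX U) t) := hp
    have h0 := mem_flowPreimage.1 (base_mem hp')
    have h1 := (eventually_flowPt_pointD hX (a := a) hd h0.1).self_of_nhds.2.2
    have h3 : (flowPt X (ψ.pointD a p) t).pt ∈ U := flowPt_mem (hX := hX) (by
      rw [pointD_pt hd]; exact base_mem hp')
    have h4 := ((l.toContinuousLinearMap).restrictScalars ℝ).hasFDerivAt.comp_hasDerivAt t (h1.deriv t rfl U h3 f)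
    change HasDerivAt (fun s => ψ.coeff (flowSection hX f) l (s, p)) (ψ.coeff (flowSection hX (X.toFun U f)) l (t, p)) t
    rw [coeff_flowSection l _ (q := (t, p)) hp' a]
    refine h4.congr_of_eventuallyEq ?_
    have h5 : Tendsto (fun s : ℝ => ((s, p) : ℝ × ModelSpace ψ.n ψ.m)) (𝓝 t) (𝓝 (t, p)) :=
      (by fun_prop : Continuous fun s : ℝ => ((s, p) : ℝ × ModelSpace ψ.n ψ.m)).tendsto _
    filter_upwards [h5.eventually (ψ.eventually_mem (q := (t, p)) hp')] with s hs
      using coeff_flowSection l f (q := (s, p)) hs a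
  base_zero x := by
    change (flowPt X (LPoint.ofPoint 0 x) 0).pt = x
    rw [flowPt_zero hX (zero_mem_flowSet hX x)]; rfl
  pullback_zero U f h := MixedSupermanifold.section_ext_of_app fun k A hA => by
    have hA' : A.pt ∈ M.slice (flowPreimage hX U) 0 := h hA
    refine (LPoint.app_res h hA _).trans ?_
    change A.app _ (flowSection hX f 0) = _
    rw [flowSection_app f hA', flowPt_zero hX (zero_mem_flowSet hX A.pt)]

/-! ### Arbitrary flows and their action on Grassmann valued points -/

section Uniqueness
variable {V : Opens M.timeProduct} {Θ : Hom (M.timeProduct.restrict V) M.toRingedSuperspace}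

open Classical in
/-- The image of a Grassmann algebra valued point under a flow. -/
def homPt (Θ : Hom (M.timeProduct.restrict V) M.toRingedSuperspace) (A : LPoint M.toRingedSuperspace k) (t : ℝ) :
    LPoint M.toRingedSuperspace k :=
  if h : ((t, A.pt) : ℝ × M.carrier) ∈ V then
    { pt := Θ.base ⟨(t, A.pt), h⟩
      eval := fun U hU => (A.eval (M.slice (M.timeProduct.imageOpens V (Opens.comap Θ.base U)) t)
        ⟨⟨(t, A.pt), h⟩, hU, rfl⟩).comp (((Pi.evalAlgHom ℂ _ t).comp (M.timeSections _).val).comp (Θ.pullback U))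
      eval_res := fun {U U'} hle hx f => by
        have h1 : ((Θ.pullback U (M.res hle f) : M.timeSections _).1 t) =
            M.res (M.slice_mono (M.timeProduct.imageOpens_mono V (Opens.comap_mono Θ.base hle)) t)
              ((Θ.pullback U' f : M.timeSections _).1 t) :=
          congrFun (congrArg Subtype.val (Θ.pullback_res hle f)) t
        exact (congrArg (A.eval _ _) h1).trans (A.eval_res _ _ _)
      eval_parity := fun {U} hx i f hf => A.eval_parity _ i _ (Θ.pullback_parity i f hf t) }
  else A

theorem homPt_pt (h : ((t, A.pt) : ℝ × M.carrier) ∈ V) : (homPt Θ A t).pt = Θ.base ⟨(t, A.pt), h⟩ := by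
  rw [homPt, dif_pos h]

theorem homPt_app (h : ((t, A.pt) : ℝ × M.carrier) ∈ V) (hU : Θ.base ⟨(t, A.pt), h⟩ ∈ U) (f : M.sections U) :
    (homPt Θ A t).app U f =
      A.app (M.slice (M.timeProduct.imageOpens V (Opens.comap Θ.base U)) t) ((Θ.pullback U f : M.timeSections _).1 t) := by
  have hU' : (homPt Θ A t).pt ∈ U := by rw [homPt_pt h]; exact hU
  have hA : A.pt ∈ M.slice (M.timeProduct.imageOpens V (Opens.comap Θ.base U)) t := ⟨⟨(t, A.pt), h⟩, hU, rfl⟩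
  rw [LPoint.app_of_mem hU', LPoint.app_of_mem hA]
  simp only [homPt, dif_pos h]
  rfl

theorem IsFlow.homPt_zero (hΘ : IsFlow X V Θ) (A : LPoint M.toRingedSuperspace k) : homPt Θ A 0 = A := by
  have h0 := hΘ.zero_mem A.pt
  have hpt : (homPt Θ A 0).pt = A.pt := by rw [homPt_pt h0]; exact hΘ.base_zero A.pt
  refine LPoint.ext_of_app hpt fun U hU f => ?_
  have hU' : Θ.base ⟨(0, A.pt), h0⟩ ∈ U := by rwa [homPt_pt h0] at hU
  have hle : U ≤ M.slice (M.timeProduct.imageOpens V (Opens.comap Θ.base U)) 0 := fun x hx =>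
    ⟨⟨(0, x), hΘ.zero_mem x⟩, by
      change Θ.base _ ∈ U
      rw [hΘ.base_zero x]; exact hx, rfl⟩
  rw [homPt_app h0 hU', ← LPoint.app_res hle (hpt ▸ hU), hΘ.pullback_zero]

/-- At a universal point of a chart, the flow equation in the coefficients of local expressions is
literally the equation of an integral curve. Universal points suffice later, as they determine
morphisms. -/
theorem IsFlow.isIntegral (hΘ : IsFlow X V Θ) {ψ : M.Parametrization} {p : ModelSpace ψ.n ψ.m} (hp : p ∈ ψ.domain) :
    IsIntegral X (homPt Θ (ψ.point p hp)) {t | ((t, (ψ.point p hp).pt) : ℝ × M.carrier) ∈ V} := by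
  set A := ψ.point p hp
  set S : Set ℝ := {t | ((t, A.pt) : ℝ × M.carrier) ∈ V}
  have hS : IsOpen S := V.isOpen.preimage (by fun_prop : Continuous fun s : ℝ => ((s, A.pt) : ℝ × M.carrier))
  have hc : ∀ t ∈ S, ContinuousAt (fun s => (homPt Θ A s).pt) t := fun t ht => by
    refine (hS.isOpenEmbedding_subtypeVal.continuousAt_iff (x := ⟨t, ht⟩) (g := fun s => (homPt Θ A s).pt)).1 ?_
    have e : (fun s => (homPt Θ A s).pt) ∘ (Subtype.val : S → ℝ) = fun s => Θ.base ⟨(s.1, A.pt), s.2⟩ :=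
      funext fun s => homPt_pt s.2
    rw [e]
    have h1 : Continuous fun s : S => (⟨(s.1, A.pt), s.2⟩ : V) :=
      Continuous.subtype_mk (f := fun s : S => ((s.1, A.pt) : ℝ × M.carrier)) (by fun_prop) _
    exact (Θ.base.continuous.comp h1).continuousAt
  refine ⟨hc, fun t ht U hU f => ?_⟩
  have hU' : ∀ {s} (hs : s ∈ S), (homPt Θ A s).pt ∈ U → Θ.base ⟨(s, A.pt), hs⟩ ∈ U := fun hs h => by
    rwa [homPt_pt hs] at h
  have key : ∀ {s} (hs : s ∈ S), (homPt Θ A s).pt ∈ U → ∀ (f : M.sections U) (l : Module.Dual ℂ (Grassmann ψ.k)),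
      p ∈ ψ.preimage (M.slice (M.timeProduct.imageOpens V (Opens.comap Θ.base U)) s) ∧
      ψ.coeff (Θ.pullback U f : M.timeSections _).1 l (s, p) = l ((homPt Θ A s).app U f) := by
    intro s hs h f l
    have hp' : p ∈ ψ.preimage (M.slice (M.timeProduct.imageOpens V (Opens.comap Θ.base U)) s) :=
      ψ.mem_preimage.2 ⟨hp, ⟨⟨(s, A.pt), hs⟩, hU' hs h, rfl⟩⟩
    refine ⟨hp', ?_⟩
    rw [homPt_app hs (hU' hs h)]
    exact (ψ.coeff_eq _ l (q := (s, p)) hp').trans (congrArg l ((expr_eq _ hp').symm.trans (point_app hp' _).symm))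
  refine hasDerivAt_of_dual fun l => ?_
  have h1 := hΘ.hasTimeDeriv U f ψ l t p (key ht hU f l).1
  rw [(key ht hU (X.toFun U f) l).2] at h1
  refine h1.congr_of_eventuallyEq ?_
  filter_upwards [hS.mem_nhds ht, (hc t ht).eventually (U.isOpen.mem_nhds hU)] with s hs hsU
    using ((key hs hsU f l).2).symm

/-- Here the interval condition on a flow domain enters: the times available at a point must be
connected to zero for an integral curve to be followed. -/
theorem IsFlow.reaches (hΘ : IsFlow X V Θ) (hV : ∀ x : M.carrier, {t : ℝ | ((t, x) : ℝ × M.carrier) ∈ V}.OrdConnected)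
    {ψ : M.Parametrization} {p : ModelSpace ψ.n ψ.m} (hp : p ∈ ψ.domain)
    (ht : ((t, (ψ.point p hp).pt) : ℝ × M.carrier) ∈ V) :
    Reaches X (ψ.point p hp) t (homPt Θ (ψ.point p hp) t) :=
  ⟨_, V.isOpen.preimage (by fun_prop : Continuous fun s : ℝ => ((s, (ψ.point p hp).pt) : ℝ × M.carrier)),
    (hV _).isPreconnected, hΘ.zero_mem _, ht, _, hΘ.isIntegral hp, hΘ.homPt_zero _, rfl⟩

/-- The images of universal points give the map on points, and evaluating pulled back sections at
universal points gives their local expressions. -/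
theorem Hom.ext_of_homPt {Θ' : Hom (M.timeProduct.restrict V) M.toRingedSuperspace}
    (h : ∀ (ψ : M.Parametrization) (p : ModelSpace ψ.n ψ.m) (hp : p ∈ ψ.domain) (t : ℝ),
      ((t, (ψ.point p hp).pt) : ℝ × M.carrier) ∈ V → homPt Θ (ψ.point p hp) t = homPt Θ' (ψ.point p hp) t) :
    Θ = Θ' := by
  have hb : Θ.base = Θ'.base := by
    refine ContinuousMap.ext ?_
    rintro ⟨⟨t, x⟩, hq⟩
    obtain ⟨ψ, a, rfl⟩ := M.exists_chart x
    have h1 := congrArg LPoint.pt (h ψ a.1 a.2 t hq)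
    rwa [homPt_pt hq, homPt_pt hq] at h1
  -- The pulled back sections live over open sets that depend on the base maps. Comparing their
  -- restrictions to a common `N` avoids transport along the equality of these maps.
  have hpull : ∀ (U : Opens M.carrier) (f : M.sections U) (t : ℝ) (N : Opens M.carrier)
      (h₁ : N ≤ M.slice (M.timeProduct.imageOpens V (Opens.comap Θ.base U)) t)
      (h₂ : N ≤ M.slice (M.timeProduct.imageOpens V (Opens.comap Θ'.base U)) t),
      M.res h₁ ((Θ.pullback U f : M.timeSections _).1 t) = M.res h₂ ((Θ'.pullback U f : M.timeSections _).1 t) := by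
    intro U f t N h₁ h₂
    refine MixedSupermanifold.section_ext fun ψ p hp => ?_
    have hd := mem_domain hp
    have hN : (ψ.point p hd).pt ∈ N := base_mem hp
    rw [← point_app hp, ← point_app hp, LPoint.app_res h₁ hN, LPoint.app_res h₂ hN]
    have aux : ∀ {Θ : Hom (M.timeProduct.restrict V) M.toRingedSuperspace},
        (ψ.point p hd).pt ∈ M.slice (M.timeProduct.imageOpens V (Opens.comap Θ.base U)) t →
        ∃ hV : ((t, (ψ.point p hd).pt) : ℝ × M.carrier) ∈ V, Θ.base ⟨_, hV⟩ ∈ U := by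
      rintro Θ ⟨⟨q, hq⟩, hqU, e⟩
      obtain rfl : q = (t, (ψ.point p hd).pt) := e
      exact ⟨hq, hqU⟩
    obtain ⟨hV, hU⟩ := aux (h₁ hN)
    obtain ⟨_, hU'⟩ := aux (h₂ hN)
    rw [← homPt_app hV hU, ← homPt_app hV hU', h ψ p hd t hV]
  obtain ⟨b, P, _, _, _⟩ := Θ
  obtain ⟨b', P', _, _, _⟩ := Θ'
  obtain rfl : b = b' := hb
  have : P = P' := by
    funext U
    refine AlgHom.ext fun f => Subtype.ext (funext fun t => ?_)
    have := hpull U f t _ le_rfl le_rfl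
    rwa [M.res_self, M.res_self] at this
  subst this
  rfl

end Uniqueness

/-- Any flow moves the universal point over `x` along an integral curve, so a flow domain consists
of reached pairs, and two flows on the same domain agree by uniqueness of integral curves. -/
theorem isMaximalFlow_maximalFlow : IsMaximalFlow X (flowOpens hX) (maximalFlow hX) := by
  have hord : ∀ x : M.carrier, {t : ℝ | ((t, x) : ℝ × M.carrier) ∈ flowOpens hX}.OrdConnected := fun x =>
    (isPreconnected_flowSet x).ordConnected
  refine ⟨⟨⟨zero_mem_flowSet hX, hord, _, isFlow_maximalFlow⟩, ?_⟩, isFlow_maximalFlow, fun Θ' hΘ' => ?_⟩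
  · rintro V ⟨h0, hV, Θ, hΘ⟩ ⟨t, x⟩ htx
    obtain ⟨ψ, a, rfl⟩ := M.exists_chart x
    exact (hΘ.reaches hV a.2 htx).mem_flowSet
  · refine Hom.ext_of_homPt fun ψ p hp t ht => ?_
    exact (hΘ'.reaches hord hp ht).unique hX (isFlow_maximalFlow.reaches hord hp ht)

end MaximalFlow

/-! ### The underlying mixed manifold -/

theorem Grassmann.algebraMap_aug_zero (a : Grassmann 0) : algebraMap ℂ (Grassmann 0) (Grassmann.aug 0 a) = a := by
  have h : (Algebra.ofId ℂ (Grassmann 0)).comp (Grassmann.aug 0) = AlgHom.id ℂ (Grassmann 0) := by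
    refine ExteriorAlgebra.hom_ext (LinearMap.ext fun v => ?_)
    rw [Subsingleton.elim v 0, map_zero, map_zero]
  exact DFunLike.congr_fun h a

namespace MixedSupermanifold
open RingedSuperspace.Parametrization
variable {M : MixedSupermanifold.{u, v}} {U : Opens M.carrier}

theorem value_base {ψ : M.Parametrization} {p : ModelSpace ψ.n ψ.m} (hp : p ∈ ψ.preimage U) (f : M.sections U) :
    M.value f ⟨ψ.hom.base ⟨p, mem_domain hp⟩, base_mem hp⟩ = Grassmann.aug ψ.k (ψ.expr U f p) := by
  rw [← point_app hp, LPoint.aug_app (M := M) (A := ψ.point p (mem_domain hp)) (base_mem hp)]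
  rfl

/-- A local lift of the function is invertible where its value is nonzero, and the function
underlying the inverse is an inverse in the quotient sheaf. -/
theorem body_isUnitAt {φ : M.body.sections U} {x : M.carrier} (hx : x ∈ U)
    (h : (φ : M.bodySections U).1 ⟨x, hx⟩ ≠ 0) : M.body.IsUnitAt φ x := by
  obtain ⟨W, hW, f, hxW, hf⟩ := M.mem_bodySections.1 (φ : M.bodySections U).2 ⟨x, hx⟩
  have h1 : M.value f ⟨x, hxW⟩ ≠ 0 := by rw [hf ⟨x, hxW⟩]; exact h
  obtain ⟨W', hW', hx', hu⟩ := M.isUnitAt_of_value_ne_zero f ⟨x, hxW⟩ h1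
  refine ⟨W', hW'.trans hW, hx', ?_⟩
  obtain ⟨g, hg⟩ := hu.exists_right_inv
  let g' : M.bodySections W' := M.toBody W' g
  have e : M.bodyRes (hW'.trans hW) φ * g' = 1 := by
    refine Subtype.ext (funext fun y => ?_)
    have h2 := congrFun (congrArg M.value hg) y
    rw [map_mul, Pi.mul_apply, M.value_res, hf, map_one] at h2
    exact h2
  exact IsUnit.of_mul_eq_one (M := M.bodySections W') _ e

theorem mem_modelSections_body (ψ : M.Parametrization) (φ : M.bodySections U) :
    (fun p : ψ.preimage U => algebraMap ℂ (Grassmann 0) (φ.1 ⟨ψ.hom.base ⟨p.1, mem_domain p.2⟩, base_mem p.2⟩)) ∈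
      modelSections ψ.n ψ.m 0 (ψ.preimage U) := by
  refine mem_modelSections_of_mix fun p hp => ?_
  obtain ⟨W, hW, f, hpW, hf⟩ := M.mem_bodySections.1 φ.2 ⟨_, base_mem hp⟩
  have hpW' : p ∈ ψ.preimage W := ψ.mem_preimage.2 ⟨mem_domain hp, hpW⟩
  refine (Mix.clm_comp_complex ((Algebra.linearMap ℂ (Grassmann 0)).toContinuousLinearMap.comp
    (Grassmann.augL ψ.k)) (mixNear_expr f hpW').mix).congr ?_
  filter_upwards [(ψ.preimage W).isOpen.mem_nhds hpW'] with q hq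
  rw [extendZero_of_mem _ (ψ.preimage_mono hW hq)]
  exact congrArg (algebraMap ℂ (Grassmann 0)) ((hf ⟨_, base_mem hq⟩).symm.trans (value_base hq f))

/-- The expression of a function on the underlying mixed manifold in a parametrization. -/
def bodyPullback (ψ : M.Parametrization) (U : Opens M.carrier) :
    M.bodySections U →ₐ[ℂ] modelSections ψ.n ψ.m 0 (ψ.preimage U) where
  toFun φ := ⟨_, mem_modelSections_body ψ φ⟩
  map_one' := Subtype.ext (funext fun _ => map_one (algebraMap ℂ (Grassmann 0)))
  map_mul' _ _ := Subtype.ext (funext fun _ => map_mul (algebraMap ℂ (Grassmann 0)) _ _)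
  map_zero' := Subtype.ext (funext fun _ => map_zero (algebraMap ℂ (Grassmann 0)))
  map_add' _ _ := Subtype.ext (funext fun _ => map_add (algebraMap ℂ (Grassmann 0)) _ _)
  commutes' _ := rfl

theorem aug_bodyPullback {ψ : M.Parametrization} (φ : M.bodySections U) (p : ψ.preimage U) :
    Grassmann.aug 0 ((bodyPullback ψ U φ).1 p) = φ.1 ⟨ψ.hom.base ⟨p.1, mem_domain p.2⟩, base_mem p.2⟩ :=
  AlgHom.commutes _ _

theorem bijective_bodyPullback {ψ : M.Parametrization} (hU : U ≤ ψ.range) :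
    Function.Bijective (bodyPullback ψ U) := by
  refine ⟨fun φ φ' h => ?_, fun g => ?_⟩
  · refine Subtype.ext (funext ?_)
    rintro ⟨x, hx⟩
    obtain ⟨a, rfl⟩ := hU hx
    have hp : a.1 ∈ ψ.preimage U := ψ.mem_preimage.2 ⟨a.2, hx⟩
    have h1 := aug_bodyPullback φ ⟨a.1, hp⟩
    rw [h, aug_bodyPullback φ' ⟨a.1, hp⟩] at h1
    exact h1.symm
  · obtain ⟨f, hf⟩ := exists_expr_eq (ψ := ψ) hU
      (g := fun p => algebraMap ℂ (Grassmann ψ.k) (Grassmann.aug 0 (extendZero (ψ.preimage U) g.1 p)))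
      fun p hp => Mix.clm_comp_complex ((Algebra.linearMap ℂ (Grassmann ψ.k)).toContinuousLinearMap.comp
        (Grassmann.augL 0)) (mix_of_mem_modelSections g.2 hp)
    refine ⟨M.toBody U f, Subtype.ext (funext fun p => ?_)⟩
    have h1 := value_base p.2 f
    rw [hf _ p.2, AlgHom.commutes, extendZero_of_mem _ p.2] at h1
    exact (congrArg (algebraMap ℂ (Grassmann 0)) h1).trans (Grassmann.algebraMap_aug_zero _)

/-- The morphism of a parametrization of the underlying mixed manifold. -/
def bodyHom (ψ : M.Parametrization) : Hom ((model ψ.n ψ.m 0).restrict ψ.domain) M.body where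
  base := ψ.hom.base
  pullback U := bodyPullback ψ U
  pullback_res _ _ := rfl
  pullback_parity {U} i φ hφ p := by
    rcases zmod_two_cases i with rfl | rfl
    · exact Grassmann.algebraMap_mem_even _
    · have h0 : φ = 0 := hφ
      have h1 : (bodyPullback ψ U φ).1 p = 0 := by
        rw [h0]
        exact congrFun (congrArg Subtype.val (map_zero (bodyPullback ψ U))) p
      exact h1.symm ▸ Submodule.zero_mem _
  isLocal {U} φ x hx := by
    rintro ⟨W, hW, hxW, hu⟩
    refine body_isUnitAt hx ?_
    have hp : x.1 ∈ ψ.preimage U := ⟨x, hx, rfl⟩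
    let π : modelSections ψ.n ψ.m 0 ((model ψ.n ψ.m 0).imageOpens ψ.domain W) →ₐ[ℂ] Grassmann 0 :=
      (Pi.evalAlgHom ℂ (fun _ => Grassmann 0) ⟨x.1, x, hxW, rfl⟩).comp (modelSections ψ.n ψ.m 0 _).val
    have h1 : IsUnit ((bodyPullback ψ U φ).1 ⟨x.1, hp⟩) := hu.map π
    have h2 := (h1.map (Grassmann.aug 0)).ne_zero
    exact fun h => h2 ((aug_bodyPullback (M := M) (U := U) φ ⟨x.1, hp⟩).trans h)

/-- The parametrization of the underlying mixed manifold induced by a parametrization. -/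
def bodyChart (ψ : M.Parametrization) : M.body.Parametrization where
  n := ψ.n
  m := ψ.m
  k := 0
  domain := ψ.domain
  hom := bodyHom ψ
  isOpenImmersion := ⟨ψ.isOpenImmersion.1, fun _ hU => bijective_bodyPullback (ψ := ψ) hU⟩

variable (M) in
/-- The underlying mixed manifold, as a mixed supermanifold. -/
abbrev bodyManifold : MixedSupermanifold.{u, u} where
  toRingedSuperspace := M.body
  t2 := M.t2
  secondCountable := M.secondCountable
  locallyRinged x U hx := by
    refine ⟨⟨0, 1, fun h => ?_⟩, fun φ => ?_⟩
    · exact zero_ne_one (congrFun (congrArg Subtype.val h) ⟨x, hx⟩ : (0 : ℂ) = 1)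
    · by_cases h : (φ : M.bodySections U).1 ⟨x, hx⟩ = 0
      · refine Or.inr (body_isUnitAt hx ?_)
        change 1 - (φ : M.bodySections U).1 ⟨x, hx⟩ ≠ 0
        rw [h, sub_zero]
        exact one_ne_zero
      · exact Or.inl (body_isUnitAt hx h)
  locallyModel x := by
    obtain ⟨ψ, hψ⟩ := M.locallyModel x
    exact ⟨bodyChart ψ, hψ⟩

/-- Evaluation of functions at a point is a homomorphism from the stalk of the quotient sheaf to
`ℂ`, and such a homomorphism is unique. -/
theorem value_body (φ : M.body.sections U) (x : U) :
    M.bodyManifold.value φ x = (φ : M.bodySections U).1 x :=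
  M.bodyManifold.value_eq φ x
    { eval := fun U h => (Pi.evalAlgHom ℂ (fun _ : U => ℂ) ⟨x.1, h⟩).comp (M.bodySections U).val
      eval_res := fun _ _ _ => rfl }

end MixedSupermanifold

/-! ### Reality in terms of charts -/

namespace EvenVectorField
open RingedSuperspace.Parametrization MixedSupermanifold
variable {M : MixedSupermanifold.{u, v}} {X : EvenVectorField M.toRingedSuperspace} {U W : Opens M.carrier}

/-- The first `n` coordinates are sections with real values, so a field preserving real valued
functions has real components in these directions. -/
theorem realField_of_value (h : ∀ (U : Opens M.carrier) (f : M.sections U), (∀ x, (M.value f x).im = 0) →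
    ∀ x, (M.value (X.toFun U f) x).im = 0) (ψ : M.Parametrization) : ψ.RealField X := by
  intro p hp i
  rw [← value_base (mem_preimage_range hp)]
  refine h _ _ ?_ _
  rintro ⟨x, a, rfl⟩
  have h1 := value_base (mem_preimage_range a.2) (ψ.coordinateSection (.inl i))
  rw [expr_coordinateSection _ a.2, AlgHom.commutes] at h1
  rw [show M.value (ψ.coordinateSection (.inl i)) ⟨ψ.hom.base a, a, rfl⟩ = _ from h1]
  exact Complex.ofReal_im _

theorem underlying_apply (φ : M.bodySections U) (h : W ≤ U) (f : M.sections W) (hf : M.IsLift h f φ.1) (x : W) :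
    (X.underlying.toFun U φ : M.bodySections U).1 ⟨x.1, h x.2⟩ = M.value (X.toFun W f) x :=
  X.bodyFun_eq φ h f hf x

theorem underlying_toBody (f : M.sections U) : X.underlying.toFun U (M.toBody U f) = M.toBody U (X.toFun U f) :=
  Subtype.ext (funext fun x => X.bodyFun_eq (M.toBody U f) le_rfl f (fun _ => rfl) x)

theorem IsReal.realField (hX : X.IsReal) (ψ : M.Parametrization) : ψ.RealField X :=
  realField_of_value (fun U f hf x => by
    have h1 := hX U (M.toBody U f) hf x
    rw [underlying_toBody] at h1
    exact h1) ψ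

theorem IsReal.realField_underlying (hX : X.IsReal) (ψ : M.bodyManifold.Parametrization) : ψ.RealField X.underlying :=
  realField_of_value (M := M.bodyManifold) (fun U φ hφ x => by
    exact (congrArg Complex.im (value_body (M := M) _ x)).trans
      (hX U φ (fun x => (congrArg Complex.im (value_body (M := M) φ x)).symm.trans (hφ x)) x)) ψ

end EvenVectorField

/-! ### Comparison of the flows on the supermanifold and on the underlying manifold -/

section Body
open MixedSupermanifold
variable {M : MixedSupermanifold.{u, v}} {X : EvenVectorField M.toRingedSuperspace} {k : ℕ} {S : Set ℝ} {t : ℝ}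
  {x : M.carrier} {U : Opens M.carrier}

theorem LPoint.ofPoint_body_app (h : x ∈ U) (φ : M.bodySections U) :
    (LPoint.ofPoint (M := M.bodyManifold) k x).app U φ = algebraMap ℂ _ (φ.1 ⟨x, h⟩) :=
  (LPoint.ofPoint_app (M := M.bodyManifold) h φ).trans (congrArg _ (value_body _ _))

theorem LPoint.aug_body_app {A : LPoint M.body k} (h : A.pt ∈ U) (φ : M.bodySections U) :
    Grassmann.aug k (A.app U φ) = φ.1 ⟨A.pt, h⟩ :=
  (LPoint.aug_app (M := M.bodyManifold) h φ).trans (value_body _ _)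

/-- Near a point of the curve a function on the underlying manifold lifts to a section. Its value is
the constant term of the lift, and the underlying field acts through the lift, so the derivative can
be computed there. -/
theorem IsIntegral.toBody {A : ℝ → LPoint M.toRingedSuperspace k} (h : IsIntegral X A S) :
    IsIntegral (M := M.body) X.underlying (fun t => LPoint.ofPoint (M := M.bodyManifold) 0 (A t).pt) S := by
  refine ⟨h.cont, fun t ht U hU φ => ?_⟩
  obtain ⟨W, hW, f, hpW, hf⟩ := M.mem_bodySections.1 (φ : M.bodySections U).2 ⟨_, hU⟩
  have key : ∀ {s} (φ : M.bodySections U) (hs : (A s).pt ∈ W) (f : M.sections W),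
      φ.1 ⟨(A s).pt, hW hs⟩ = M.value f ⟨_, hs⟩ → (LPoint.ofPoint (M := M.bodyManifold) 0 (A s).pt).app U φ =
        algebraMap ℂ (Grassmann 0) (Grassmann.aug k ((A s).app W f)) := fun φ hs f e => by
    rw [LPoint.aug_app hs, ← e]
    exact LPoint.ofPoint_body_app (hW hs) φ
  have h1 := (((Algebra.linearMap ℂ (Grassmann 0)).toContinuousLinearMap.comp
    (Grassmann.augL k)).restrictScalars ℝ).hasFDerivAt.comp_hasDerivAt t (h.deriv t ht W hpW f)
  rw [key _ hpW (X.toFun W f) (X.underlying_apply φ hW f hf ⟨_, hpW⟩)]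
  refine h1.congr_of_eventuallyEq ?_
  filter_upwards [(h.cont t ht).eventually (W.isOpen.mem_nhds hpW)] with s hs
    using key φ hs f (hf ⟨_, hs⟩).symm

/-- The value of a section at an ordinary point depends only on the underlying function, so the
equation for sections follows from the one for functions. -/
theorem IsIntegral.ofBody {A : ℝ → LPoint M.body k} (h : IsIntegral X.underlying A S) :
    IsIntegral X (fun t => LPoint.ofPoint (M := M) 0 (A t).pt) S := by
  refine ⟨h.cont, fun t ht U hU f => ?_⟩
  have key : ∀ {s} (_ : (A s).pt ∈ U) (f : M.sections U), (LPoint.ofPoint (M := M) 0 (A s).pt).app U f =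
        algebraMap ℂ (Grassmann 0) (Grassmann.aug k ((A s).app U (M.toBody U f))) := fun hs f => by
    exact (LPoint.ofPoint_app hs f).trans (congrArg _ (LPoint.aug_body_app hs (M.toBody U f)).symm)
  have h1 := (((Algebra.linearMap ℂ (Grassmann 0)).toContinuousLinearMap.comp
    (Grassmann.augL k)).restrictScalars ℝ).hasFDerivAt.comp_hasDerivAt t (h.deriv t ht U hU (M.toBody U f))
  rw [X.underlying_toBody] at h1
  rw [key hU]
  refine h1.congr_of_eventuallyEq ?_
  filter_upwards [(h.cont t ht).eventually (U.isOpen.mem_nhds hU)] with s hs using key hs f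

theorem Reaches.toBody {A₀ A₁ : LPoint M.toRingedSuperspace k} (h : Reaches X A₀ t A₁) :
    Reaches (M := M.bodyManifold) X.underlying (LPoint.ofPoint (M := M.bodyManifold) 0 A₀.pt) t
      (LPoint.ofPoint (M := M.bodyManifold) 0 A₁.pt) := by
  obtain ⟨K, hK, hKc, h0, ht, A, hA, rfl, rfl⟩ := h
  exact ⟨K, hK, hKc, h0, ht, _, hA.toBody, rfl, rfl⟩

theorem Reaches.ofBody {A₀ A₁ : LPoint M.body k} (h : Reaches (M := M.bodyManifold) X.underlying A₀ t A₁) :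
    Reaches X (LPoint.ofPoint (M := M) 0 A₀.pt) t (LPoint.ofPoint (M := M) 0 A₁.pt) := by
  obtain ⟨K, hK, hKc, h0, ht, A, hA, rfl, rfl⟩ := h
  exact ⟨K, hK, hKc, h0, ht, _, hA.ofBody, rfl, rfl⟩

/-- Flow sets are defined by integral curves of ordinary points, and these pass in both directions
between the two manifolds. -/
theorem flowSet_underlying : flowSet (M := M.bodyManifold) X.underlying = flowSet X :=
  Set.ext fun _ => ⟨fun ⟨_, h⟩ => ⟨_, h.ofBody⟩, fun ⟨_, h⟩ => ⟨_, h.toBody⟩⟩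

theorem flowPt_underlying_pt (hX : X.IsReal) (h : (t, x) ∈ flowSet X) :
    (flowPt (M := M.bodyManifold) X.underlying (LPoint.ofPoint (M := M.bodyManifold) 0 x) t).pt =
      (flowPt X (LPoint.ofPoint 0 x) t).pt :=
  congrArg LPoint.pt ((reaches_flowPt hX.realField (A₀ := LPoint.ofPoint 0 x) h).toBody.flowPt_eq
    hX.realField_underlying)

theorem value_flowSection {hX : ∀ ψ : M.Parametrization, ψ.RealField X} (f : M.sections U)
    (h : x ∈ M.slice (flowPreimage hX U) t) :
    M.value (flowSection hX f t) ⟨x, h⟩ = M.value f ⟨(flowPt X (LPoint.ofPoint 0 x) t).pt, (mem_flowPreimage.1 h).2⟩ := by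
  rw [← LPoint.aug_app (M := M) (A := flowPt X (LPoint.ofPoint 0 x) t) (mem_flowPreimage.1 h).2,
    ← flowSection_app (hX := hX) (A := LPoint.ofPoint 0 x) f h, LPoint.aug_app (A := LPoint.ofPoint 0 x) h]
  rfl

/-- The underlying field is again real, so the maximal flow on the underlying manifold comes from
the same construction, and the two flows are compared pointwise through values. -/
theorem exists_underlying_flow (hX : X.IsReal) : ∃ Θ₀ : Hom (M.body.timeProduct.restrict (flowOpens hX.realField)) M.body,
    IsUnderlying (maximalFlow hX.realField) Θ₀ ∧ IsMaximalFlow X.underlying (flowOpens hX.realField) Θ₀ := by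
  -- The type of the morphism depends on its domain, and the two flow sets are equal only by a
  -- theorem. Quantifying over `V` lets this equality be substituted once, after the needed
  -- properties have been stated in terms of `V`.
  have key : ∀ V : Opens (ℝ × M.carrier), V = flowOpens (M := M.bodyManifold) hX.realField_underlying →
      ∃ Θ₀ : Hom (M.body.timeProduct.restrict V) M.body, IsMaximalFlow X.underlying V Θ₀ ∧
        (∀ p : V, Θ₀.base p =
          (flowPt (M := M.bodyManifold) X.underlying (LPoint.ofPoint (M := M.bodyManifold) 0 p.1.2) p.1.1).pt) ∧
        ∀ (U : Opens M.carrier) (φ : M.bodySections U) (t : ℝ) (x : M.carrier)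
          (h₀ : x ∈ M.body.slice (M.body.timeProduct.imageOpens V (Opens.comap Θ₀.base U)) t) (y : U),
          y.1 = (flowPt (M := M.bodyManifold) X.underlying (LPoint.ofPoint (M := M.bodyManifold) 0 x) t).pt →
          ((Θ₀.pullback U φ : M.body.timeSections _).1 t : M.bodySections _).1 ⟨x, h₀⟩ = φ.1 y := by
    rintro _ rfl
    refine ⟨maximalFlow (M := M.bodyManifold) hX.realField_underlying, isMaximalFlow_maximalFlow (M := M.bodyManifold) (X := X.underlying), fun _ => rfl, ?_⟩
    intro U φ t x h₀ y hy
    have h1 := value_flowSection (M := M.bodyManifold) (hX := hX.realField_underlying) φ h₀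
    exact (value_body (M := M) _ _).symm.trans (h1.trans ((value_body (M := M) _ _).trans (congrArg φ.1 (Subtype.ext hy.symm))))
  obtain ⟨Θ₀, hΘ₀, hb, hp⟩ := key (flowOpens hX.realField) (Opens.ext (flowSet_underlying (X := X)).symm)
  refine ⟨Θ₀, ⟨fun p => ?_, fun U f t x h h₀ => ?_⟩, hΘ₀⟩
  · rw [hb]
    exact flowPt_underlying_pt hX p.2
  · have h' : x ∈ M.slice (flowPreimage hX.realField U) t := h
    have hf := mem_flowPreimage.1 h'
    rw [hp U (M.toBody U f) t x h₀ ⟨_, hf.2⟩ (flowPt_underlying_pt hX hf.1).symm]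
    exact (value_flowSection f h').symm

end Body

end MixedSuper

end

theorem mainTheorem3 (M : MixedSupermanifold.{u, v}) (X : EvenVectorField M.toRingedSuperspace)
    (hX : X.IsReal) :
    ∃ (V : Opens (ℝ × M.carrier)) (Θ : Hom (M.timeProduct.restrict V) M.toRingedSuperspace),
      IsMaximalFlow X V Θ ∧
        ∃ Θ₀ : Hom (M.body.timeProduct.restrict V) M.body,
          IsUnderlying Θ Θ₀ ∧ IsMaximalFlow X.underlying V Θ₀ := by
  obtain ⟨Θ₀, h⟩ := exists_underlying_flow hX
  exact ⟨flowOpens hX.realField, maximalFlow hX.realField, isMaximalFlow_maximalFlow, Θ₀, h⟩
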